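/- Let $X$ be a normal projective variety over $\mathbb{C}$ and let $L$ be a very ample line bundle on $X$ which is projectively normal, i.e. the multiplication map $\mathrm{Sym}^k H^0(X,L)\to H^0(X,L^k)$ is surjective for every $k\ge 0$. Let $\mathrm{Aut}(X,L)$ be the group of automorphisms of the pair $(X,L)$ (automorphisms of $X$ over $\mathbb{C}$ together with a lift to $L$), acting linearly on $H^0(X,L^k)$. For a finite-dimensional $\mathrm{Aut}(X,L)$-module $V$ the Loewy filtration is defined by $\mathcal{F}_0V=V$ and, for $i>0$, by letting $\mathcal{F}_iV$ be the smallest submodule of $\mathcal{F}_{i-1}V$ such that $\mathcal{F}_{i-1}V/\mathcal{F}_iV$ is semisimple; the Loewy length $\ell\ell(V)$ is the largest $i$ with $\mathcal{F}_iV\neq 0$ (and $0$ if $V=0$). Write $\ell\ell(k)=\ell\ell(H^0(X,L^k))$ and $C=h^0(L)=\dim H^0(X,L)$. Then $$\ell\ell(k)\le Ck\qquad\text{for all } k\ge 0,$$ and the Loewy filtration is linearly right bounded with this constant: $\mathcal{F}_{Ck}H^0(X,L^k)=0$ for all $k\ge 1$. -/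

import Mathlib

open CategoryTheory AlgebraicGeometry TopologicalSpace Opposite

noncomputable section

/-! ### The Loewy (radical) filtration of a module -/

/-- The Loewy filtration of an `A`-module `M`: `F 0 = M`, and `F (i + 1)` is the smallest
submodule of `F i` such that `F i / F (i + 1)` is semisimple (it is written as the intersection
of all submodules `N` of `F i` with `F i / N` semisimple; see `loewyFiltration_isLeast`). -/
def loewyFiltration (A M : Type*) [Ring A] [AddCommGroup M] [Module A M] : ℕ → Submodule A M
  | 0 => ⊤
  | i + 1 => sInf {N | N ≤ loewyFiltration A M i ∧
      IsSemisimpleModule A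
        (↥(loewyFiltration A M i) ⧸ N.submoduleOf (loewyFiltration A M i))}

/-- The Loewy length: the maximal `i` such that `F i` is non-zero (and `⊤` if there is no
bound on such `i`). -/
def loewyLength (A M : Type*) [Ring A] [AddCommGroup M] [Module A M] : ℕ∞ :=
  ⨆ i ∈ {i : ℕ | loewyFiltration A M i ≠ ⊥}, (i : ℕ∞)

theorem isSemisimpleModule_quotient_inf {A M : Type*} [Ring A] [AddCommGroup M] [Module A M]
    (N₁ N₂ : Submodule A M) [IsSemisimpleModule A (M ⧸ N₁)] [IsSemisimpleModule A (M ⧸ N₂)] :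
    IsSemisimpleModule A (M ⧸ (N₁ ⊓ N₂)) := by
  let N : Bool → Submodule A M := fun b ↦ cond b N₁ N₂
  have : ∀ b, IsSemisimpleModule A (M ⧸ N b) := by
    rintro (_ | _) <;> simpa [N]
  have hN : N₁ ⊓ N₂ = LinearMap.ker (LinearMap.pi fun b ↦ (N b).mkQ) := by
    ext x
    simp [N, LinearMap.mem_ker, funext_iff, and_comm]
  rw [hN]
  exact IsSemisimpleModule.of_injective
    ((LinearMap.ker (LinearMap.pi fun b ↦ (N b).mkQ)).liftQ _ le_rfl)
    (LinearMap.ker_eq_bot.mp (Submodule.ker_liftQ_eq_bot _ _ _ le_rfl))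

/-- For an Artinian module (e.g. a finite-dimensional representation) the smallest submodule
in the definition of the Loewy filtration exists. -/
theorem loewyFiltration_isLeast (A M : Type*) [Ring A] [AddCommGroup M] [Module A M]
    [IsArtinian A M] (i : ℕ) :
    IsLeast {N | N ≤ loewyFiltration A M i ∧
      IsSemisimpleModule A
        (↥(loewyFiltration A M i) ⧸ N.submoduleOf (loewyFiltration A M i))}
      (loewyFiltration A M (i + 1)) := by
  set F := loewyFiltration A M i with hF
  set S : Set (Submodule A M) := {N | N ≤ F ∧ IsSemisimpleModule A (↥F ⧸ N.submoduleOf F)}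
    with hS
  have hlast : loewyFiltration A M (i + 1) = sInf S := rfl
  rw [hlast]
  have hne : S.Nonempty := by
    refine ⟨F, le_rfl, ?_⟩
    have : Subsingleton (↥F ⧸ F.submoduleOf F) := by
      rw [Submodule.submoduleOf_self]
      exact Submodule.Quotient.subsingleton_iff.mpr rfl
    exact { exists_isCompl := fun N ↦ ⟨⊥, disjoint_bot_right, codisjoint_iff.mpr
      (Subsingleton.elim _ _)⟩ }
  obtain ⟨N, hN, hmin⟩ := IsArtinian.set_has_minimal S hne
  have hle : ∀ N' ∈ S, N ≤ N' := by
    intro N' hN'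
    by_contra hcon
    refine hmin (N ⊓ N') ⟨inf_le_left.trans hN.1, ?_⟩ (inf_lt_left.mpr hcon)
    have h1 := hN.2
    have h2 := hN'.2
    exact isSemisimpleModule_quotient_inf (N.submoduleOf F) (N'.submoduleOf F)
  have : sInf S = N := le_antisymm (sInf_le hN) (le_sInf hle)
  rw [this]
  exact ⟨hN, hle⟩

/-! ### Pairs `(X, L)` over `ℂ` and their automorphisms -/

/-- A pair `(X, L)`: a scheme over `ℂ` with a sheaf of modules on it. -/
structure SchemePair where
  X : Scheme.{0}
  str : X ⟶ Spec (CommRingCat.of ℂ)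
  L : X.Modules

namespace SchemePair

/-- A morphism `(X, L) ⟶ (Y, M)`: a morphism `f : X ⟶ Y` over `ℂ` with a morphism
`M ⟶ f_* L` of `𝒪_Y`-modules. -/
structure Hom (P Q : SchemePair) where
  base : P.X ⟶ Q.X
  w : base ≫ Q.str = P.str
  map : Q.L ⟶ (Scheme.Modules.pushforward base).obj P.L

/-- The action of a morphism `(X, L) ⟶ (Y, M)` on sections, `Γ(M, U) → Γ(L, f⁻¹ U)`. -/
def Hom.onSections {P Q : SchemePair} (φ : Hom P Q) (U : Q.X.Opens) (s : Γ(Q.L, U)) :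
    Γ(P.L, φ.base ⁻¹ᵁ U) :=
  φ.map.app U s

theorem Hom.ext' {P Q : SchemePair} {φ ψ : Hom P Q} (h : φ.base = ψ.base)
    (h' : ∀ (U : Q.X.Opens) (s : Γ(Q.L, U)), φ.onSections U s =
      P.L.presheaf.map (homOfLE (h ▸ le_rfl : φ.base ⁻¹ᵁ U ≤ ψ.base ⁻¹ᵁ U)).op
        (ψ.onSections U s)) : φ = ψ := by
  obtain ⟨f, w, a⟩ := φ
  obtain ⟨g, w', b⟩ := ψ
  obtain rfl : f = g := h
  congr 1
  ext U s
  refine (h' U s).trans ?_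
  have : (homOfLE (le_refl (f ⁻¹ᵁ U))).op = 𝟙 _ := rfl
  exact congr($(P.L.presheaf.map_id _) _)

theorem Hom.onSections_congr {P Q : SchemePair} {φ ψ : Hom P Q} (h : φ = ψ) (U : Q.X.Opens)
    (s : Γ(Q.L, U)) : φ.onSections U s =
      P.L.presheaf.map (homOfLE (h ▸ le_rfl : φ.base ⁻¹ᵁ U ≤ ψ.base ⁻¹ᵁ U)).op
        (ψ.onSections U s) := by
  subst h
  exact congr($(P.L.presheaf.map_id _) _).symm

instance : Category SchemePair where
  Hom := Hom
  id P := ⟨𝟙 P.X, Category.id_comp _, (Scheme.Modules.pushforwardId P.X).inv.app P.L⟩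
  comp {P Q R} φ ψ := ⟨φ.base ≫ ψ.base, by rw [Category.assoc, ψ.w, φ.w],
    ψ.map ≫ (Scheme.Modules.pushforward ψ.base).map φ.map ≫
      (Scheme.Modules.pushforwardComp φ.base ψ.base).hom.app P.L⟩
  id_comp {P Q} φ := Hom.ext' (Category.id_comp _) fun U s ↦ by
    exact congr($(P.L.presheaf.map_id _) _).symm
  comp_id {P Q} φ := Hom.ext' (Category.comp_id _) fun U s ↦ by
    exact congr($(P.L.presheaf.map_id _) _).symm
  assoc {P Q R S} φ ψ χ := Hom.ext' (Category.assoc _ _ _) fun U s ↦ by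
    exact congr($(P.L.presheaf.map_id _) _).symm

theorem comp_base {P Q R : SchemePair} (φ : P ⟶ Q) (ψ : Q ⟶ R) :
    Hom.base (φ ≫ ψ) = Hom.base φ ≫ Hom.base ψ := rfl

theorem id_base (P : SchemePair) : Hom.base (𝟙 P) = 𝟙 P.X := rfl

theorem comp_onSections {P Q R : SchemePair} (φ : P ⟶ Q) (ψ : Q ⟶ R) (U : R.X.Opens)
    (s : Γ(R.L, U)) : Hom.onSections (φ ≫ ψ) U s =
      Hom.onSections φ (Hom.base ψ ⁻¹ᵁ U) (Hom.onSections ψ U s) := rfl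

theorem id_onSections (P : SchemePair) (U : P.X.Opens) (s : Γ(P.L, U)) :
    Hom.onSections (𝟙 P) U s = s := rfl

instance isIso_base {P Q : SchemePair} (φ : P ≅ Q) : IsIso (Hom.base φ.hom) :=
  ⟨Hom.base φ.inv, congr(Hom.base $(φ.hom_inv_id)), congr(Hom.base $(φ.inv_hom_id))⟩

theorem map_bijective_of_eq {X : Scheme.{0}} (L : X.Modules) {U V : X.Opens} (h : V ≤ U)
    (h' : V = U) : Function.Bijective (L.presheaf.map (homOfLE h).op) := by
  subst h'
  rw [show (homOfLE h).op = 𝟙 _ from rfl, L.presheaf.map_id]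
  exact Function.bijective_id

theorem onSections_comp_bijective {P Q : SchemePair} (φ : P ≅ Q) (U : Q.X.Opens) :
    Function.Bijective
      (Hom.onSections φ.inv (Hom.base φ.hom ⁻¹ᵁ U) ∘ Hom.onSections φ.hom U) := by
  have h := Hom.onSections_congr φ.inv_hom_id U
  have h2 : Hom.base (φ.inv ≫ φ.hom) ⁻¹ᵁ U = Hom.base (𝟙 Q) ⁻¹ᵁ U := by rw [φ.inv_hom_id]
  have h3 := map_bijective_of_eq Q.L h2.le h2
  rwa [show (Q.L.presheaf.map (homOfLE h2.le).op : _ → _) =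
    Hom.onSections φ.inv (Hom.base φ.hom ⁻¹ᵁ U) ∘ Hom.onSections φ.hom U from
      funext fun s ↦ (h s).symm] at h3

theorem onSections_bijective {P Q : SchemePair} (φ : P ≅ Q) (U : Q.X.Opens) :
    Function.Bijective (Hom.onSections φ.hom U) := by
  refine ⟨(onSections_comp_bijective φ U).1.of_comp, ?_⟩
  have h2 : Hom.base φ.inv ⁻¹ᵁ (Hom.base φ.hom ⁻¹ᵁ U) = U := by
    change Hom.base (φ.inv ≫ φ.hom) ⁻¹ᵁ U = U
    rw [φ.inv_hom_id]
    rfl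
  have key : ∀ W, W = U → Function.Surjective (Hom.onSections φ.hom W) →
      Function.Surjective (Hom.onSections φ.hom U) := by
    rintro W rfl h
    exact h
  exact key _ h2 (onSections_comp_bijective φ.symm (Hom.base φ.hom ⁻¹ᵁ U)).2.of_comp

theorem onSections_restrict {P Q : SchemePair} (φ : P ⟶ Q) {U V : Q.X.Opens} (h : V ≤ U)
    (s : Γ(Q.L, U)) : Hom.onSections φ V (Q.L.presheaf.map (homOfLE h).op s) =
      P.L.presheaf.map (homOfLE ((Hom.base φ).preimage_mono h)).op (Hom.onSections φ U s) :=
  congr($((Hom.map φ).mapPresheaf.naturality (homOfLE h).op) s)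

theorem onSections_smul {P Q : SchemePair} (φ : P ⟶ Q) (U : Q.X.Opens) (a : Γ(Q.X, U))
    (s : Γ(Q.L, U)) : Hom.onSections φ U (a • s) =
      (Hom.base φ).app U a • Hom.onSections φ U s :=
  (Hom.map φ).app_smul a s

/-- The `ℂ`-algebra structure on the ring of regular functions on an open subset. -/
instance (P : SchemePair) (U : P.X.Opens) : Algebra ℂ Γ(P.X, U) :=
  ((Scheme.ΓSpecIso (CommRingCat.of ℂ)).inv ≫ P.str.appTop ≫
    P.X.presheaf.map (homOfLE le_top).op).hom.toAlgebra

theorem algebraMap_def (P : SchemePair) (U : P.X.Opens) (c : ℂ) :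
    algebraMap ℂ Γ(P.X, U) c = P.X.presheaf.map (homOfLE le_top).op
      (P.str.appTop ((Scheme.ΓSpecIso (CommRingCat.of ℂ)).inv c)) := rfl

theorem map_algebraMap (P : SchemePair) {U V : P.X.Opens} (h : V ≤ U) (c : ℂ) :
    P.X.presheaf.map (homOfLE h).op (algebraMap ℂ Γ(P.X, U) c) = algebraMap ℂ Γ(P.X, V) c := by
  rw [algebraMap_def, algebraMap_def, ← CommRingCat.comp_apply, ← Functor.map_comp]
  rfl

theorem app_algebraMap {P Q : SchemePair} (φ : P ⟶ Q) (U : Q.X.Opens) (c : ℂ) :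
    (Hom.base φ).app U (algebraMap ℂ Γ(Q.X, U) c) = algebraMap ℂ Γ(P.X, _) c := by
  have h : ∀ (f : P.X ⟶ Spec (CommRingCat.of ℂ)), f = P.str →
      ∀ z, f.appTop z = P.str.appTop z := by
    rintro f rfl z
    rfl
  rw [algebraMap_def, algebraMap_def, ← h _ (Hom.w φ), Scheme.Hom.comp_appTop,
    ← CommRingCat.comp_apply, Scheme.Hom.naturality]
  rfl

/-- Pull-back of functions along an isomorphism of pairs, `𝒪_Y(U) ≃ 𝒪_X(f⁻¹ U)`. -/
def pullbackFun {P Q : SchemePair} (φ : P ≅ Q) (U : Q.X.Opens) :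
    Γ(Q.X, U) ≃ₐ[ℂ] Γ(P.X, Hom.base φ.hom ⁻¹ᵁ U) :=
  AlgEquiv.ofBijective ⟨((Hom.base φ.hom).app U).hom, app_algebraMap φ.hom U⟩
    (ConcreteCategory.bijective_of_isIso ((Hom.base φ.hom).app U))

theorem pullbackFun_apply {P Q : SchemePair} (φ : P ≅ Q) (U : Q.X.Opens) (a : Γ(Q.X, U)) :
    pullbackFun φ U a = (Hom.base φ.hom).app U a := rfl

/-! ### Line bundles, their powers and global sections -/

/-- A section `e` of `L` over `U` is a frame if it generates `L` freely over `U`, i.e. if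
`𝒪_U → L|_U`, `a ↦ a e`, is an isomorphism. -/
def IsFrame {X : Scheme.{0}} (L : X.Modules) (U : X.Opens) (e : Γ(L, U)) : Prop :=
  ∀ (V : X.Opens) (h : V ≤ U), Function.Bijective
    fun a : Γ(X, V) ↦ a • (L.presheaf.map (homOfLE h).op e : Γ(L, V))

/-- `L` is a line bundle (invertible sheaf): it has a frame locally around every point. -/
def IsLineBundle {X : Scheme.{0}} (L : X.Modules) : Prop :=
  ∀ x : X, ∃ U : X.Opens, x ∈ U ∧ ∃ e : Γ(L, U), IsFrame L U e

theorem IsFrame.restrict {X : Scheme.{0}} {L : X.Modules} {U : X.Opens} {e : Γ(L, U)}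
    (he : IsFrame L U e) (V : X.Opens) (h : V ≤ U) :
    IsFrame L V (L.presheaf.map (homOfLE h).op e) := by
  intro W hW
  have := he W (hW.trans h)
  rwa [show (homOfLE (hW.trans h)).op = (homOfLE h).op ≫ (homOfLE hW).op from rfl,
    Functor.map_comp] at this

theorem IsFrame.smul {X : Scheme.{0}} {L : X.Modules} {U : X.Opens} {e : Γ(L, U)}
    (he : IsFrame L U e) (u : Γ(X, U)ˣ) : IsFrame L U ((u : Γ(X, U)) • e) := by
  intro V h
  have h1 := he V h
  have hu : IsUnit (X.presheaf.map (homOfLE h).op (u : Γ(X, U))) :=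
    u.isUnit.map (X.presheaf.map (homOfLE h).op).hom
  have : (fun a : Γ(X, V) ↦ a • (L.presheaf.map (homOfLE h).op ((u : Γ(X, U)) • e) :
      Γ(L, V))) = (fun a : Γ(X, V) ↦ a • (L.presheaf.map (homOfLE h).op e : Γ(L, V))) ∘
      fun a ↦ a * X.presheaf.map (homOfLE h).op (u : Γ(X, U)) := by
    funext a
    rw [Function.comp_apply, mul_smul, Scheme.Modules.map_smul]
  rw [this]
  exact h1.comp (IsUnit.isUnit_iff_mulRight_bijective.mp hu)

/-- Isomorphisms of pairs take frames to frames. -/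
theorem IsFrame.image {P Q : SchemePair} (φ : P ≅ Q) {U : Q.X.Opens} {e : Γ(Q.L, U)}
    (he : IsFrame Q.L U e) :
    IsFrame P.L (Hom.base φ.hom ⁻¹ᵁ U) (Hom.onSections φ.hom U e) := by
  intro V h
  obtain ⟨W, rfl⟩ : ∃ W, V = Hom.base φ.hom ⁻¹ᵁ W := by
    refine ⟨Hom.base φ.inv ⁻¹ᵁ V, ?_⟩
    change V = Hom.base (φ.hom ≫ φ.inv) ⁻¹ᵁ V
    rw [φ.hom_inv_id]
    rfl
  have hW : W ≤ U := by
    intro x hx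
    obtain ⟨y, rfl⟩ := (Hom.base φ.hom).surjective x
    exact h hx
  have : (fun a : Γ(P.X, Hom.base φ.hom ⁻¹ᵁ W) ↦
      a • (P.L.presheaf.map (homOfLE h).op (Hom.onSections φ.hom U e) : Γ(P.L, _))) ∘
      pullbackFun φ W = Hom.onSections φ.hom W ∘
        fun a : Γ(Q.X, W) ↦ a • (Q.L.presheaf.map (homOfLE hW).op e : Γ(Q.L, W)) := by
    funext a
    rw [Function.comp_apply, Function.comp_apply, onSections_smul, onSections_restrict]
    rfl
  have h2 := (onSections_bijective φ W).comp (he W hW)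
  rw [← this] at h2
  exact (Function.Bijective.of_comp_iff _ (pullbackFun φ W).bijective).mp h2

/-- The local frames of `L` over `U`. -/
def Frames {X : Scheme.{0}} (L : X.Modules) (U : X.Opens) : Type :=
  {e : Γ(L, U) // IsFrame L U e}

/-- The restriction of a frame to a smaller open subset. -/
def Frames.restrict {X : Scheme.{0}} {L : X.Modules} {U V : X.Opens} (h : V ≤ U)
    (e : Frames L U) : Frames L V :=
  ⟨_, e.2.restrict V h⟩

/-- The frame `u e`, for a frame `e` and a nowhere vanishing function `u`. -/
def Frames.smul {X : Scheme.{0}} {L : X.Modules} {U : X.Opens} (u : Γ(X, U)ˣ)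
    (e : Frames L U) : Frames L U :=
  ⟨_, e.2.smul u⟩

/-- The image `φ(e)` of a frame under an isomorphism of pairs. -/
def Frames.image {P Q : SchemePair} (φ : P ≅ Q) {U : Q.X.Opens} (e : Frames Q.L U) :
    Frames P.L (Hom.base φ.hom ⁻¹ᵁ U) :=
  ⟨_, e.2.image φ⟩

/-- The space of global sections `H⁰(X, L^k)` of the `k`-th tensor power of the line bundle `L`.
A section `t` of `L^k` is described by its coefficients with respect to the local frames of `L`:
for each open subset `U` and each frame `e` of `L` over `U`, the coefficient `t U e` is the
function on `U` with `t = t U e • e^k` on `U`. The coefficients are compatible with restriction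
and satisfy `t U e = u ^ k * t U (u e)` for every nowhere vanishing function `u` on `U`. -/
def H0 (P : SchemePair) (k : ℕ) : Submodule ℂ (∀ U : P.X.Opens, Frames P.L U → Γ(P.X, U)) where
  carrier := {t |
    (∀ (U V : P.X.Opens) (h : V ≤ U) (e : Frames P.L U),
      t V (e.restrict h) = P.X.presheaf.map (homOfLE h).op (t U e)) ∧
    ∀ (U : P.X.Opens) (e : Frames P.L U) (u : Γ(P.X, U)ˣ),
      t U e = (u : Γ(P.X, U)) ^ k * t U (e.smul u)}
  add_mem' := by
    rintro s t ⟨hs, hs'⟩ ⟨ht, ht'⟩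
    refine ⟨fun U V h e ↦ ?_, fun U e u ↦ ?_⟩
    · simp only [Pi.add_apply, hs U V h e, ht U V h e, map_add]
    · simp only [Pi.add_apply, mul_add]
      rw [← hs' U e u, ← ht' U e u]
  zero_mem' := ⟨fun U V h e ↦ (map_zero _).symm, fun U e u ↦ (mul_zero _).symm⟩
  smul_mem' := by
    rintro c t ⟨ht, ht'⟩
    refine ⟨fun U V h e ↦ ?_, fun U e u ↦ ?_⟩
    · simp only [Pi.smul_apply, ht U V h e, Algebra.smul_def, map_mul, map_algebraMap]
    · simp only [Pi.smul_apply, mul_smul_comm]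
      rw [← ht' U e u]

/-- The product `s₁ ⋯ s_k ∈ H⁰(X, L^k)` of sections `s₁, …, s_k ∈ H⁰(X, L)`. -/
def prodSections (P : SchemePair) (k : ℕ) (s : Fin k → P.H0 1) : P.H0 k :=
  ⟨fun U e ↦ ∏ i, (s i).1 U e, fun U V h e ↦ by
    rw [map_prod]
    exact Finset.prod_congr rfl fun i _ ↦ (s i).2.1 U V h e, fun U e u ↦ by
    have : ∀ i, (s i).1 U e = (u : Γ(P.X, U)) * (s i).1 U (e.smul u) := fun i ↦ by
      simpa using (s i).2.2 U e u
    refine (Finset.prod_congr rfl fun i _ ↦ this i).trans ?_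
    rw [Finset.prod_mul_distrib]
    simp⟩

/-- `h⁰(L) = dim H⁰(X, L)`. -/
def h0 (P : SchemePair) : ℕ := Module.finrank ℂ (P.H0 1)

/-- The linear action of `Aut(X, L)` on `H⁰(X, L^k)`. If `(f, φ)` is an automorphism, so that
`φ : L ≅ f_* L`, a section with coefficient `a` with respect to the frame `φ(e)` of `L` over
`f⁻¹ U` is sent to the section with coefficient `(f^*)⁻¹ a` with respect to the
frame `e` over `U`. -/
def autAction (P : SchemePair) (k : ℕ) : Representation ℂ (Aut P) (P.H0 k) where
  toFun g :=
    { toFun t := ⟨fun U e ↦ (pullbackFun g U).symm (t.1 _ (e.image g)), by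
        refine ⟨fun U V h e ↦ ?_, fun U e u ↦ ?_⟩
        · refine (AlgEquiv.symm_apply_eq _).mpr ?_
          have h1 := t.2.1 _ _ ((Hom.base g.hom).preimage_mono h) (e.image g)
          have h2 : (e.restrict h).image g =
              (e.image g).restrict ((Hom.base g.hom).preimage_mono h) :=
            Subtype.ext (onSections_restrict g.hom h e.1)
          have h3 : ∀ a, pullbackFun g V (P.X.presheaf.map (homOfLE h).op a) =
              P.X.presheaf.map (homOfLE ((Hom.base g.hom).preimage_mono h)).op
                (pullbackFun g U a) := fun a ↦
            congr($((Hom.base g.hom).naturality (homOfLE h).op) a)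
          rw [h3, AlgEquiv.apply_symm_apply, h2, h1]
        · refine (AlgEquiv.symm_apply_eq _).mpr ?_
          have h1 := t.2.2 _ (e.image g) (Units.map (pullbackFun g U : _ →* _) u)
          have h2 : (e.smul u).image g =
              (e.image g).smul (Units.map (pullbackFun g U : _ →* _) u) :=
            Subtype.ext (onSections_smul g.hom U u.1 e.1)
          rw [map_mul, map_pow, AlgEquiv.apply_symm_apply, h2]
          exact h1⟩
      map_add' s t := Subtype.ext (funext fun U ↦ funext fun e ↦
        map_add (pullbackFun g U).symm _ _)
      map_smul' c t := Subtype.ext (funext fun U ↦ funext fun e ↦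
        map_smul (pullbackFun g U).symm _ _) }
  map_one' := by
    refine LinearMap.ext fun t ↦ Subtype.ext (funext fun U ↦ funext fun e ↦ ?_)
    exact (AlgEquiv.symm_apply_eq _).mpr rfl
  map_mul' g h := by
    refine LinearMap.ext fun t ↦ Subtype.ext (funext fun U ↦ funext fun e ↦ ?_)
    refine (AlgEquiv.symm_apply_eq _).mpr ?_
    change t.1 _ (e.image (g * h)) = pullbackFun h _ (pullbackFun g U
      ((pullbackFun g U).symm ((pullbackFun h _).symm (t.1 _ ((e.image g).image h)))))
    rw [AlgEquiv.apply_symm_apply, AlgEquiv.apply_symm_apply]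
    rfl

/-- The section of `L = L^1` in the above sense given by a global section `s` of the sheaf `L`:
its coefficient with respect to `e` is the function `a` with `a e = s`. -/
def ofGlobal (P : SchemePair) (s : Γ(P.L, ⊤)) : P.H0 1 :=
  have key : ∀ (U : P.X.Opens) (e : Frames P.L U), ∃! a : Γ(P.X, U),
      a • e.1 = (P.L.presheaf.map (homOfLE le_top).op s : Γ(P.L, U)) := fun U e ↦ by
    have h := (e.2 U le_rfl).existsUnique (P.L.presheaf.map (homOfLE le_top).op s)
    rwa [show (homOfLE (le_refl U)).op = 𝟙 _ from rfl, P.L.presheaf.map_id] at h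
  ⟨fun U e ↦ (key U e).choose, by
    refine ⟨fun U V h e ↦ ?_, fun U e u ↦ ?_⟩
    · refine (key V (e.restrict h)).unique (key V (e.restrict h)).choose_spec.1 ?_
      have h1 := congr(P.L.presheaf.map (homOfLE h).op $((key U e).choose_spec.1))
      rw [Scheme.Modules.map_smul] at h1
      refine h1.trans ?_
      rw [← ConcreteCategory.comp_apply, ← Functor.map_comp]
      rfl
    · refine (key U e).unique (key U e).choose_spec.1 ?_
      refine Eq.trans ?_ (key U (e.smul u)).choose_spec.1
      rw [pow_one, mul_comm, mul_smul]
      rfl⟩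

theorem ofGlobal_smul (P : SchemePair) (s : Γ(P.L, ⊤)) (U : P.X.Opens) (e : Frames P.L U) :
    (P.ofGlobal s).1 U e • e.1 = (P.L.presheaf.map (homOfLE le_top).op s : Γ(P.L, U)) := by
  have h := (e.2 U le_rfl).existsUnique (P.L.presheaf.map (homOfLE le_top).op s)
  rw [show (homOfLE (le_refl U)).op = 𝟙 _ from rfl, P.L.presheaf.map_id] at h
  exact h.choose_spec.1

/-- For a line bundle, the space `H⁰(X, L^1)` defined by coefficients is the space of global
sections of the sheaf `L`. -/
theorem ofGlobal_bijective (P : SchemePair) (hL : IsLineBundle P.L) :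
    Function.Bijective P.ofGlobal := by
  choose U hxU e he using hL
  have hcov : (⊤ : P.X.Opens) ≤ iSup U := fun x _ ↦ Opens.mem_iSup.mpr ⟨x, hxU x⟩
  have res : ∀ {W V T : P.X.Opens} (h : V ≤ W) (h' : T ≤ V) (z : Γ(P.L, W)),
      P.L.presheaf.map (homOfLE h').op (P.L.presheaf.map (homOfLE h).op z) =
        P.L.presheaf.map (homOfLE (h'.trans h)).op z := fun h h' z ↦ by
    rw [← ConcreteCategory.comp_apply, ← Functor.map_comp]
    rfl
  -- independence of `t W f • f` of the frame `f`
  have indep : ∀ (t : P.H0 1) (W : P.X.Opens) (f g : Frames P.L W),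
      t.1 W f • f.1 = t.1 W g • g.1 := by
    intro t W f g
    have bij : ∀ f : Frames P.L W, Function.Bijective fun a : Γ(P.X, W) ↦ a • f.1 := fun f ↦ by
      have h := f.2 W le_rfl
      rwa [show (homOfLE (le_refl W)).op = 𝟙 _ from rfl, P.L.presheaf.map_id] at h
    obtain ⟨a, ha⟩ := (bij f).2 g.1
    obtain ⟨b, hb⟩ := (bij g).2 f.1
    have hab : b * a = 1 := (bij f).1 (by
      change (b * a) • f.1 = (1 : Γ(P.X, W)) • f.1
      rw [mul_smul, one_smul]
      exact (congrArg (b • ·) ha).trans hb)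
    let u : Γ(P.X, W)ˣ := ⟨a, b, by rw [mul_comm, hab], hab⟩
    have hg : g = f.smul u := Subtype.ext ha.symm
    rw [t.2.2 W f u, ← hg, pow_one, ← show a • f.1 = g.1 from ha, ← mul_smul, mul_comm]
  have restr : ∀ (t : P.H0 1) (W V : P.X.Opens) (h : V ≤ W) (f : Frames P.L W),
      P.L.presheaf.map (homOfLE h).op (t.1 W f • f.1) =
        t.1 V (f.restrict h) • (f.restrict h).1 := by
    intro t W V h f
    rw [Scheme.Modules.map_smul, t.2.1 W V h f]
    rfl
  constructor
  · intro s s' hs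
    refine TopCat.Sheaf.eq_of_locally_eq' ⟨_, P.L.isSheaf⟩ U ⊤ (fun x ↦ homOfLE le_top) hcov
      s s' fun x ↦ ?_
    have h1 := ofGlobal_smul P s (U x) ⟨e x, he x⟩
    have h2 := ofGlobal_smul P s' (U x) ⟨e x, he x⟩
    rw [hs] at h1
    exact h1.symm.trans h2
  · intro t
    obtain ⟨s, hs, -⟩ := TopCat.Sheaf.existsUnique_gluing' ⟨_, P.L.isSheaf⟩ U ⊤
      (fun x ↦ homOfLE le_top) hcov
      (fun x ↦ (t.1 (U x) ⟨e x, he x⟩ • e x : Γ(P.L, U x))) (fun x y ↦ by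
        exact (restr t (U x) (U x ⊓ U y) inf_le_left ⟨e x, he x⟩).trans
          ((indep t _ _ _).trans
            (restr t (U y) (U x ⊓ U y) inf_le_right ⟨e y, he y⟩).symm))
    have hs' : ∀ x, P.L.presheaf.map (homOfLE le_top).op s =
      (t.1 (U x) ⟨e x, he x⟩ • e x : Γ(P.L, U x)) := hs
    refine ⟨s, Subtype.ext (funext fun V ↦ funext fun f ↦ ?_)⟩
    have bij := f.2 V le_rfl
    rw [show (homOfLE (le_refl V)).op = 𝟙 _ from rfl, P.L.presheaf.map_id] at bij
    refine bij.1 ((ofGlobal_smul P s V f).trans ?_)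
    refine TopCat.Sheaf.eq_of_locally_eq' ⟨_, P.L.isSheaf⟩ (fun x ↦ V ⊓ U x) V
      (fun x ↦ homOfLE inf_le_left) (fun x hx ↦ Opens.mem_iSup.mpr ⟨x, hx, hxU x⟩) _ _
      fun x ↦ ?_
    refine (res le_top inf_le_left s).trans (Eq.trans ?_
      (restr t V (V ⊓ U x) inf_le_left f).symm)
    refine (res le_top (inf_le_right : V ⊓ U x ≤ U x) s).symm.trans ?_
    rw [hs' x]
    exact (restr t (U x) (V ⊓ U x) inf_le_right ⟨e x, he x⟩).trans (indep t _ _ _)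

instance (n : ℕ) : GradedAlgebra (MvPolynomial.homogeneousSubmodule (Fin (n + 1)) ℂ) :=
  MvPolynomial.gradedAlgebra

/-- The projective space `ℙⁿ` over `ℂ` with homogeneous coordinates `x₀, …, xₙ`. -/
abbrev projSpace (n : ℕ) : Scheme.{0} :=
  Proj (MvPolynomial.homogeneousSubmodule (Fin (n + 1)) ℂ)

/-- The structure morphism `ℙⁿ ⟶ Spec ℂ`. -/
def projSpaceStr (n : ℕ) : projSpace n ⟶ Spec (CommRingCat.of ℂ) :=
  Proj.toSpecZero _ ≫ Spec.map (CommRingCat.ofHom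
    (algebraMap ℂ (MvPolynomial.homogeneousSubmodule (Fin (n + 1)) ℂ 0)))

/-- The standard open subset `{x_j ≠ 0}` of `ℙⁿ`. -/
def projChart (n : ℕ) (j : Fin (n + 1)) : (projSpace n).Opens :=
  Proj.basicOpen _ (MvPolynomial.X j)

/-- The regular function `x_l / x_j` on the open subset `{x_j ≠ 0}` of `ℙⁿ`. -/
def projRatio (n : ℕ) (l j : Fin (n + 1)) : Γ(projSpace n, projChart n j) :=
  Proj.awayToSection (MvPolynomial.homogeneousSubmodule (Fin (n + 1)) ℂ) (MvPolynomial.X j)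
    (HomogeneousLocalization.Away.mk _ (MvPolynomial.isHomogeneous_X ℂ j) 1
      (MvPolynomial.X l) (MvPolynomial.isHomogeneous_X ℂ l))

/-- `L` is very ample: there is a closed immersion `i : X ⟶ ℙⁿ` over `ℂ` with `L ≅ i^* 𝒪(1)`.
The latter is expressed by giving the sections `s_j` of `L` that correspond to `i^* x_j`:
`s_j` is a frame of `L` over the preimage of `{x_j ≠ 0}`, and `s_l = i^*(x_l / x_j) s_j` there. -/
def IsVeryAmple (P : SchemePair) : Prop :=
  ∃ (n : ℕ) (i : P.X ⟶ projSpace n) (s : Fin (n + 1) → Γ(P.L, ⊤)),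
    IsClosedImmersion i ∧ i ≫ projSpaceStr n = P.str ∧
    ∀ j : Fin (n + 1),
      IsFrame P.L (i ⁻¹ᵁ projChart n j) (P.L.presheaf.map (homOfLE le_top).op (s j)) ∧
      ∀ l : Fin (n + 1),
        (P.L.presheaf.map (homOfLE le_top).op (s l) : Γ(P.L, i ⁻¹ᵁ projChart n j)) =
          i.app (projChart n j) (projRatio n l j) •
            (P.L.presheaf.map (homOfLE le_top).op (s j) : Γ(P.L, i ⁻¹ᵁ projChart n j))

/-- `L` is projectively normal: for every `k`, the multiplication map
`Sym^k H⁰(X, L) → H⁰(X, L^k)` is surjective, i.e. the `k`-fold products of sections of `L` span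
`H⁰(X, L^k)`. -/
def IsProjectivelyNormal (P : SchemePair) : Prop :=
  ∀ k : ℕ, Submodule.span ℂ (Set.range (P.prodSections k)) = ⊤

/-- `(X, L)` is a normal (irreducible, reduced) projective variety over `ℂ` together with a very
ample line bundle. -/
structure IsPolarisedVariety (P : SchemePair) : Prop where
  isIntegral : IsIntegral P.X
  isNormal : ∀ x : P.X, IsIntegrallyClosed (P.X.presheaf.stalk x)
  isLineBundle : IsLineBundle P.L
  isVeryAmple : P.IsVeryAmple

/-- The `i`-th step of the Loewy filtration of the `Aut(X, L)`-module `H⁰(X, L^k)`. -/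
def loewy (P : SchemePair) (k i : ℕ) :
    Submodule (MonoidAlgebra ℂ (Aut P)) (P.autAction k).asModule :=
  loewyFiltration (MonoidAlgebra ℂ (Aut P)) (P.autAction k).asModule i

/-- The Loewy length of the `Aut(X, L)`-module `H⁰(X, L^k)`. -/
def ll (P : SchemePair) (k : ℕ) : ℕ∞ :=
  loewyLength (MonoidAlgebra ℂ (Aut P)) (P.autAction k).asModule

end SchemePair

end

/-! The heart is subadditivity. Suppose the step `F a` of the Loewy filtration vanishes on `M`, the
step `F b` vanishes on `N`, and the values of an equivariant bilinear map `M × N → Q` span `Q`. Then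
`F (a + b)` vanishes on `Q`. Projective normality makes this applicable to `H⁰(L^k) × H⁰(L) →
H⁰(L^(k+1))`. Since `F C` vanishes on `H⁰(L)` (every nonzero step drops the dimension), induction
gives the bound for `k ≥ 1`. For `k = 0` the space is spanned by the empty product.

For subadditivity, let `W j` be the span of the products of `F p M` and `F q N` with `p + q = j`.
Modulo `W (j + 1)` these products depend only on the semisimple graded pieces. By Chevalley's
theorem (over `ℂ`, tensor products of finite-dimensional semisimple representations of any group are
semisimple) they span a semisimple module. A descending chain with semisimple subquotients lies
above the Loewy filtration.

Chevalley's theorem is proved by minimisation, without algebraic groups. For finitely many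
invertible matrices `A i` acting irreducibly, minimise over `k` the sum of the squared logarithms of
the singular values of `B i = k (A i) k⁻¹`; irreducibility prevents the minimum from escaping to a
singular `k`. The first variation yields the balance equation `∑ log (B i (B i)ᴴ) = ∑ log ((B i)ᴴ B
i)`. It is inherited by Kronecker products, because the logarithm turns them into sums. It also
implies complete reducibility. For an invariant subspace `W`, Jensen's inequality bounds the traces
of the two sides over `W` by the logarithms of the singular values of `B i` on `W`, from opposite
directions. Equality forces `(B i)ᴴ B i` to preserve `W`, so `B i` preserves the orthogonal
complement.

All this needs `H⁰(L)` to be finite-dimensional; otherwise `Module.finrank` would be the default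
value `0`. Sections embed into the function field through their coefficient at the generic point.
Multiplied by a variable `X`, they become integral over the homogeneous coordinate ring of the
embedded variety, and finiteness of normalization in characteristic zero gives the claim. -/

noncomputable section

/-! ### Balanced families of matrices -/

namespace BalancedMatrix

open Matrix
open scoped ComplexOrder

attribute [local instance] Matrix.linftyOpNormedAddCommGroup Matrix.linftyOpNormedSpace
  Matrix.linftyOpNormedRing Matrix.linftyOpNormedAlgebra

variable {n m ι : Type*} [Fintype n] [DecidableEq n] [Fintype m] [DecidableEq m] [Fintype ι]

/-- The diagonal matrix with entries `exp (y j)`. -/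
def expDiag (y : n → ℝ) : Matrix n n ℂ := diagonal fun j ↦ ((Real.exp (y j) : ℝ) : ℂ)

/-- The diagonal matrix with real entries `y j`. -/
def realDiag (y : n → ℝ) : Matrix n n ℂ := diagonal fun j ↦ ((y j : ℝ) : ℂ)

/-- `U e^y Vᴴ` is a singular value decomposition of `k A k⁻¹`. -/
structure IsSVD (A k U V : Matrix n n ℂ) (y : n → ℝ) : Prop where
  left : U ∈ unitaryGroup n ℂ
  right : V ∈ unitaryGroup n ℂ
  eq : k * A = U * expDiag y * Vᴴ * k

/-- A family of matrices is balanced if, in suitable coordinates,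
`∑ log (Aᵢ Aᵢᴴ) = ∑ log (Aᵢᴴ Aᵢ)`. -/
def IsBalanced (A : ι → Matrix n n ℂ) : Prop :=
  ∃ (k : Matrix n n ℂ) (U V : ι → Matrix n n ℂ) (y : ι → n → ℝ), IsUnit k ∧
    (∀ i, IsSVD (A i) k (U i) (V i) (y i)) ∧
    ∑ i, U i * realDiag (y i) * (U i)ᴴ = ∑ i, V i * realDiag (y i) * (V i)ᴴ

/-- Tuples consisting of a change of coordinates and singular value decompositions. -/
abbrev SVDData (n ι : Type*) : Type _ :=
  Matrix n n ℂ × (ι → Matrix n n ℂ) × (ι → Matrix n n ℂ) × (ι → n → ℝ)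

theorem expDiag_mul_neg (y : n → ℝ) : expDiag y * expDiag (-y) = 1 := by
  rw [expDiag, expDiag, diagonal_mul_diagonal, ← diagonal_one]
  congr 1
  ext j
  rw [← Complex.ofReal_mul, ← Real.exp_add, Pi.neg_apply, add_neg_cancel, Real.exp_zero,
    Complex.ofReal_one]

theorem expDiag_add (y z : n → ℝ) : expDiag y * expDiag z = expDiag (y + z) := by
  simp [expDiag, diagonal_mul_diagonal, Complex.exp_add]

theorem expDiag_conjTranspose (y : n → ℝ) : (expDiag y)ᴴ = expDiag y := by
  rw [expDiag, diagonal_conjTranspose]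
  congr 1
  ext j
  simp only [Pi.star_apply, RCLike.star_def, Complex.conj_ofReal]

theorem realDiag_conjTranspose (y : n → ℝ) : (realDiag y)ᴴ = realDiag y := by
  rw [realDiag, diagonal_conjTranspose]
  congr 1
  ext j
  simp

theorem conjTranspose_mul_self_of_mem {U : Matrix n n ℂ} (hU : U ∈ unitaryGroup n ℂ) :
    Uᴴ * U = 1 := mem_unitaryGroup_iff'.mp hU

theorem mul_conjTranspose_self_of_mem {U : Matrix n n ℂ} (hU : U ∈ unitaryGroup n ℂ) :
    U * Uᴴ = 1 := mem_unitaryGroup_iff.mp hU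

/-- Singular value decomposition of an invertible matrix. -/
theorem exists_svd {B : Matrix n n ℂ} (hB : IsUnit B) :
    ∃ (U V : Matrix n n ℂ) (y : n → ℝ), U ∈ unitaryGroup n ℂ ∧ V ∈ unitaryGroup n ℂ ∧
      B = U * expDiag y * Vᴴ := by
  have hpos : (Bᴴ * B).PosDef := by
    have := (Matrix.PosDef.one (n := n) (R := ℂ)).conjTranspose_mul_mul_same
      (B := B) (mulVec_injective_of_isUnit hB)
    simpa using this
  set h := hpos.isHermitian
  set V : Matrix n n ℂ := h.eigenvectorUnitary.1 with hV
  have hVm : V ∈ unitaryGroup n ℂ := h.eigenvectorUnitary.2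
  have hVV := conjTranspose_mul_self_of_mem hVm
  have hVV' := mul_conjTranspose_self_of_mem hVm
  set y : n → ℝ := fun j ↦ Real.log (h.eigenvalues j) / 2 with hy
  have hspec : Bᴴ * B = V * (expDiag y * expDiag y) * Vᴴ := by
    have h1 := h.spectral_theorem
    rw [Unitary.conjStarAlgAut_apply] at h1
    rw [h1]
    congr 2
    rw [expDiag_add, expDiag]
    congr 1
    ext j
    simp only [Function.comp_apply, Pi.add_apply, hy, add_halves,
      Real.exp_log (hpos.eigenvalues_pos j)]
    rfl
  have hBV : B * V * expDiag (-y) * expDiag y * Vᴴ = B := by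
    rw [mul_assoc (B * V), expDiag_add, neg_add_cancel]
    simp [expDiag, mul_assoc, hVV']
  refine ⟨B * V * expDiag (-y), V, y, ?_, hVm, hBV.symm⟩
  rw [mem_unitaryGroup_iff', star_eq_conjTranspose]
  simp only [conjTranspose_mul, expDiag_conjTranspose]
  calc expDiag (-y) * (Vᴴ * Bᴴ) * (B * V * expDiag (-y))
      = expDiag (-y) * (Vᴴ * (Bᴴ * B) * V) * expDiag (-y) := by simp only [mul_assoc]
    _ = expDiag (-y) * ((Vᴴ * V) * (expDiag y * expDiag y) * (Vᴴ * V)) * expDiag (-y) := by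
        rw [hspec]; simp only [mul_assoc]
    _ = (expDiag (-y) * expDiag y) * (expDiag y * expDiag (-y)) := by
        rw [hVV]; simp only [mul_assoc, one_mul, mul_one]
    _ = 1 := by
        have := expDiag_mul_neg (-y)
        rw [neg_neg] at this
        rw [expDiag_mul_neg, this, one_mul]

/-- For an irreducible family of invertible matrices, the total displacement
`∑ (log of singular values)²` attains its minimum. -/
theorem exists_min [Nonempty n] {A : ι → Matrix n n ℂ} (hA : ∀ i, IsUnit (A i))
    (hirr : ∀ W : Submodule ℂ (n → ℂ), (∀ i, ∀ w ∈ W, A i *ᵥ w ∈ W) → W = ⊥ ∨ W = ⊤) :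
    ∃ (k : Matrix n n ℂ) (U V : ι → Matrix n n ℂ) (y : ι → n → ℝ), IsUnit k ∧
      (∀ i, IsSVD (A i) k (U i) (V i) (y i)) ∧
      ∀ (k' : Matrix n n ℂ) (U' V' : ι → Matrix n n ℂ) (y' : ι → n → ℝ), IsUnit k' →
        (∀ i, IsSVD (A i) k' (U' i) (V' i) (y' i)) → ∑ i, ∑ j, y i j ^ 2 ≤ ∑ i, ∑ j, y' i j ^ 2 := by
  choose U₀ V₀ y₀ hU₀ hV₀ hy₀ using fun i ↦ exists_svd (hA i)
  have : ProperSpace (Matrix n n ℂ) := FiniteDimensional.proper ℂ _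
  let cost : SVDData n ι → ℝ := fun x ↦ ∑ i, ∑ j, x.2.2.2 i j ^ 2
  have hcost : Continuous cost := by fun_prop
  set c₀ : ℝ := ∑ i, ∑ j, y₀ i j ^ 2 with hc₀
  -- The equation in `IsSVD` avoids `k⁻¹` and is homogeneous in `k`. So `k` may be scaled to norm
  -- one, and the conditions are closed and bounded. Invertibility of `k` is not a closed condition
  -- and is recovered after minimising.
  let Z : Set (SVDData n ι) := {x | ‖x.1‖ = 1 ∧ (∀ i, IsSVD (A i) x.1 (x.2.1 i) (x.2.2.1 i) (x.2.2.2 i)) ∧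
    cost x ≤ c₀}
  have hclosed : IsClosed Z := by
    have h1 : IsClosed {x : SVDData n ι | ‖x.1‖ = 1} := isClosed_eq (by fun_prop) continuous_const
    have hun : IsClosed ((unitaryGroup n ℂ : Submonoid (Matrix n n ℂ)) : Set (Matrix n n ℂ)) := by
      have : ((unitaryGroup n ℂ : Submonoid (Matrix n n ℂ)) : Set (Matrix n n ℂ)) =
          {U | U * Uᴴ = 1} := by
        ext U
        exact mem_unitaryGroup_iff
      rw [this]
      exact isClosed_eq (by fun_prop) continuous_const
    have h2 : IsClosed {x : SVDData n ι | ∀ i, IsSVD (A i) x.1 (x.2.1 i) (x.2.2.1 i) (x.2.2.2 i)} := by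
      have : {x : SVDData n ι | ∀ i, IsSVD (A i) x.1 (x.2.1 i) (x.2.2.1 i) (x.2.2.2 i)} = ⋂ i,
          ({x : SVDData n ι | x.2.1 i ∈ unitaryGroup n ℂ} ∩ {x : SVDData n ι | x.2.2.1 i ∈ unitaryGroup n ℂ} ∩
          {x : SVDData n ι | x.1 * A i = x.2.1 i * expDiag (x.2.2.2 i) * (x.2.2.1 i)ᴴ * x.1}) := by
        ext x
        simp only [Set.mem_ofPred_eq, Set.mem_iInter, Set.mem_inter_iff]
        exact forall_congr' fun i ↦ ⟨fun h ↦ ⟨⟨h.1, h.2⟩, h.3⟩, fun h ↦ ⟨h.1.1, h.1.2, h.2⟩⟩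
      rw [this]
      refine isClosed_iInter fun i ↦ ((hun.preimage ?_).inter (hun.preimage ?_)).inter
        (isClosed_eq ?_ ?_)
      · fun_prop
      · fun_prop
      · fun_prop
      · have : Continuous fun x : SVDData n ι ↦ expDiag (x.2.2.2 i) := by
          unfold expDiag
          fun_prop
        fun_prop
    exact h1.inter (h2.inter (isClosed_le hcost continuous_const))
  have hnorm_un : ∃ R : ℝ, 0 ≤ R ∧ ∀ U ∈ unitaryGroup n ℂ, ‖U‖ ≤ R := by
    refine ⟨Fintype.card n, by positivity, fun U hU ↦ ?_⟩
    rw [linfty_opNorm_def]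
    norm_cast
    have : (Fintype.card n : ℝ) = ((Fintype.card n : NNReal) : ℝ) := by simp
    refine le_trans ?_ this.ge
    refine Finset.sup_le fun i _ ↦ (Finset.sum_le_card_nsmul _ _ 1 fun j _ ↦ ?_).trans (by simp)
    exact entry_norm_bound_of_unitary hU i j
  obtain ⟨R, hR0, hR⟩ := hnorm_un
  have hbdd : Z ⊆ Metric.closedBall 0 (max (max 1 R) (Real.sqrt c₀)) := by
    rintro x ⟨hx1, hx2, hx3⟩
    rw [mem_closedBall_zero_iff]
    have hy : ‖x.2.2.2‖ ≤ Real.sqrt c₀ := by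
      refine (pi_norm_le_iff_of_nonneg (Real.sqrt_nonneg _)).mpr fun i ↦
        (pi_norm_le_iff_of_nonneg (Real.sqrt_nonneg _)).mpr fun j ↦ ?_
      rw [Real.norm_eq_abs]
      refine Real.abs_le_sqrt (le_trans ?_ hx3)
      refine le_trans ?_ (Finset.single_le_sum (f := fun i ↦ ∑ j, x.2.2.2 i j ^ 2)
        (fun i _ ↦ Finset.sum_nonneg fun j _ ↦ sq_nonneg _) (Finset.mem_univ i))
      exact Finset.single_le_sum (f := fun j ↦ x.2.2.2 i j ^ 2) (fun j _ ↦ sq_nonneg _)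
        (Finset.mem_univ j)
    have hU : ‖x.2.1‖ ≤ R := (pi_norm_le_iff_of_nonneg hR0).mpr fun i ↦ hR _ (hx2 i).1
    have hV : ‖x.2.2.1‖ ≤ R := (pi_norm_le_iff_of_nonneg hR0).mpr fun i ↦ hR _ (hx2 i).2
    refine max_le (hx1.le.trans (by simp)) (max_le (hU.trans (by simp)) (max_le
      (hV.trans (by simp)) (hy.trans (by simp))))
  have hcomp : IsCompact Z := (isCompact_closedBall _ _).of_isClosed_subset hclosed hbdd
  have hscale : ∀ (k : Matrix n n ℂ) (U V : ι → Matrix n n ℂ) (y : ι → n → ℝ), IsUnit k →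
      (∀ i, IsSVD (A i) k (U i) (V i) (y i)) → ∑ i, ∑ j, y i j ^ 2 ≤ c₀ →
      (((‖k‖⁻¹ : ℝ) : ℂ) • k, U, V, y) ∈ Z := by
    intro k U V y hk h hc
    have hk0 : ‖k‖ ≠ 0 := norm_ne_zero_iff.mpr hk.ne_zero
    refine ⟨?_, fun i ↦ ⟨(h i).1, (h i).2, ?_⟩, hc⟩
    · rw [norm_smul, Complex.norm_real, norm_inv, norm_norm, inv_mul_cancel₀ hk0]
    · simp only [smul_mul_assoc, mul_smul_comm, (h i).3]
  have hne : Z.Nonempty := ⟨_, hscale 1 U₀ V₀ y₀ isUnit_one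
    (fun i ↦ ⟨hU₀ i, hV₀ i, by simpa using hy₀ i⟩) le_rfl⟩
  obtain ⟨⟨k, U, V, y⟩, ⟨hk1, hk2, hk3⟩, hmin⟩ := hcomp.exists_isMinOn hne hcost.continuousOn
  refine ⟨k, U, V, y, ?_, hk2, fun k' U' V' y' hk' h' ↦ ?_⟩
  -- The equation `k A = (U e^y Vᴴ) k` makes `ker k` invariant under the family. By irreducibility
  -- `k` is invertible or zero, and its norm is one.
  · let W : Submodule ℂ (n → ℂ) := LinearMap.ker (Matrix.mulVecLin k)
    have hmem : ∀ w, w ∈ W ↔ k *ᵥ w = 0 := fun w ↦ by simp [W, LinearMap.mem_ker]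
    rcases hirr W fun i w hw ↦ by
      rw [hmem] at hw ⊢
      rw [mulVec_mulVec, (hk2 i).3, ← mulVec_mulVec, hw, mulVec_zero] with h | h
    · rw [← mulVec_injective_iff_isUnit]
      exact LinearMap.ker_eq_bot.mp h
    · exfalso
      have : k = 0 := by
        refine Matrix.ext_of_mulVec_single fun j ↦ ?_
        rw [(hmem _).mp (h ▸ Submodule.mem_top), zero_mulVec]
      simp [this] at hk1
  · by_cases hc : ∑ i, ∑ j, y' i j ^ 2 ≤ c₀
    · exact hmin (hscale k' U' V' y' hk' h' hc)
    · exact hk3.trans (le_of_not_ge hc)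

end BalancedMatrix

/-! ### Convexity and estimates for singular values -/

namespace BalancedMatrix

open Matrix
open scoped ComplexOrder

attribute [local instance] Matrix.linftyOpNormedAddCommGroup Matrix.linftyOpNormedSpace
  Matrix.linftyOpNormedRing Matrix.linftyOpNormedAlgebra

variable {n m ι : Type*} [Fintype n] [DecidableEq n] [Fintype m] [DecidableEq m] [Fintype ι]

/-- The derivative `log x / x` decreases only from `e` onwards. This restriction is the reason for
the shift by a constant `c` in `isBalanced_of_min`. -/
theorem concaveOn_half_log_sq :
    ConcaveOn ℝ (Set.Ici (Real.exp 1)) fun x ↦ Real.log x ^ 2 / 2 := by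
  have hd : ∀ x, 0 < x → HasDerivAt (fun x ↦ Real.log x ^ 2 / 2) (Real.log x / x) x := by
    intro x hx
    refine (((Real.hasDerivAt_log hx.ne').pow 2).div_const 2).congr_deriv ?_
    norm_num
    ring
  have hpos : ∀ x ∈ Set.Ici (Real.exp 1), 0 < x := fun x hx ↦ (Real.exp_pos 1).trans_le hx
  refine AntitoneOn.concaveOn_of_deriv (convex_Ici _)
    (fun x hx ↦ (hd x (hpos x hx)).continuousAt.continuousWithinAt)
    (fun x hx ↦ (hd x (hpos x (interior_subset hx))).differentiableAt.differentiableWithinAt) ?_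
  intro x hx y hy hxy
  rw [(hd x (hpos x (interior_subset hx))).deriv, (hd y (hpos y (interior_subset hy))).deriv]
  exact Real.log_div_self_antitoneOn (interior_subset hx) (interior_subset hy) hxy

theorem sum_norm_sq_col {W : Matrix n n ℂ} (hW : W ∈ unitaryGroup n ℂ) (j : n) :
    ∑ l, ‖W l j‖ ^ 2 = 1 := by
  have h := congr($(conjTranspose_mul_self_of_mem hW) j j)
  rw [mul_apply, one_apply_eq] at h
  have : ∀ l, Wᴴ j l * W l j = ((‖W l j‖ ^ 2 : ℝ) : ℂ) := fun l ↦ by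
    rw [conjTranspose_apply, RCLike.star_def, RCLike.conj_mul]
    simp
  simp only [this] at h
  exact_mod_cast h

theorem sum_norm_sq_row {W : Matrix n n ℂ} (hW : W ∈ unitaryGroup n ℂ) (l : n) :
    ∑ j, ‖W l j‖ ^ 2 = 1 := by
  have h := sum_norm_sq_col (Unitary.star_mem hW) l
  rw [star_eq_conjTranspose] at h
  simpa using h

/-- The Peierls inequality for the function `(log x)² / 2`, concave on `[e, ∞)`. -/
theorem sum_half_sq_le {W : Matrix n n ℂ} (hW : W ∈ unitaryGroup n ℂ) {a : n → ℝ}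
    (ha : ∀ l, 1 ≤ a l) :
    ∑ l, a l ^ 2 / 2 ≤ ∑ j, Real.log (∑ l, ‖W l j‖ ^ 2 * Real.exp (a l)) ^ 2 / 2 := by
  have key : ∀ j, ∑ l, ‖W l j‖ ^ 2 * (a l ^ 2 / 2) ≤
      Real.log (∑ l, ‖W l j‖ ^ 2 * Real.exp (a l)) ^ 2 / 2 := fun j ↦ by
    have := concaveOn_half_log_sq.le_map_sum (t := Finset.univ) (w := fun l ↦ ‖W l j‖ ^ 2)
      (p := fun l ↦ Real.exp (a l)) (fun l _ ↦ sq_nonneg _) (sum_norm_sq_col hW j)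
      (fun l _ ↦ Real.exp_le_exp.mpr (ha l))
    simpa only [smul_eq_mul, Real.log_exp] using this
  -- The weights `‖W l j‖ ^ 2` are doubly stochastic: column sums serve for Jensen, row sums for
  -- adding up the results.
  refine le_trans (le_of_eq ?_) (Finset.sum_le_sum fun j _ ↦ key j)
  rw [Finset.sum_comm]
  refine Finset.sum_congr rfl fun l _ ↦ ?_
  rw [← Finset.sum_mul, sum_norm_sq_row hW, one_mul]

/-- The columns of `V` are eigenvectors of `Bᴴ B` with eigenvalues `e^(2 y l)`, so its diagonal in
any unitary frame `W` consists of averages of these eigenvalues. Unlike a choice of singular values,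
these entries vary smoothly with `B`. -/
theorem gram_apply_re {B U V W : Matrix n n ℂ} {y : n → ℝ} (hU : U ∈ unitaryGroup n ℂ)
    (hB : B = U * expDiag y * Vᴴ) (j : n) :
    ((Wᴴ * (Bᴴ * B) * W) j j).re = ∑ l, ‖(Vᴴ * W) l j‖ ^ 2 * Real.exp (2 * y l) := by
  have h1 : Wᴴ * (Bᴴ * B) * W = (Vᴴ * W)ᴴ * (expDiag y * (expDiag y * (Vᴴ * W))) := by
    rw [hB]
    simp only [conjTranspose_mul, conjTranspose_conjTranspose, expDiag_conjTranspose]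
    calc _ = Wᴴ * (V * expDiag y * (Uᴴ * U) * expDiag y * Vᴴ) * W := by simp only [mul_assoc]
      _ = _ := by
        rw [conjTranspose_mul_self_of_mem hU, mul_one]
        simp only [mul_assoc]
  rw [h1, mul_apply, Complex.re_sum]
  refine Finset.sum_congr rfl fun l _ ↦ ?_
  rw [expDiag, diagonal_mul, diagonal_mul, conjTranspose_apply]
  generalize (Vᴴ * W) l j = z
  rw [mul_left_comm, mul_left_comm (star z), RCLike.star_def, Complex.conj_mul', two_mul, Real.exp_add,
    mul_comm (‖z‖ ^ 2), mul_assoc]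
  rw [← Complex.ofReal_pow, ← Complex.ofReal_mul, ← Complex.ofReal_mul, Complex.ofReal_re]

/-- The sum of the absolute values of the entries. -/
def entrySum (C : Matrix n n ℂ) : ℝ := ∑ a, ∑ b, ‖C a b‖

theorem entrySum_nonneg (C : Matrix n n ℂ) : 0 ≤ entrySum C :=
  Finset.sum_nonneg fun _ _ ↦ Finset.sum_nonneg fun _ _ ↦ norm_nonneg _

theorem continuous_entrySum : Continuous (entrySum : Matrix n n ℂ → ℝ) :=
  continuous_finsetSum _ fun a _ ↦ continuous_finsetSum _ fun b _ ↦
    (continuous_id.matrix_elem a b).norm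

/-- The numbers `e^(-y l)` are the singular values of the inverse `C`, hence diagonal entries of `Vᴴ
C U`, and entries of unitary matrices have modulus at most one. This bounds singular values below by
a quantity continuous in `C`. -/
theorem exp_neg_le {B C U V : Matrix n n ℂ} {y : n → ℝ} (hU : U ∈ unitaryGroup n ℂ)
    (hV : V ∈ unitaryGroup n ℂ) (hB : B = U * expDiag y * Vᴴ) (hC : B * C = 1) (l : n) :
    Real.exp (-y l) ≤ entrySum C := by
  have h : expDiag (-y) = Vᴴ * C * U := by
    have h1 : V * expDiag (-y) * Uᴴ * B = 1 := by
      rw [hB]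
      calc _ = V * (expDiag (-y) * (Uᴴ * U) * expDiag (- -y)) * Vᴴ := by
            rw [neg_neg]
            simp only [mul_assoc]
        _ = 1 := by
            rw [conjTranspose_mul_self_of_mem hU, mul_one, expDiag_mul_neg, mul_one,
              mul_conjTranspose_self_of_mem hV]
    have h2 : C = V * expDiag (-y) * Uᴴ := by
      rw [← mul_one (V * expDiag (-y) * Uᴴ), ← hC, ← mul_assoc, h1, one_mul]
    rw [h2]
    calc expDiag (-y) = (Vᴴ * V) * expDiag (-y) * (Uᴴ * U) := by
          rw [conjTranspose_mul_self_of_mem hU, conjTranspose_mul_self_of_mem hV, mul_one, one_mul]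
      _ = _ := by simp only [mul_assoc]
  have h2 : Real.exp (-y l) = ‖(Vᴴ * C * U) l l‖ := by
    rw [← h, expDiag, diagonal_apply_eq, Complex.norm_real, Real.norm_eq_abs, Pi.neg_apply,
      Real.abs_exp]
  rw [h2, mul_assoc, mul_apply]
  refine (norm_sum_le _ _).trans (Finset.sum_le_sum fun a _ ↦ ?_)
  rw [norm_mul, conjTranspose_apply, norm_star, mul_apply]
  refine (mul_le_of_le_one_left (norm_nonneg _) (entry_norm_bound_of_unitary hV a l)).trans
    ((norm_sum_le _ _).trans (Finset.sum_le_sum fun b _ ↦ ?_))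
  rw [norm_mul]
  exact mul_le_of_le_one_right (norm_nonneg _) (entry_norm_bound_of_unitary hU b l)

/-- Hence `∑ y` does not change under conjugation, so terms linear in `y` are irrelevant to the
minimisation. -/
theorem norm_det_svd {U V : Matrix n n ℂ} {y : n → ℝ} (hU : U ∈ unitaryGroup n ℂ)
    (hV : V ∈ unitaryGroup n ℂ) : ‖(U * expDiag y * Vᴴ).det‖ = Real.exp (∑ l, y l) := by
  have hu : ∀ {U : Matrix n n ℂ}, U ∈ unitaryGroup n ℂ → ‖U.det‖ = 1 := fun hU ↦
    CStarRing.norm_of_mem_unitary (det_of_mem_unitary hU)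
  rw [det_mul, det_mul, norm_mul, norm_mul, hu hU, det_conjTranspose, norm_star, hu hV, one_mul,
    mul_one, expDiag, det_diagonal, norm_prod, Real.exp_sum]
  exact Finset.prod_congr rfl fun l _ ↦ by
    rw [Complex.norm_real, Real.norm_eq_abs, Real.abs_exp]

/-- Converts the first variation, a weighted sum of diagonal entries, into a trace pairing with `M`.
-/
theorem trace_mul_realDiag (M U : Matrix n n ℂ) (y : n → ℝ) :
    ∑ j, y j * ((Uᴴ * M * U) j j).re = (M * (U * realDiag y * Uᴴ)).trace.re := by
  rw [← mul_assoc, ← mul_assoc, trace_mul_comm, ← mul_assoc, ← mul_assoc, trace, Complex.re_sum]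
  refine Finset.sum_congr rfl fun j _ ↦ ?_
  rw [diag_apply, realDiag, mul_diagonal, mul_comm, Complex.re_mul_ofReal]

end BalancedMatrix

/-! ### The first variation of the displacement -/

namespace BalancedMatrix

open Matrix
open scoped ComplexOrder

attribute [local instance] Matrix.linftyOpNormedAddCommGroup Matrix.linftyOpNormedSpace
  Matrix.linftyOpNormedRing Matrix.linftyOpNormedAlgebra

variable {n m ι : Type*} [Fintype n] [DecidableEq n] [Fintype m] [DecidableEq m] [Fintype ι]

/-- The curve `exp (t M) B exp (-t M)` of conjugates of `B`. -/
def conjCurve (M B : Matrix n n ℂ) (t : ℝ) : Matrix n n ℂ :=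
  NormedSpace.exp (t • M) * B * NormedSpace.exp (t • -M)

theorem exp_smul_mul_exp_neg (M : Matrix n n ℂ) (t : ℝ) :
    NormedSpace.exp (t • M) * NormedSpace.exp (t • -M) = 1 := by
  rw [← exp_add_of_commute]
  · simp
  · exact ((Commute.refl M).neg_right.smul_left t).smul_right t

theorem exp_neg_mul_exp_smul (M : Matrix n n ℂ) (t : ℝ) :
    NormedSpace.exp (t • -M) * NormedSpace.exp (t • M) = 1 :=
  mul_eq_one_comm.mp (exp_smul_mul_exp_neg M t)

theorem conjCurve_zero (M B : Matrix n n ℂ) : conjCurve M B 0 = B := by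
  simp [conjCurve]

theorem conjCurve_mul (M B C : Matrix n n ℂ) (t : ℝ) :
    conjCurve M B t * conjCurve M C t = conjCurve M (B * C) t := by
  calc _ = NormedSpace.exp (t • M) * B * (NormedSpace.exp (t • -M) * NormedSpace.exp (t • M)) * C *
        NormedSpace.exp (t • -M) := by simp only [conjCurve, mul_assoc]
    _ = _ := by rw [exp_neg_mul_exp_smul, mul_one, conjCurve, mul_assoc _ B C]

theorem conjCurve_one (M : Matrix n n ℂ) (t : ℝ) : conjCurve M 1 t = 1 := by
  rw [conjCurve, mul_one, exp_smul_mul_exp_neg]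

theorem det_conjCurve (M B : Matrix n n ℂ) (t : ℝ) : (conjCurve M B t).det = B.det := by
  rw [conjCurve, det_mul, det_mul, mul_right_comm, ← det_mul, exp_smul_mul_exp_neg, det_one,
    one_mul]

theorem conjCurve_conjTranspose {M : Matrix n n ℂ} (hM : Mᴴ = M) (B : Matrix n n ℂ) (t : ℝ) :
    (conjCurve M B t)ᴴ = conjCurve (-M) Bᴴ t := by
  simp only [conjCurve, conjTranspose_mul, ← exp_conjTranspose, conjTranspose_smul,
    conjTranspose_neg, hM, star_trivial, neg_neg, mul_assoc]

theorem hasDerivAt_conjCurve (M B : Matrix n n ℂ) :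
    HasDerivAt (conjCurve M B) (M * B - B * M) 0 := by
  have h1 := hasDerivAt_exp_smul_const M (0 : ℝ)
  have h2 := hasDerivAt_exp_smul_const (-M) (0 : ℝ)
  have := (h1.mul_const B).mul h2
  simp only [zero_smul, NormedSpace.exp_zero, one_mul, mul_one] at this
  refine this.congr_deriv ?_
  rw [mul_neg, sub_eq_add_neg]

theorem continuous_conjCurve (M B : Matrix n n ℂ) : Continuous (conjCurve M B) := by
  unfold conjCurve
  have : Continuous (NormedSpace.exp : Matrix n n ℂ → Matrix n n ℂ) := NormedSpace.exp_continuous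
  fun_prop

/-- The real part of a diagonal entry, as a continuous linear form. -/
def reDiag (j : n) : Matrix n n ℂ →L[ℝ] ℝ :=
  LinearMap.toContinuousLinearMap
    { toFun X := (X j j).re
      map_add' X Y := by simp
      map_smul' c X := by simp }

/-- First variation of the diagonal entries of `Bᴴ B` along the curve of conjugates. -/
theorem hasDerivAt_gram {M B U V : Matrix n n ℂ} {y : n → ℝ} (hM : Mᴴ = M)
    (hU : U ∈ unitaryGroup n ℂ) (hV : V ∈ unitaryGroup n ℂ) (hB : B = U * expDiag y * Vᴴ) (j : n) :
    HasDerivAt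
      (fun t ↦ ((Vᴴ * ((conjCurve M B t)ᴴ * conjCurve M B t) * V) j j).re)
      (Real.exp (2 * y j) * (2 * (((Uᴴ * M * U) j j).re - ((Vᴴ * M * V) j j).re))) 0 := by
  have h1 := (hasDerivAt_conjCurve (-M) Bᴴ).mul (hasDerivAt_conjCurve M B)
  have h2 := (reDiag j).hasFDerivAt.comp_hasDerivAt (0 : ℝ) ((h1.const_mul Vᴴ).mul_const V)
  -- Singular vectors diagonalise every term of the derivative: `Bᴴ B` scales the columns of `V` by
  -- `e^(2y)`, and `B` takes them to `e^y` times the columns of `U`.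
  have hBV : Bᴴ * B * V = V * (expDiag y * expDiag y) := by
    rw [hB]
    simp only [conjTranspose_mul, conjTranspose_conjTranspose, expDiag_conjTranspose]
    calc _ = V * expDiag y * (Uᴴ * U) * expDiag y * (Vᴴ * V) := by simp only [mul_assoc]
      _ = _ := by
        rw [conjTranspose_mul_self_of_mem hU, conjTranspose_mul_self_of_mem hV]
        simp only [mul_assoc, mul_one]
  have hVB : Vᴴ * (Bᴴ * B) = expDiag y * expDiag y * Vᴴ := by
    have := congr($hBVᴴ)
    simpa only [conjTranspose_mul, conjTranspose_conjTranspose, expDiag_conjTranspose] using this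
  have hUB : B * V = U * expDiag y := by
    rw [hB, mul_assoc, conjTranspose_mul_self_of_mem hV, mul_one]
  have hUB' : Vᴴ * Bᴴ = expDiag y * Uᴴ := by
    have := congr($hUBᴴ)
    simpa only [conjTranspose_mul, expDiag_conjTranspose] using this
  have hfun : (fun t ↦ ((Vᴴ * ((conjCurve M B t)ᴴ * conjCurve M B t) * V) j j).re) =
      reDiag j ∘ fun t ↦ Vᴴ * (conjCurve (-M) Bᴴ * conjCurve M B) t * V := by
    funext t
    rw [conjCurve_conjTranspose hM]
    rfl
  rw [hfun]
  refine h2.congr_deriv (Eq.symm ?_)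
  have : Vᴴ * ((-M * Bᴴ - Bᴴ * -M) * conjCurve M B 0 +
      conjCurve (-M) Bᴴ 0 * (M * B - B * M)) * V =
      expDiag y * (Uᴴ * M * U) * expDiag y + expDiag y * (Uᴴ * M * U) * expDiag y - (Vᴴ * M * V) * (expDiag y * expDiag y) -
        (expDiag y * expDiag y) * (Vᴴ * M * V) := by
    rw [conjCurve_zero, conjCurve_zero]
    calc _ = (Vᴴ * Bᴴ) * M * (B * V) + (Vᴴ * Bᴴ) * M * (B * V) - Vᴴ * M * (Bᴴ * B * V) -
          (Vᴴ * (Bᴴ * B)) * M * V := by noncomm_ring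
      _ = _ := by
        rw [hUB, hUB', hBV, hVB]
        simp only [mul_assoc]
  have h3 : ∀ X Y Z : Matrix n n ℂ, reDiag j (X + X - Y - Z) =
      (X j j).re + (X j j).re - (Y j j).re - (Z j j).re := fun X Y Z ↦ by
    rw [map_sub, map_sub, map_add]
    rfl
  rw [this, expDiag_add]
  refine Eq.symm ((h3 _ _ _).trans ?_)
  simp only [expDiag, mul_diagonal, diagonal_mul, Complex.re_mul_ofReal, Complex.re_ofReal_mul,
    Pi.add_apply]
  rw [two_mul (y j), Real.exp_add]
  ring

set_option maxHeartbeats 1000000 in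
/-- Coordinates of minimal total displacement make a family balanced. -/
theorem isBalanced_of_min {A : ι → Matrix n n ℂ} {k : Matrix n n ℂ}
    {U V : ι → Matrix n n ℂ} {y : ι → n → ℝ} (hk : IsUnit k)
    (h : ∀ i, IsSVD (A i) k (U i) (V i) (y i))
    (hmin : ∀ (k' : Matrix n n ℂ) (U' V' : ι → Matrix n n ℂ) (y' : ι → n → ℝ), IsUnit k' →
      (∀ i, IsSVD (A i) k' (U' i) (V' i) (y' i)) →
        ∑ i, ∑ j, y i j ^ 2 ≤ ∑ i, ∑ j, y' i j ^ 2) : IsBalanced A := by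
  refine ⟨k, U, V, y, hk, h, ?_⟩
  -- The defect of balance `M` is itself the test direction: `k` is moved to `exp (t M) k`, and the
  -- variation turns out to be a multiple of `tr M²`.
  set M := ∑ i, U i * realDiag (y i) * (U i)ᴴ - ∑ i, V i * realDiag (y i) * (V i)ᴴ with hMdef
  have hM : Mᴴ = M := by
    simp only [hMdef, conjTranspose_sub, conjTranspose_sum, conjTranspose_mul,
      conjTranspose_conjTranspose, realDiag_conjTranspose, mul_assoc]
  let B : ι → Matrix n n ℂ := fun i ↦ U i * expDiag (y i) * (V i)ᴴ
  let C : ι → Matrix n n ℂ := fun i ↦ V i * expDiag (-y i) * (U i)ᴴ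
  have hBC : ∀ i, B i * C i = 1 := fun i ↦ by
    calc _ = U i * (expDiag (y i) * ((V i)ᴴ * V i) * expDiag (-y i)) * (U i)ᴴ := by
          simp only [B, C, mul_assoc]
      _ = 1 := by
        rw [conjTranspose_mul_self_of_mem (h i).2, mul_one, expDiag_mul_neg, mul_one,
          mul_conjTranspose_self_of_mem (h i).1]
  have hunit : ∀ i t, IsUnit (conjCurve M (B i) t) := fun i t ↦
    IsUnit.of_mul_eq_one _ (by rw [conjCurve_mul, hBC, conjCurve_one])
  -- These decompositions are chosen for each `t` separately, with no regularity in `t`. The cost is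
  -- therefore not differentiated directly but compared with a smooth function `G`.
  choose U' V' y' hU' hV' hB' using fun t i ↦ exists_svd (hunit i t)
  have hcost : ∀ t, ∑ i, ∑ j, y i j ^ 2 ≤ ∑ i, ∑ j, y' t i j ^ 2 := fun t ↦ by
    refine hmin (NormedSpace.exp (t • M) * k) (U' t) (V' t) (y' t) ((isUnit_exp _).mul hk)
      fun i ↦ ⟨hU' t i, hV' t i, ?_⟩
    rw [← hB', mul_assoc, (h i).3]
    calc _ = NormedSpace.exp (t • M) * B i * 1 * k := by simp only [B, mul_assoc, one_mul]
      _ = _ := by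
        rw [← exp_neg_mul_exp_smul M t]
        simp only [conjCurve, mul_assoc]
  -- a uniform lower bound for the singular values along the curve
  let S : ℝ → ℝ := fun t ↦ ∑ i, entrySum (conjCurve M (C i) t)
  have hS : Continuous S := by
    exact continuous_finsetSum _ fun i _ ↦ continuous_entrySum.comp (continuous_conjCurve M (C i))
  -- Near `t = 0` one has `e^(-y') ≤ S t ≤ S 0 + 1`, so this `c` makes `c + 2 y' ≥ 1`, the range in
  -- which the Peierls inequality holds.
  set c : ℝ := 1 + 2 * Real.log (S 0 + 1) with hc
  have hS0 : ∀ t, 0 ≤ S t := fun t ↦ Finset.sum_nonneg fun i _ ↦ entrySum_nonneg _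
  have hbound : ∀ᶠ t in nhds (0 : ℝ), ∀ i l, 1 ≤ c + 2 * y' t i l := by
    filter_upwards [hS.continuousAt.eventually (gt_mem_nhds (lt_add_one (S 0)))] with t ht i l
    have h1 := exp_neg_le (hU' t i) (hV' t i) (hB' t i) (C := conjCurve M (C i) t)
      (by rw [conjCurve_mul, hBC, conjCurve_one]) l
    have h2 : entrySum (conjCurve M (C i) t) ≤ S t :=
      Finset.single_le_sum (f := fun i ↦ entrySum (conjCurve M (C i) t))
        (fun i _ ↦ entrySum_nonneg _) (Finset.mem_univ i)
    have h3 : -y' t i l ≤ Real.log (S 0 + 1) :=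
      (Real.le_log_iff_exp_le (by linarith [hS0 0])).mpr ((h1.trans h2).trans ht.le)
    rw [hc]
    linarith
  -- the upper bound for the displacement
  let q : ι → n → ℝ → ℝ := fun i j t ↦
    (((V i)ᴴ * ((conjCurve M (B i) t)ᴴ * conjCurve M (B i) t) * V i) j j).re
  let G : ℝ → ℝ := fun t ↦ ∑ i, ∑ j, Real.log (Real.exp c * q i j t) ^ 2 / 2
  have hq0 : ∀ i j, q i j 0 = Real.exp (2 * y i j) := fun i j ↦ by
    simp only [q, conjCurve_zero]
    rw [gram_apply_re (h i).1 (rfl : B i = _), conjTranspose_mul_self_of_mem (h i).2,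
      Finset.sum_eq_single j]
    · simp
    · intro l _ hl
      simp [one_apply_ne hl]
    · simp
  have hsum : ∀ t i, ∑ l, y' t i l = ∑ l, y i l := fun t i ↦ by
    have h1 := norm_det_svd (y := y' t i) (hU' t i) (hV' t i)
    rw [← hB', det_conjCurve, norm_det_svd (h i).1 (h i).2] at h1
    exact (Real.exp_injective h1).symm
  -- The linear term is constant along the curve by `hsum`, so minimality of `∑ y²` passes to the
  -- shifted squares.
  have hexpand : ∀ z : ι → n → ℝ, ∑ i, ∑ l, (c + 2 * z i l) ^ 2 / 2 =
      ∑ i : ι, ∑ l : n, c ^ 2 / 2 + 2 * c * ∑ i, ∑ l, z i l + 2 * ∑ i, ∑ l, z i l ^ 2 := fun z ↦ by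
    simp only [Finset.mul_sum, ← Finset.sum_add_distrib]
    exact Finset.sum_congr rfl fun i _ ↦ Finset.sum_congr rfl fun l _ ↦ by ring
  have hlocal : IsLocalMin G 0 := by
    filter_upwards [hbound] with t ht
    have hG0 : G 0 = ∑ i, ∑ l, (c + 2 * y i l) ^ 2 / 2 := by
      simp only [G, hq0, ← Real.exp_add, Real.log_exp]
    have hGt : ∑ i, ∑ l, (c + 2 * y' t i l) ^ 2 / 2 ≤ G t := by
      refine Finset.sum_le_sum fun i _ ↦ ?_
      have hW : (V' t i)ᴴ * V i ∈ unitaryGroup n ℂ :=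
        mul_mem (Unitary.star_mem (hV' t i)) (h i).2
      refine (sum_half_sq_le hW (ht i)).trans (le_of_eq ?_)
      refine Finset.sum_congr rfl fun j _ ↦ ?_
      simp only [q]
      rw [gram_apply_re (hU' t i) (hB' t i), Finset.mul_sum]
      congr 3
      exact Finset.sum_congr rfl fun l _ ↦ by rw [Real.exp_add, mul_left_comm]
    rw [hG0]
    refine le_trans ?_ hGt
    rw [hexpand, hexpand]
    simp only [hsum]
    linarith [hcost t]
  have hderiv : HasDerivAt G (∑ i, ∑ j, (c + 2 * y i j) *
      (2 * ((((U i)ᴴ * M * U i) j j).re - (((V i)ᴴ * M * V i) j j).re))) 0 := by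
    refine HasDerivAt.fun_sum fun i _ ↦ HasDerivAt.fun_sum fun j _ ↦ ?_
    have h1 := (hasDerivAt_gram hM (h i).1 (h i).2 (rfl : B i = _) j).const_mul (Real.exp c)
    have h2 := ((h1.log (by
      rw [show (((V i)ᴴ * ((conjCurve M (B i) 0)ᴴ * conjCurve M (B i) 0) * V i) j j).re =
        Real.exp (2 * y i j) from hq0 i j]
      positivity)).pow 2).div_const 2
    refine h2.congr_deriv ?_
    rw [show (((V i)ᴴ * ((conjCurve M (B i) 0)ᴴ * conjCurve M (B i) 0) * V i) j j).re =
        Real.exp (2 * y i j) from hq0 i j, ← Real.exp_add, Real.log_exp, Real.exp_add c (2 * y i j)]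
    have h3 := (Real.exp_pos c).ne'
    have h4 := (Real.exp_pos (2 * y i j)).ne'
    generalize Real.exp c = E at *
    generalize Real.exp (2 * y i j) = F at *
    rw [← mul_assoc, mul_div_cancel_left₀ _ (mul_ne_zero h3 h4)]
    norm_num
    ring
  have hzero := hlocal.hasDerivAt_eq_zero hderiv
  have htr : ∀ {W : Matrix n n ℂ}, W ∈ unitaryGroup n ℂ →
      ∑ j, ((Wᴴ * M * W) j j).re = M.trace.re := fun {W} hW ↦ by
    have : (Wᴴ * M * W).trace = M.trace := by
      rw [trace_mul_comm, ← mul_assoc, mul_conjTranspose_self_of_mem hW, one_mul]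
    rw [← this, trace, Complex.re_sum]
    rfl
  -- The derivative of `G` at `0` is `4 Re tr (M²)`. The terms with `c` cancel, because the
  -- diagonals of `M` in the two unitary frames have the same sum.
  have hMM : (M * M).trace.re = 0 := by
    have h1 : ∀ i, ∑ j, (c + 2 * y i j) *
        (2 * ((((U i)ᴴ * M * U i) j j).re - (((V i)ᴴ * M * V i) j j).re)) =
        4 * ((M * (U i * realDiag (y i) * (U i)ᴴ)).trace.re -
          (M * (V i * realDiag (y i) * (V i)ᴴ)).trace.re) := fun i ↦ by
      rw [← trace_mul_realDiag, ← trace_mul_realDiag]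
      have h2 : ∑ j, c * (2 * ((((U i)ᴴ * M * U i) j j).re - (((V i)ᴴ * M * V i) j j).re)) = 0 := by
        rw [← Finset.mul_sum, ← Finset.mul_sum, Finset.sum_sub_distrib, htr (h i).1, htr (h i).2]
        ring
      simp only [add_mul, Finset.sum_add_distrib, h2, zero_add, ← Finset.sum_sub_distrib,
        Finset.mul_sum]
      exact Finset.sum_congr rfl fun j _ ↦ by ring
    simp only [h1, ← Finset.mul_sum, Finset.sum_sub_distrib, ← Complex.re_sum, ← trace_sum] at hzero
    rw [← Complex.sub_re, ← trace_sub, ← mul_sub, ← hMdef] at hzero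
    linarith
  -- As `M` is Hermitian, `tr (M²)` is the sum of the squared moduli of its entries.
  have hM0 : M = 0 := by
    rw [← trace_conjTranspose_mul_self_eq_zero_iff, hM]
    have := (posSemidef_conjTranspose_mul_self M).trace_nonneg
    rw [hM] at this
    exact Complex.ext hMM (Complex.nonneg_iff.mp this).2.symm
  exact sub_eq_zero.mp hM0

/-- An irreducible family of invertible matrices is balanced. -/
theorem isBalanced_of_irreducible [Nonempty n] {A : ι → Matrix n n ℂ} (hA : ∀ i, IsUnit (A i))
    (hirr : ∀ W : Submodule ℂ (n → ℂ), (∀ i, ∀ w ∈ W, A i *ᵥ w ∈ W) → W = ⊥ ∨ W = ⊤) :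
    IsBalanced A := by
  obtain ⟨k, U, V, y, hk, h, hmin⟩ := exists_min hA hirr
  exact isBalanced_of_min hk h hmin

end BalancedMatrix

/-! ### Jensen's inequality for singular values and its equality case -/

namespace BalancedMatrix

open scoped InnerProductSpace

section Orthogonal

variable {n ι : Type*} [Fintype n] [Fintype ι]
variable {E : Type*} [NormedAddCommGroup E] [InnerProductSpace ℂ E]

theorem exists_orthonormalBasis_of_orthonormal [FiniteDimensional ℂ E] {v : n → E}
    (hv : Orthonormal ℂ v) (hn : Fintype.card n = Module.finrank ℂ E) :
    ∃ b : OrthonormalBasis n ℂ E, ⇑b = v := by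
  exact ⟨OrthonormalBasis.mk hv (hv.linearIndependent.span_eq_top_of_card_eq_finrank' hn).ge,
    OrthonormalBasis.coe_mk _ _⟩

/-- Singular value decomposition of an injective endomorphism. -/
theorem exists_svd_linearMap [FiniteDimensional ℂ E] {a : E →ₗ[ℂ] E} (ha : Function.Injective a) :
    ∃ (u u' : OrthonormalBasis (Fin (Module.finrank ℂ E)) ℂ E) (τ : Fin (Module.finrank ℂ E) → ℝ),
      ∀ j, 0 < τ j ∧ a (u j) = (τ j : ℂ) • u' j := by
  have hT : (a.adjoint * a).IsSymmetric := LinearMap.isSymmetric_adjoint_mul_self a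
  set u := hT.eigenvectorBasis rfl with hu
  have hin : ∀ i j, ⟪a (u i), a (u j)⟫_ℂ = (hT.eigenvalues rfl j : ℂ) * ⟪u i, u j⟫_ℂ := fun i j ↦ by
    have h1 := hT.apply_eigenvectorBasis rfl j
    rw [Module.End.mul_apply] at h1
    rw [← LinearMap.adjoint_inner_right, h1, inner_smul_right]
    rfl
  have hpos : ∀ j, 0 < ‖a (u j)‖ := fun j ↦ norm_pos_iff.mpr fun h0 ↦ by
    have h1 : u j = 0 := ha (by rw [h0, map_zero])
    simpa [h1] using u.orthonormal.1 j
  have hon : Orthonormal ℂ fun j ↦ ((‖a (u j)‖⁻¹ : ℝ) : ℂ) • a (u j) := by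
    refine ⟨fun j ↦ ?_, fun i j hij ↦ ?_⟩
    · rw [norm_smul, Complex.norm_real, norm_inv, norm_norm, inv_mul_cancel₀ (hpos j).ne']
    · simp only [inner_smul_left, inner_smul_right, hin, u.orthonormal.2 hij, mul_zero]
  obtain ⟨u', hu'⟩ := exists_orthonormalBasis_of_orthonormal hon (by simp)
  refine ⟨u, u', fun j ↦ ‖a (u j)‖, fun j ↦ ⟨hpos j, ?_⟩⟩
  rw [hu', smul_smul, ← Complex.ofReal_mul, mul_inv_cancel₀ (hpos j).ne', Complex.ofReal_one,
    one_smul]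

theorem sum_mul_le_log {w y : n → ℝ} (hw : ∀ j, 0 ≤ w j) (hw1 : ∑ j, w j = 1) :
    ∑ j, w j * y j ≤ Real.log (∑ j, w j * Real.exp (y j)) := by
  have := strictConcaveOn_log_Ioi.concaveOn.le_map_sum (t := Finset.univ) (w := w)
    (p := fun l ↦ Real.exp (y l)) (fun l _ ↦ hw l) hw1 (fun l _ ↦ Real.exp_pos _)
  simpa only [smul_eq_mul, Real.log_exp] using this

/-- The equality case of Jensen's inequality for the strictly concave logarithm. -/
theorem exists_of_log_le_sum_mul {w y : n → ℝ} (hw : ∀ j, 0 ≤ w j) (hw1 : ∑ j, w j = 1)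
    (h : Real.log (∑ j, w j * Real.exp (y j)) ≤ ∑ j, w j * y j) :
    ∃ c : ℝ, ∀ j, w j ≠ 0 → Real.exp (y j) = c := by
  have h1 := (strictConcaveOn_log_Ioi.map_sum_eq_iff_of_nonneg (t := Finset.univ) (w := w)
    (p := fun l ↦ Real.exp (y l)) (fun l _ ↦ hw l) hw1 (fun l _ ↦ Real.exp_pos _)).mp (by
      simpa only [smul_eq_mul, Real.log_exp] using le_antisymm h (sum_mul_le_log hw hw1))
  obtain ⟨j, hj⟩ : ∃ j, w j ≠ 0 := by
    by_contra! hcon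
    simp [hcon] at hw1
  exact ⟨_, fun l hl ↦ h1 (Finset.mem_univ l) hl (Finset.mem_univ j) hj⟩

theorem sum_norm_inner_sq (e : OrthonormalBasis n ℂ E) (v : E) :
    ∑ j, ‖⟪e j, v⟫_ℂ‖ ^ 2 = ‖v‖ ^ 2 := e.sum_sq_norm_inner_right v

variable {e f : OrthonormalBasis n ℂ E} {y : n → ℝ} {B : E →ₗ[ℂ] E}

theorem inner_map (hB : ∀ j, B (e j) = (Real.exp (y j) : ℂ) • f j) (v : E) (j : n) :
    ⟪f j, B v⟫_ℂ = Real.exp (y j) * ⟪e j, v⟫_ℂ := by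
  classical
  conv_lhs => rw [← e.sum_repr' v, map_sum, inner_sum]
  rw [Finset.sum_eq_single j]
  · rw [map_smul, hB, inner_smul_right, inner_smul_right, inner_self_eq_norm_sq_to_K,
      f.orthonormal.1 j]
    simp [mul_comm]
  · intro l _ hl
    rw [map_smul, hB, inner_smul_right, inner_smul_right, f.orthonormal.2 hl.symm]
    simp
  · simp

theorem norm_sq_map (hB : ∀ j, B (e j) = (Real.exp (y j) : ℂ) • f j) (v : E) :
    ‖B v‖ ^ 2 = ∑ j, ‖⟪e j, v⟫_ℂ‖ ^ 2 * Real.exp (2 * y j) := by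
  rw [← sum_norm_inner_sq f]
  refine Finset.sum_congr rfl fun j _ ↦ ?_
  rw [inner_map hB, norm_mul, Complex.norm_real, Real.norm_eq_abs, Real.abs_exp, mul_pow,
    mul_comm, two_mul, Real.exp_add, sq (Real.exp _)]

/-- Jensen's inequality compares the quadratic form of `log (Bᴴ B)` at a unit vector `u` with `log
‖B u‖²`. The second bound is the first for the inverse, which sends `f j` to `e^(-y j) e j` and `u'`
to `τ⁻¹ u`. -/
theorem sum_mul_le_log_of_map (hB : ∀ j, B (e j) = (Real.exp (y j) : ℂ) • f j) {u u' : E} {τ : ℝ}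
    (hu : ‖u‖ = 1) (hu' : ‖u'‖ = 1) (hτ : 0 < τ) (h : B u = (τ : ℂ) • u') :
    ∑ j, ‖⟪e j, u⟫_ℂ‖ ^ 2 * (2 * y j) ≤ 2 * Real.log τ ∧
    2 * Real.log τ ≤ ∑ j, ‖⟪f j, u'⟫_ℂ‖ ^ 2 * (2 * y j) := by
  have hn : ‖B u‖ ^ 2 = τ ^ 2 := by
    rw [h, norm_smul, hu', Complex.norm_real, Real.norm_eq_abs, abs_of_pos hτ, mul_one]
  constructor
  · refine (sum_mul_le_log (fun j ↦ sq_nonneg _) (by rw [sum_norm_inner_sq, hu, one_pow])).trans ?_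
    rw [← norm_sq_map hB, hn, Real.log_pow]
    norm_num
  · have h1 := sum_mul_le_log (w := fun j ↦ ‖⟪f j, u'⟫_ℂ‖ ^ 2) (y := fun j ↦ -(2 * y j))
      (fun j ↦ sq_nonneg _) (by rw [sum_norm_inner_sq, hu', one_pow])
    -- This is `‖B⁻¹ u'‖²`, computed in coordinates instead of by forming the inverse.
    have h2 : ∑ j, ‖⟪f j, u'⟫_ℂ‖ ^ 2 * Real.exp (-(2 * y j)) = (τ ^ 2)⁻¹ := by
      have h3 : ∀ j, ‖⟪f j, u'⟫_ℂ‖ ^ 2 * Real.exp (-(2 * y j)) =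
          (τ ^ 2)⁻¹ * ‖⟪e j, u⟫_ℂ‖ ^ 2 := fun j ↦ by
        have h4 := inner_map hB u j
        rw [h, inner_smul_right] at h4
        have h5 := congr(‖$h4‖ ^ 2)
        rw [norm_mul, norm_mul, Complex.norm_real, Complex.norm_real, Real.norm_eq_abs,
          Real.norm_eq_abs, Real.abs_exp, abs_of_pos hτ, mul_pow, mul_pow, sq (Real.exp _),
          ← Real.exp_add, ← two_mul] at h5
        rw [Real.exp_neg]
        have := (Real.exp_pos (2 * y j)).ne'
        field_simp
        linarith
      simp only [h3]
      rw [← Finset.mul_sum, sum_norm_inner_sq, hu, one_pow, mul_one]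
    rw [h2, Real.log_inv, Real.log_pow] at h1
    simp only [mul_neg, Finset.sum_neg_distrib] at h1
    push_cast at h1
    linarith

/-- Equality in Jensen's inequality confines `u` to a single eigenspace of `Bᴴ B`; the conclusion is
`Bᴴ B u = c u` in weak form. -/
theorem exists_inner_map_eq (hB : ∀ j, B (e j) = (Real.exp (y j) : ℂ) • f j) {u u' : E} {τ : ℝ}
    (hu : ‖u‖ = 1) (hu' : ‖u'‖ = 1) (hτ : 0 < τ) (h : B u = (τ : ℂ) • u')
    (heq : 2 * Real.log τ ≤ ∑ j, ‖⟪e j, u⟫_ℂ‖ ^ 2 * (2 * y j)) :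
    ∃ c : ℂ, ∀ v, ⟪B v, B u⟫_ℂ = c * ⟪v, u⟫_ℂ := by
  have hn : ‖B u‖ ^ 2 = τ ^ 2 := by
    rw [h, norm_smul, hu', Complex.norm_real, Real.norm_eq_abs, abs_of_pos hτ, mul_one]
  obtain ⟨c, hc⟩ := exists_of_log_le_sum_mul (w := fun j ↦ ‖⟪e j, u⟫_ℂ‖ ^ 2)
    (y := fun j ↦ 2 * y j) (fun j ↦ sq_nonneg _) (by rw [sum_norm_inner_sq, hu, one_pow]) (by
      rw [← norm_sq_map hB, hn, Real.log_pow]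
      exact_mod_cast heq)
  refine ⟨c, fun v ↦ ?_⟩
  rw [← f.sum_inner_mul_inner (B v) (B u), ← e.sum_inner_mul_inner v u, Finset.mul_sum]
  refine Finset.sum_congr rfl fun j _ ↦ ?_
  rw [← inner_conj_symm (B v), inner_map hB, inner_map hB, map_mul, inner_conj_symm,
    Complex.conj_ofReal]
  by_cases h0 : ⟪e j, u⟫_ℂ = 0
  · simp [h0]
  · rw [← hc j (by simpa using h0), two_mul, Real.exp_add]
    push_cast
    ring

end Orthogonal

/-! ### Orthogonal complements of subspaces invariant under a balanced family -/

section Invariant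

variable {n ι : Type*} [Fintype n] [Fintype ι]
variable {E : Type*} [NormedAddCommGroup E] [InnerProductSpace ℂ E] [FiniteDimensional ℂ E]

theorem sum_norm_inner_sq_coe {p : Type*} [Fintype p] {W : Submodule ℂ E}
    (u : OrthonormalBasis p ℂ W) (x : E) :
    ∑ a, ‖⟪x, (u a : E)⟫_ℂ‖ ^ 2 = ‖W.orthogonalProjectionOnto x‖ ^ 2 := by
  rw [← sum_norm_inner_sq u]
  refine Finset.sum_congr rfl fun a _ ↦ ?_
  rw [norm_inner_symm, W.inner_orthogonalProjectionOnto_eq_of_mem_left]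

/-- The orthogonal complement of an invariant subspace of a balanced family is invariant. -/
theorem map_mem_orthogonal {e f : ι → OrthonormalBasis n ℂ E} {y : ι → n → ℝ} {B : ι → E →ₗ[ℂ] E}
    (hB : ∀ i j, B i (e i j) = (Real.exp (y i j) : ℂ) • f i j)
    (hbal : ∀ v, ∑ i, ∑ j, ‖⟪e i j, v⟫_ℂ‖ ^ 2 * (2 * y i j) =
      ∑ i, ∑ j, ‖⟪f i j, v⟫_ℂ‖ ^ 2 * (2 * y i j))
    (W : Submodule ℂ E) (hW : ∀ i, ∀ w ∈ W, B i w ∈ W) (i : ι) (v : E) (hv : v ∈ Wᗮ) :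
    B i v ∈ Wᗮ := by
  have hinj : ∀ i, Function.Injective (B i) := fun i ↦ by
    refine (injective_iff_map_eq_zero _).mpr fun v hv ↦ ?_
    have h1 := norm_sq_map (hB i) v
    rw [hv, norm_zero, zero_pow two_ne_zero, eq_comm,
      Finset.sum_eq_zero_iff_of_nonneg fun j _ ↦ by positivity] at h1
    have h2 := sum_norm_inner_sq (e i) v
    rw [Finset.sum_eq_zero fun j hj ↦
      (mul_eq_zero.mp (h1 j hj)).resolve_right (Real.exp_pos _).ne'] at h2
    exact norm_eq_zero.mp (pow_eq_zero_iff two_ne_zero |>.mp h2.symm)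
  have hinj' : ∀ i, Function.Injective ((B i).restrict (hW i)) := fun i x x' h ↦
    Subtype.ext (hinj i congr(($h : E)))
  -- Singular vectors of the restriction of `B i` to `W`: `u i` and `u' i` are two orthonormal bases
  -- of the same space `W`.
  choose u u' τ hτ using fun i ↦ exists_svd_linearMap (hinj' i)
  have hBu : ∀ i a, B i (u i a) = (τ i a : ℂ) • (u' i a : E) := fun i a ↦ congr(($((hτ i a).2) : E))
  have hun : ∀ i a, ‖(u i a : E)‖ = 1 := fun i a ↦ (u i).orthonormal.1 a
  have hun' : ∀ i a, ‖(u' i a : E)‖ = 1 := fun i a ↦ (u' i).orthonormal.1 a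
  have hle := fun i a ↦ sum_mul_le_log_of_map (hB i) (hun i a) (hun' i a) (hτ i a).1 (hBu i a)
  let u₀ := stdOrthonormalBasis ℂ W
  -- Summed over an orthonormal basis of `W`, each form becomes a trace over `W`, independent of the
  -- basis. Both sides may thus be computed in the common basis `u₀`, where balance applies to each
  -- vector.
  have hsum : ∑ i, ∑ a, ∑ j, ‖⟪e i j, (u i a : E)⟫_ℂ‖ ^ 2 * (2 * y i j) =
      ∑ i, ∑ a, ∑ j, ‖⟪f i j, (u' i a : E)⟫_ℂ‖ ^ 2 * (2 * y i j) := by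
    have h1 : ∀ (g : OrthonormalBasis n ℂ E) (z : n → ℝ) (r : OrthonormalBasis (Fin (Module.finrank ℂ W)) ℂ W),
        ∑ a, ∑ j, ‖⟪g j, (r a : E)⟫_ℂ‖ ^ 2 * z j = ∑ a, ∑ j, ‖⟪g j, (u₀ a : E)⟫_ℂ‖ ^ 2 * z j := by
      intro g z r
      rw [Finset.sum_comm, Finset.sum_comm (s := Finset.univ (α := Fin (Module.finrank ℂ W)))]
      refine Finset.sum_congr rfl fun j _ ↦ ?_
      rw [← Finset.sum_mul, ← Finset.sum_mul, sum_norm_inner_sq_coe, sum_norm_inner_sq_coe]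
    have h2 := fun i ↦ h1 (e i) (fun j ↦ 2 * y i j) (u i)
    have h3 := fun i ↦ h1 (f i) (fun j ↦ 2 * y i j) (u' i)
    simp only [h2, h3]
    rw [Finset.sum_comm, Finset.sum_comm (s := Finset.univ (α := ι))]
    exact Finset.sum_congr rfl fun a _ ↦ hbal _
  -- The values `2 log τ` lie between two families with equal totals, so every single inequality is
  -- an equality.
  have heq : ∀ i a, 2 * Real.log (τ i a) ≤ ∑ j, ‖⟪e i j, (u i a : E)⟫_ℂ‖ ^ 2 * (2 * y i j) := by
    have h1 : ∀ i ∈ Finset.univ, ∑ a, ∑ j, ‖⟪e i j, (u i a : E)⟫_ℂ‖ ^ 2 * (2 * y i j) ≤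
        ∑ a, 2 * Real.log (τ i a) := fun i _ ↦ Finset.sum_le_sum fun a _ ↦ (hle i a).1
    have h2 : ∑ i, ∑ a, 2 * Real.log (τ i a) ≤
        ∑ i, ∑ a, ∑ j, ‖⟪e i j, (u i a : E)⟫_ℂ‖ ^ 2 * (2 * y i j) :=
      (Finset.sum_le_sum fun i _ ↦ Finset.sum_le_sum fun a _ ↦ (hle i a).2).trans hsum.ge
    have h3 := (Finset.sum_eq_sum_iff_of_le h1).mp (le_antisymm (Finset.sum_le_sum h1) h2)
    intro i a
    have h4 := (Finset.sum_eq_sum_iff_of_le fun a _ ↦ (hle i a).1).mp (h3 i (Finset.mem_univ i))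
    exact (h4 a (Finset.mem_univ a)).ge
  -- With `Bᴴ B u = c u` and `v ⊥ u`, the product of `B v` with `B u = τ u'` vanishes, and `τ` is
  -- positive.
  have hperp : ∀ a, ⟪B i v, (u' i a : E)⟫_ℂ = 0 := fun a ↦ by
    obtain ⟨c, hc⟩ := exists_inner_map_eq (hB i) (hun i a) (hun' i a) (hτ i a).1 (hBu i a) (heq i a)
    have h1 := hc v
    rw [hBu, inner_smul_right, (Submodule.mem_orthogonal' W v).mp hv _ (u i a).2, mul_zero] at h1
    exact (mul_eq_zero.mp h1).resolve_left (by exact_mod_cast (hτ i a).1.ne')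
  rw [Submodule.mem_orthogonal']
  intro w hw
  have h1 : ((∑ a, ⟪u' i a, (⟨w, hw⟩ : W)⟫_ℂ • u' i a : W) : E) = w :=
    congr(($((u' i).sum_repr' ⟨w, hw⟩) : E))
  rw [← h1, Submodule.coe_sum, inner_sum]
  simp only [Submodule.coe_smul]
  exact Finset.sum_eq_zero fun a _ ↦ by rw [inner_smul_right, hperp, mul_zero]

end Invariant

end BalancedMatrix

/-! ### Complete reducibility and Kronecker products of balanced families -/

namespace BalancedMatrix

open Matrix
open scoped InnerProductSpace Kronecker

variable {n m ι : Type*} [Fintype n] [DecidableEq n] [Fintype m] [DecidableEq m] [Fintype ι]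

/-- The columns of a unitary matrix form an orthonormal basis. -/
theorem exists_orthonormalBasis_col {U : Matrix n n ℂ} (hU : U ∈ unitaryGroup n ℂ) :
    ∃ b : OrthonormalBasis n ℂ (EuclideanSpace ℂ n),
      (∀ j, b j = WithLp.toLp 2 (U *ᵥ Pi.single j 1)) ∧
      ∀ (v : n → ℂ) j, ⟪b j, WithLp.toLp 2 v⟫_ℂ = (Uᴴ *ᵥ v) j := by
  have hin : ∀ (v : n → ℂ) j, ⟪(WithLp.toLp 2 (U *ᵥ Pi.single j 1) : EuclideanSpace ℂ n),
      WithLp.toLp 2 v⟫_ℂ = (Uᴴ *ᵥ v) j := fun v j ↦ by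
    rw [EuclideanSpace.inner_toLp_toLp, mulVec_single_one, dotProduct_comm]
    rfl
  have hon : Orthonormal ℂ fun j ↦
      (WithLp.toLp 2 (U *ᵥ Pi.single j 1) : EuclideanSpace ℂ n) := by
    rw [orthonormal_iff_ite]
    intro i j
    rw [hin, mulVec_mulVec, conjTranspose_mul_self_of_mem hU, one_mulVec, Pi.single_apply]
  obtain ⟨b, hb⟩ := exists_orthonormalBasis_of_orthonormal hon (by simp)
  exact ⟨b, fun j ↦ by rw [hb], fun v j ↦ by rw [hb, hin]⟩

theorem re_star_dotProduct (U : Matrix n n ℂ) (y : n → ℝ) (v : n → ℂ) :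
    (star v ⬝ᵥ ((U * realDiag y * Uᴴ) *ᵥ v)).re = ∑ j, ‖(Uᴴ *ᵥ v) j‖ ^ 2 * y j := by
  rw [← mulVec_mulVec, ← mulVec_mulVec, dotProduct_mulVec,
    show star v ᵥ* U = star (Uᴴ *ᵥ v) by rw [star_mulVec, conjTranspose_conjTranspose], dotProduct,
    Complex.re_sum]
  refine Finset.sum_congr rfl fun j _ ↦ ?_
  rw [realDiag, mulVec_diagonal, Pi.star_apply, mul_left_comm, RCLike.star_def, Complex.conj_mul',
    mul_comm, ← Complex.ofReal_pow, ← Complex.ofReal_mul, Complex.ofReal_re]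

/-- Invariant subspaces of a balanced family have invariant complements. -/
theorem IsBalanced.exists_isCompl {A : ι → Matrix n n ℂ} (hA : IsBalanced A)
    (W : Submodule ℂ (n → ℂ)) (hW : ∀ i, ∀ w ∈ W, A i *ᵥ w ∈ W) :
    ∃ W' : Submodule ℂ (n → ℂ), (∀ i, ∀ w ∈ W', A i *ᵥ w ∈ W') ∧ IsCompl W W' := by
  obtain ⟨k, U, V, y, hk, h, hbal⟩ := hA
  choose f hf hf' using fun i ↦ exists_orthonormalBasis_col (h i).1
  choose e he he' using fun i ↦ exists_orthonormalBasis_col (h i).2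
  let φ : (n → ℂ) ≃ₗ[ℂ] EuclideanSpace ℂ n :=
    (LinearEquiv.ofBijective (mulVecLin k)
      ⟨mulVec_injective_of_isUnit hk, mulVec_surjective_iff_isUnit.mpr hk⟩).trans
      (WithLp.linearEquiv 2 ℂ (n → ℂ)).symm
  have hφ : ∀ v, φ v = WithLp.toLp 2 (k *ᵥ v) := fun v ↦ rfl
  let B : ι → EuclideanSpace ℂ n →ₗ[ℂ] EuclideanSpace ℂ n := fun i ↦
    (WithLp.linearEquiv 2 ℂ (n → ℂ)).symm.toLinearMap ∘ₗ
      mulVecLin (U i * expDiag (y i) * (V i)ᴴ) ∘ₗ (WithLp.linearEquiv 2 ℂ (n → ℂ)).toLinearMap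
  have hB : ∀ i v, B i (WithLp.toLp 2 v) =
      WithLp.toLp 2 ((U i * expDiag (y i) * (V i)ᴴ) *ᵥ v) := fun i v ↦ rfl
  have hφB : ∀ i v, φ (A i *ᵥ v) = B i (φ v) := fun i v ↦ by
    rw [hφ, hφ, hB, mulVec_mulVec, mulVec_mulVec, (h i).3]
  have hBe : ∀ i j, B i (e i j) = (Real.exp (y i j) : ℂ) • f i j := fun i j ↦ by
    rw [he, hf, hB, mulVec_mulVec, mul_assoc, conjTranspose_mul_self_of_mem (h i).2, mul_one,
      ← mulVec_mulVec, ← WithLp.toLp_smul, ← mulVec_smul]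
    congr 2
    ext l
    rw [expDiag, mulVec_diagonal, Pi.smul_apply, smul_eq_mul, Pi.single_apply]
    split_ifs with hl
    · rw [hl]
    · simp
  have hb : ∀ v, ∑ i, ∑ j, ‖⟪e i j, v⟫_ℂ‖ ^ 2 * (2 * y i j) =
      ∑ i, ∑ j, ‖⟪f i j, v⟫_ℂ‖ ^ 2 * (2 * y i j) := fun v ↦ by
    obtain ⟨v, rfl⟩ := (WithLp.linearEquiv 2 ℂ (n → ℂ)).symm.surjective v
    -- Balance is an identity of Hermitian matrices; here it is read as an identity of their
    -- quadratic forms.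
    have key : ∀ (X : ι → Matrix n n ℂ), ∑ i, ∑ j, ‖((X i)ᴴ *ᵥ v) j‖ ^ 2 * (2 * y i j) =
        2 * (star v ⬝ᵥ ((∑ i, X i * realDiag (y i) * (X i)ᴴ) *ᵥ v)).re := fun X ↦ by
      rw [sum_mulVec, dotProduct_sum, Complex.re_sum, Finset.mul_sum]
      refine Finset.sum_congr rfl fun i _ ↦ ?_
      rw [re_star_dotProduct, Finset.mul_sum]
      exact Finset.sum_congr rfl fun j _ ↦ by ring
    have h1 : ∀ i j, ⟪e i j, (WithLp.linearEquiv 2 ℂ (n → ℂ)).symm v⟫_ℂ = ((V i)ᴴ *ᵥ v) j :=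
      fun i j ↦ he' i v j
    have h2 : ∀ i j, ⟪f i j, (WithLp.linearEquiv 2 ℂ (n → ℂ)).symm v⟫_ℂ = ((U i)ᴴ *ᵥ v) j :=
      fun i j ↦ hf' i v j
    simp only [h1, h2]
    rw [key, key, hbal]
  let W₁ := W.map φ.toLinearMap
  have hW₁ : ∀ i, ∀ w ∈ W₁, B i w ∈ W₁ := by
    rintro i _ ⟨w, hw, rfl⟩
    exact ⟨A i *ᵥ w, hW i w hw, hφB i w⟩
  refine ⟨W₁ᗮ.comap φ.toLinearMap, fun i w hw ↦ ?_, ?_⟩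
  · change φ (A i *ᵥ w) ∈ W₁ᗮ
    rw [hφB]
    exact map_mem_orthogonal hBe hb W₁ hW₁ i _ hw
  · have h1 : IsCompl W₁ W₁ᗮ := W₁.isCompl_orthogonal
    have h2 := (Submodule.orderIsoMapComap φ).symm.isCompl h1
    have h3 : (Submodule.orderIsoMapComap φ).symm W₁ = W :=
      (Submodule.orderIsoMapComap φ).symm_apply_apply W
    rwa [h3] at h2

/-- The logarithm turns a Kronecker product into a sum with one factor trivial in each term. This is
why balance survives Kronecker products. -/
theorem realDiag_add_kronecker (y : n → ℝ) (z : m → ℝ) :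
    realDiag (fun p : n × m ↦ y p.1 + z p.2) =
      realDiag y ⊗ₖ (1 : Matrix m m ℂ) + (1 : Matrix n n ℂ) ⊗ₖ realDiag z := by
  simp only [realDiag, ← diagonal_one, diagonal_kronecker_diagonal, diagonal_add]
  congr 1
  ext p
  simp

theorem expDiag_kronecker (y : n → ℝ) (z : m → ℝ) :
    expDiag y ⊗ₖ expDiag z = expDiag (fun p : n × m ↦ y p.1 + z p.2) := by
  simp only [expDiag, diagonal_kronecker_diagonal]
  congr 1
  ext p
  rw [Real.exp_add, Complex.ofReal_mul]

theorem kronecker_mem_unitaryGroup {U : Matrix n n ℂ} {U' : Matrix m m ℂ}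
    (hU : U ∈ unitaryGroup n ℂ) (hU' : U' ∈ unitaryGroup m ℂ) :
    U ⊗ₖ U' ∈ unitaryGroup (n × m) ℂ := by
  rw [mem_unitaryGroup_iff, star_eq_conjTranspose, conjTranspose_kronecker, ← mul_kronecker_mul,
    mul_conjTranspose_self_of_mem hU, mul_conjTranspose_self_of_mem hU', one_kronecker_one]

/-- The Kronecker product of balanced families is balanced. -/
theorem IsBalanced.kronecker {A : ι → Matrix n n ℂ} {B : ι → Matrix m m ℂ} (hA : IsBalanced A)
    (hB : IsBalanced B) : IsBalanced fun i ↦ A i ⊗ₖ B i := by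
  obtain ⟨k, U, V, y, hk, h, hbal⟩ := hA
  obtain ⟨k', U', V', z, hk', h', hbal'⟩ := hB
  refine ⟨k ⊗ₖ k', fun i ↦ U i ⊗ₖ U' i, fun i ↦ V i ⊗ₖ V' i, fun i p ↦ y i p.1 + z i p.2, ?_,
    fun i ↦ ⟨kronecker_mem_unitaryGroup (h i).1 (h' i).1,
      kronecker_mem_unitaryGroup (h i).2 (h' i).2, ?_⟩, ?_⟩
  · rw [isUnit_iff_isUnit_det] at hk hk' ⊢
    rw [det_kronecker]
    exact (hk.pow _).mul (hk'.pow _)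
  · rw [← expDiag_kronecker, conjTranspose_kronecker, ← mul_kronecker_mul, ← mul_kronecker_mul,
      ← mul_kronecker_mul, ← mul_kronecker_mul, (h i).3, (h' i).3]
  · have key : ∀ (X : ι → Matrix n n ℂ) (X' : ι → Matrix m m ℂ),
        (∀ i, X i ∈ unitaryGroup n ℂ) → (∀ i, X' i ∈ unitaryGroup m ℂ) →
        ∑ i, (X i ⊗ₖ X' i) * realDiag (fun p : n × m ↦ y i p.1 + z i p.2) * (X i ⊗ₖ X' i)ᴴ =
        (∑ i, X i * realDiag (y i) * (X i)ᴴ) ⊗ₖ (1 : Matrix m m ℂ) +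
          (1 : Matrix n n ℂ) ⊗ₖ (∑ i, X' i * realDiag (z i) * (X' i)ᴴ) := by
      intro X X' hX hX'
      have hl : ∀ Y : ι → Matrix n n ℂ, (∑ i, Y i) ⊗ₖ (1 : Matrix m m ℂ) = ∑ i, Y i ⊗ₖ 1 :=
        fun Y ↦ map_sum (AddMonoidHom.mk' (fun X : Matrix n n ℂ ↦ X ⊗ₖ (1 : Matrix m m ℂ))
          fun X Y ↦ add_kronecker X Y 1) _ _
      have hr : ∀ Y : ι → Matrix m m ℂ, (1 : Matrix n n ℂ) ⊗ₖ (∑ i, Y i) = ∑ i, 1 ⊗ₖ Y i :=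
        fun Y ↦ map_sum (AddMonoidHom.mk' (fun X : Matrix m m ℂ ↦ (1 : Matrix n n ℂ) ⊗ₖ X)
          fun X Y ↦ kronecker_add 1 X Y) _ _
      rw [hl, hr, ← Finset.sum_add_distrib]
      refine Finset.sum_congr rfl fun i _ ↦ ?_
      rw [realDiag_add_kronecker, conjTranspose_kronecker, mul_add, add_mul, ← mul_kronecker_mul,
        ← mul_kronecker_mul, ← mul_kronecker_mul, ← mul_kronecker_mul, mul_one, mul_one,
        mul_conjTranspose_self_of_mem (hX i), mul_conjTranspose_self_of_mem (hX' i)]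
    rw [key _ _ (fun i ↦ (h i).1) fun i ↦ (h' i).1, key _ _ (fun i ↦ (h i).2) fun i ↦ (h' i).2,
      hbal, hbal']

theorem mulVec_mem_of_mem_span {s : Set (Matrix n n ℂ)} {W : Submodule ℂ (n → ℂ)}
    (h : ∀ X ∈ s, ∀ w ∈ W, X *ᵥ w ∈ W) {X : Matrix n n ℂ} (hX : X ∈ Submodule.span ℂ s) :
    ∀ w ∈ W, X *ᵥ w ∈ W := by
  induction hX using Submodule.span_induction with
  | mem X hX => exact h X hX
  | zero => exact fun w _ ↦ by simp
  | add X Y _ _ hX hY => exact fun w hw ↦ (add_mulVec X Y w).symm ▸ W.add_mem (hX w hw) (hY w hw)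
  | smul c X _ hX => exact fun w hw ↦ (smul_mulVec c X w).symm ▸ W.smul_mem c (hX w hw)

/-- A form of Chevalley's theorem on tensor products of irreducible representations. -/
theorem exists_isCompl_kronecker [Nonempty n] [Nonempty m] {G : Type*}
    {A : G → Matrix n n ℂ} {B : G → Matrix m m ℂ} (hA : ∀ g, IsUnit (A g)) (hB : ∀ g, IsUnit (B g))
    (hA' : ∀ W : Submodule ℂ (n → ℂ), (∀ g, ∀ w ∈ W, A g *ᵥ w ∈ W) → W = ⊥ ∨ W = ⊤)
    (hB' : ∀ W : Submodule ℂ (m → ℂ), (∀ g, ∀ w ∈ W, B g *ᵥ w ∈ W) → W = ⊥ ∨ W = ⊤)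
    (W : Submodule ℂ (n × m → ℂ)) (hW : ∀ g, ∀ w ∈ W, (A g ⊗ₖ B g) *ᵥ w ∈ W) :
    ∃ W' : Submodule ℂ (n × m → ℂ), (∀ g, ∀ w ∈ W', (A g ⊗ₖ B g) *ᵥ w ∈ W') ∧ IsCompl W W' := by
  classical
  -- A balanced family must be finite. Spanning the triples jointly yields one finite set `t` that
  -- detects invariance for `A`, for `B` and for `A ⊗ₖ B`, the last not being linear in the first
  -- two.
  let F : G → Matrix n n ℂ × Matrix m m ℂ × Matrix (n × m) (n × m) ℂ :=
    fun g ↦ (A g, B g, A g ⊗ₖ B g)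
  obtain ⟨t, ht⟩ : ∃ t : Finset G, ∀ g, F g ∈ Submodule.span ℂ (F '' t) := by
    obtain ⟨s, hs, hs'⟩ := (Submodule.fg_span_iff_fg_span_finset_subset (R := ℂ)
      (Set.range F)).mp (IsNoetherian.noetherian _)
    obtain ⟨t, -, rfl⟩ := Finset.subset_set_image_iff.mp (Set.image_univ (f := F) ▸ hs)
    refine ⟨t, fun g ↦ ?_⟩
    rw [← Finset.coe_image, ← hs']
    exact Submodule.subset_span ⟨g, rfl⟩
  have htA : ∀ g, A g ∈ Submodule.span ℂ (A '' t) := fun g ↦ by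
    have := Submodule.mem_map_of_mem (f := LinearMap.fst ℂ _ _) (ht g)
    rwa [Submodule.map_span, ← Set.image_comp] at this
  have htB : ∀ g, B g ∈ Submodule.span ℂ (B '' t) := fun g ↦ by
    have := Submodule.mem_map_of_mem (f := LinearMap.fst ℂ _ _ ∘ₗ LinearMap.snd ℂ _ _) (ht g)
    rwa [Submodule.map_span, ← Set.image_comp] at this
  have htAB : ∀ g, A g ⊗ₖ B g ∈ Submodule.span ℂ ((fun g ↦ A g ⊗ₖ B g) '' t) := fun g ↦ by
    have := Submodule.mem_map_of_mem (f := LinearMap.snd ℂ _ _ ∘ₗ LinearMap.snd ℂ _ _) (ht g)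
    rwa [Submodule.map_span, ← Set.image_comp] at this
  have h1 : IsBalanced fun i : t ↦ A i := isBalanced_of_irreducible (fun i ↦ hA i) fun W hW ↦
    hA' W fun g ↦ mulVec_mem_of_mem_span (by rintro _ ⟨i, hi, rfl⟩; exact hW ⟨i, hi⟩) (htA g)
  have h2 : IsBalanced fun i : t ↦ B i := isBalanced_of_irreducible (fun i ↦ hB i) fun W hW ↦
    hB' W fun g ↦ mulVec_mem_of_mem_span (by rintro _ ⟨i, hi, rfl⟩; exact hW ⟨i, hi⟩) (htB g)
  obtain ⟨W', hW', hc⟩ := (h1.kronecker h2).exists_isCompl W fun i ↦ hW i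
  exact ⟨W', fun g ↦ mulVec_mem_of_mem_span (by rintro _ ⟨i, hi, rfl⟩; exact hW' ⟨i, hi⟩) (htAB g),
    hc⟩

end BalancedMatrix

/-! ### Chevalley's theorem on tensor products of semisimple representations -/

namespace Chevalley

open Matrix
open scoped Kronecker

variable {G : Type*} [Group G]
variable {M N Q : Type*}
  [AddCommGroup M] [Module ℂ M] [Module (MonoidAlgebra ℂ G) M] [IsScalarTower ℂ (MonoidAlgebra ℂ G) M]
  [AddCommGroup N] [Module ℂ N] [Module (MonoidAlgebra ℂ G) N] [IsScalarTower ℂ (MonoidAlgebra ℂ G) N]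
  [AddCommGroup Q] [Module ℂ Q] [Module (MonoidAlgebra ℂ G) Q] [IsScalarTower ℂ (MonoidAlgebra ℂ G) Q]

/-- A subspace stable under the group, as a submodule over the group algebra. -/
def stableSubmodule (p : Submodule ℂ M) (h : ∀ g : G, ∀ x ∈ p, MonoidAlgebra.of ℂ G g • x ∈ p) :
    Submodule (MonoidAlgebra ℂ G) M where
  carrier := p
  add_mem' := p.add_mem
  zero_mem' := p.zero_mem
  smul_mem' r x hx := by
    induction r using MonoidAlgebra.induction_on with
    | of g => exact h g x hx
    | add r s hr hs =>
      rw [add_smul]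
      exact p.add_mem hr hs
    | smul c r hr =>
      rw [smul_assoc]
      exact p.smul_mem c hr

variable {n m : Type*} [Fintype n] [DecidableEq n] [Fintype m] [DecidableEq m]

/-- The matrix of a group element. -/
def actMatrix (b : Module.Basis n ℂ M) (g : G) : Matrix n n ℂ :=
  LinearMap.toMatrix b b (Algebra.lsmul ℂ ℂ M (MonoidAlgebra.of ℂ G g))

theorem actMatrix_mulVec (b : Module.Basis n ℂ M) (g : G) (x : M) :
    actMatrix b g *ᵥ b.equivFun x = b.equivFun (MonoidAlgebra.of ℂ G g • x) :=
  LinearMap.toMatrix_mulVec_repr b b _ x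

theorem equivFun_basis (b : Module.Basis n ℂ M) (i : n) : b.equivFun (b i) = Pi.single i 1 := by
  ext j
  rw [Module.Basis.equivFun_self, Pi.single_apply]
  exact if_congr eq_comm rfl rfl

theorem isUnit_actMatrix (b : Module.Basis n ℂ M) (g : G) : IsUnit (actMatrix b g) := by
  refine IsUnit.of_mul_eq_one (actMatrix b g⁻¹) ?_
  rw [actMatrix, actMatrix, ← LinearMap.toMatrix_mul, ← map_mul, ← map_mul, mul_inv_cancel,
    map_one, map_one, LinearMap.toMatrix_one]

theorem eq_bot_or_eq_top_of_isSimpleModule [IsSimpleModule (MonoidAlgebra ℂ G) M]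
    (b : Module.Basis n ℂ M) (W : Submodule ℂ (n → ℂ))
    (hW : ∀ g : G, ∀ w ∈ W, actMatrix b g *ᵥ w ∈ W) : W = ⊥ ∨ W = ⊤ := by
  let p : Submodule (MonoidAlgebra ℂ G) M := stableSubmodule (W.comap b.equivFun.toLinearMap)
    fun g x hx ↦ by
      change b.equivFun (MonoidAlgebra.of ℂ G g • x) ∈ W
      rw [← actMatrix_mulVec]
      exact hW g _ hx
  have hp : ∀ w, w ∈ W ↔ b.equivFun.symm w ∈ p := fun w ↦ by
    change w ∈ W ↔ b.equivFun (b.equivFun.symm w) ∈ W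
    rw [LinearEquiv.apply_symm_apply]
  rcases eq_bot_or_eq_top p with h | h
  · refine Or.inl ((Submodule.eq_bot_iff _).mpr fun w hw ↦ ?_)
    rw [hp, h, Submodule.mem_bot] at hw
    exact (LinearEquiv.map_eq_zero_iff _).mp hw
  · exact Or.inr (Submodule.eq_top_iff'.mpr fun w ↦ by rw [hp, h]; trivial)

/-- A complement of the preimage of `p` maps onto a complement of `p`. Working with matrices `C g`
avoids giving `n → ℂ` a module structure over the group algebra. -/
theorem isSemisimpleModule_of_surjective {C : G → Matrix n n ℂ}
    (hC : ∀ W : Submodule ℂ (n → ℂ), (∀ g, ∀ w ∈ W, C g *ᵥ w ∈ W) →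
      ∃ W' : Submodule ℂ (n → ℂ), (∀ g, ∀ w ∈ W', C g *ᵥ w ∈ W') ∧ IsCompl W W')
    (L : (n → ℂ) →ₗ[ℂ] Q) (hL : ∀ g v, L (C g *ᵥ v) = MonoidAlgebra.of ℂ G g • L v)
    (hs : Function.Surjective L) : IsSemisimpleModule (MonoidAlgebra ℂ G) Q where
  exists_isCompl p := by
    obtain ⟨W', hW', hc⟩ := hC ((p.restrictScalars ℂ).comap L) fun g w hw ↦ by
      change L _ ∈ p
      rw [hL]
      exact p.smul_mem _ hw
    refine ⟨stableSubmodule (W'.map L) ?_, ?_⟩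
    · rintro g _ ⟨w, hw, rfl⟩
      exact ⟨_, hW' g w hw, hL g w⟩
    · refine ⟨Submodule.disjoint_def.mpr ?_, codisjoint_iff.mpr (Submodule.eq_top_iff'.mpr ?_)⟩
      · rintro x hx ⟨w, hw, rfl⟩
        rw [Submodule.disjoint_def.mp hc.disjoint w hx hw, map_zero]
      · intro x
        obtain ⟨v, rfl⟩ := hs x
        obtain ⟨w, hw, w', hw', rfl⟩ := Submodule.mem_sup.mp
          (show v ∈ (p.restrictScalars ℂ).comap L ⊔ W' by rw [hc.sup_eq_top]; trivial)
        rw [map_add]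
        exact Submodule.add_mem_sup hw ⟨w', hw', rfl⟩

/-- In coordinates `β` is a linear map out of the tensor product, on which `g` acts by a Kronecker
product. `P` is its image, a quotient of a completely reducible space. -/
theorem exists_isSemisimpleModule_of_isSimpleModule [FiniteDimensional ℂ M] [FiniteDimensional ℂ N]
    [IsSimpleModule (MonoidAlgebra ℂ G) M] [IsSimpleModule (MonoidAlgebra ℂ G) N]
    (β : M →ₗ[ℂ] N →ₗ[ℂ] Q) (hβ : ∀ (g : G) x y,
      β (MonoidAlgebra.of ℂ G g • x) (MonoidAlgebra.of ℂ G g • y) = MonoidAlgebra.of ℂ G g • β x y) :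
    ∃ P : Submodule (MonoidAlgebra ℂ G) Q, IsSemisimpleModule (MonoidAlgebra ℂ G) P ∧
      ∀ x y, β x y ∈ P := by
  have := IsSimpleModule.nontrivial (MonoidAlgebra ℂ G) M
  have := IsSimpleModule.nontrivial (MonoidAlgebra ℂ G) N
  let b := Module.finBasis ℂ M
  let c := Module.finBasis ℂ N
  have : Nonempty (Fin (Module.finrank ℂ M)) := Fin.pos_iff_nonempty.mp Module.finrank_pos
  have : Nonempty (Fin (Module.finrank ℂ N)) := Fin.pos_iff_nonempty.mp Module.finrank_pos
  let L : (Fin (Module.finrank ℂ M) × Fin (Module.finrank ℂ N) → ℂ) →ₗ[ℂ] Q :=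
    Fintype.linearCombination ℂ fun p ↦ β (b p.1) (c p.2)
  have hLβ : ∀ x y, L (fun p ↦ b.equivFun x p.1 * c.equivFun y p.2) = β x y := fun x y ↦ by
    conv_rhs => rw [← b.sum_equivFun x, ← c.sum_equivFun y]
    simp only [L, Fintype.linearCombination_apply, map_sum, LinearMap.sum_apply, map_smul,
      LinearMap.smul_apply, Finset.smul_sum, smul_smul, Fintype.sum_prod_type]
    rw [Finset.sum_comm]
    exact Finset.sum_congr rfl fun i _ ↦ Finset.sum_congr rfl fun j _ ↦ by rw [mul_comm]
  have hL : ∀ (g : G) v, L ((actMatrix b g ⊗ₖ actMatrix c g) *ᵥ v) = MonoidAlgebra.of ℂ G g • L v := by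
    intro g v
    have : L ∘ₗ mulVecLin (actMatrix b g ⊗ₖ actMatrix c g) =
        Algebra.lsmul ℂ ℂ Q (MonoidAlgebra.of ℂ G g) ∘ₗ L := by
      refine (Pi.basisFun ℂ _).ext fun p ↦ ?_
      rw [LinearMap.comp_apply, LinearMap.comp_apply, Pi.basisFun_apply, mulVecLin_apply,
        mulVec_single_one, Algebra.lsmul_coe]
      have h1 : (actMatrix b g ⊗ₖ actMatrix c g).col p = fun q ↦
          b.equivFun (MonoidAlgebra.of ℂ G g • b p.1) q.1 *
            c.equivFun (MonoidAlgebra.of ℂ G g • c p.2) q.2 := by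
        funext q
        rw [← actMatrix_mulVec, ← actMatrix_mulVec]
        rw [equivFun_basis, equivFun_basis, mulVec_single_one, mulVec_single_one]
        rfl
      rw [h1, hLβ, hβ]
      congr 1
      simp [L, Fintype.linearCombination_apply, Pi.single_apply]
    exact congr($this v)
  let P : Submodule (MonoidAlgebra ℂ G) Q := stableSubmodule (LinearMap.range L) (by
    rintro g _ ⟨v, rfl⟩
    exact ⟨_, hL g v⟩)
  let L' : (Fin (Module.finrank ℂ M) × Fin (Module.finrank ℂ N) → ℂ) →ₗ[ℂ] P :=
    L.codRestrict (P.restrictScalars ℂ) fun v ↦ ⟨v, rfl⟩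
  refine ⟨P, isSemisimpleModule_of_surjective (C := fun g ↦ actMatrix b g ⊗ₖ actMatrix c g)
    (BalancedMatrix.exists_isCompl_kronecker (isUnit_actMatrix b) (isUnit_actMatrix c)
      (eq_bot_or_eq_top_of_isSimpleModule b) (eq_bot_or_eq_top_of_isSimpleModule c))
    L' (fun g v ↦ Subtype.ext (hL g v)) ?_,
    fun x y ↦ ⟨_, hLβ x y⟩⟩
  rintro ⟨_, v, rfl⟩
  exact ⟨v, rfl⟩

/-- Chevalley's theorem: the image of an equivariant bilinear map on semisimple modules is
contained in a semisimple submodule. -/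
theorem exists_isSemisimpleModule [FiniteDimensional ℂ M] [FiniteDimensional ℂ N]
    [IsSemisimpleModule (MonoidAlgebra ℂ G) M] [IsSemisimpleModule (MonoidAlgebra ℂ G) N]
    (β : M →ₗ[ℂ] N →ₗ[ℂ] Q) (hβ : ∀ (g : G) x y,
      β (MonoidAlgebra.of ℂ G g • x) (MonoidAlgebra.of ℂ G g • y) = MonoidAlgebra.of ℂ G g • β x y) :
    ∃ P : Submodule (MonoidAlgebra ℂ G) Q, IsSemisimpleModule (MonoidAlgebra ℂ G) P ∧
      ∀ x y, β x y ∈ P := by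
  -- Both modules are sums of simple submodules, and a sum of semisimple submodules is semisimple,
  -- so the images of all pairs of simples may be added up.
  let I := {S : Submodule (MonoidAlgebra ℂ G) M // IsSimpleModule (MonoidAlgebra ℂ G) S} ×
    {T : Submodule (MonoidAlgebra ℂ G) N // IsSimpleModule (MonoidAlgebra ℂ G) T}
  have key : ∀ i : I, ∃ P : Submodule (MonoidAlgebra ℂ G) Q,
      IsSemisimpleModule (MonoidAlgebra ℂ G) P ∧ ∀ x ∈ i.1.1, ∀ y ∈ i.2.1, β x y ∈ P := by
    rintro ⟨⟨S, hS⟩, ⟨T, hT⟩⟩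
    have : FiniteDimensional ℂ S :=
      inferInstanceAs (FiniteDimensional ℂ (S.restrictScalars ℂ))
    have : FiniteDimensional ℂ T :=
      inferInstanceAs (FiniteDimensional ℂ (T.restrictScalars ℂ))
    let β' : S →ₗ[ℂ] T →ₗ[ℂ] Q := β.compl₁₂ (S.subtype.restrictScalars ℂ) (T.subtype.restrictScalars ℂ)
    obtain ⟨P, hP, h⟩ := exists_isSemisimpleModule_of_isSimpleModule β' fun g x y ↦ hβ g x y
    exact ⟨P, hP, fun x hx y hy ↦ h ⟨x, hx⟩ ⟨y, hy⟩⟩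
  choose P hP h using key
  refine ⟨⨆ i, P i, ?_, fun x y ↦ ?_⟩
  · have := isSemisimpleModule_biSup_of_isSemisimpleModule_submodule (s := Set.univ) (p := P)
      fun i _ ↦ hP i
    have e : ⨆ i ∈ Set.univ, P i = ⨆ i, P i := iSup_univ
    rwa [← e]
  · have hx : x ∈ ⨆ S : {S : Submodule (MonoidAlgebra ℂ G) M // IsSimpleModule (MonoidAlgebra ℂ G) S},
        S.1 := by
      have h1 := IsSemisimpleModule.sSup_simples_eq_top (MonoidAlgebra ℂ G) M
      rw [sSup_eq_iSup'] at h1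
      exact h1.ge Submodule.mem_top
    have hy : y ∈ ⨆ T : {T : Submodule (MonoidAlgebra ℂ G) N // IsSimpleModule (MonoidAlgebra ℂ G) T},
        T.1 := by
      have h1 := IsSemisimpleModule.sSup_simples_eq_top (MonoidAlgebra ℂ G) N
      rw [sSup_eq_iSup'] at h1
      exact h1.ge Submodule.mem_top
    induction hx using Submodule.iSup_induction' with
    | mem S x hx =>
      induction hy using Submodule.iSup_induction' with
      | mem T y hy => exact Submodule.mem_iSup_of_mem (S, T) (h (S, T) x hx y hy)
      | zero => rw [map_zero]; exact zero_mem _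
      | add y z _ _ hy hz => rw [map_add]; exact add_mem hy hz
    | zero => rw [map_zero]; exact zero_mem _
    | add x z _ _ hx hz => rw [map_add]; exact add_mem hx hz

end Chevalley

/-! ### Bounds for the Loewy filtration -/

section Loewy

variable {A M : Type*} [Ring A] [AddCommGroup M] [Module A M]

theorem loewyFiltration_succ_le_of_le {i : ℕ} {N : Submodule A M} (hN : N ≤ loewyFiltration A M i)
    (h : IsSemisimpleModule A (↥(loewyFiltration A M i) ⧸ N.submoduleOf (loewyFiltration A M i))) :
    loewyFiltration A M (i + 1) ≤ N :=
  sInf_le ⟨hN, h⟩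

theorem isSemisimpleModule_of_subsingleton [Subsingleton M] : IsSemisimpleModule A M where
  exists_isCompl _ := ⟨⊥, disjoint_bot_right, codisjoint_iff.mpr (Subsingleton.elim _ _)⟩

theorem loewyFiltration_succ_le (i : ℕ) : loewyFiltration A M (i + 1) ≤ loewyFiltration A M i := by
  refine loewyFiltration_succ_le_of_le le_rfl ?_
  have : Subsingleton (↥(loewyFiltration A M i) ⧸
      (loewyFiltration A M i).submoduleOf (loewyFiltration A M i)) := by
    rw [Submodule.submoduleOf_self]
    exact Submodule.Quotient.subsingleton_iff.mpr rfl
  exact isSemisimpleModule_of_subsingleton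

theorem loewyFiltration_antitone : Antitone (loewyFiltration A M) :=
  antitone_nat_of_succ_le loewyFiltration_succ_le

/-- A descending chain with semisimple subquotients bounds the Loewy filtration. -/
theorem loewyFiltration_le_of_chain {W : ℕ → Submodule A M} (h0 : W 0 = ⊤)
    (h : ∀ i, ∃ P : Submodule A (M ⧸ W (i + 1)), IsSemisimpleModule A P ∧
      W i ≤ P.comap (W (i + 1)).mkQ) (i : ℕ) : loewyFiltration A M i ≤ W i := by
  induction i with
  | zero => exact h0.symm ▸ le_top
  | succ i ih =>
    obtain ⟨P, hP, hWP⟩ := h i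
    refine le_trans (loewyFiltration_succ_le_of_le
      (N := loewyFiltration A M i ⊓ W (i + 1)) inf_le_left ?_) inf_le_right
    -- The kernel of `f` is `F i ⊓ W (i + 1)`, so the quotient embeds in the semisimple `P` and `F
    -- (i + 1)` lies below that kernel.
    let f : loewyFiltration A M i →ₗ[A] P :=
      ((W (i + 1)).mkQ ∘ₗ (loewyFiltration A M i).subtype).codRestrict P fun x ↦ hWP (ih x.2)
    have hf : (loewyFiltration A M i ⊓ W (i + 1)).submoduleOf (loewyFiltration A M i) =
        LinearMap.ker f := by
      ext x
      rw [LinearMap.mem_ker, ← Subtype.coe_inj]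
      change (x : M) ∈ loewyFiltration A M i ⊓ W (i + 1) ↔ (W (i + 1)).mkQ x = 0
      rw [Submodule.mkQ_apply, Submodule.Quotient.mk_eq_zero, Submodule.mem_inf, and_iff_right x.2]
    rw [hf]
    exact IsSemisimpleModule.of_injective ((LinearMap.ker f).liftQ f le_rfl)
      (LinearMap.ker_eq_bot.mp (Submodule.ker_liftQ_eq_bot _ _ _ le_rfl))

/-- A nonzero Noetherian module has a maximal proper submodule. Its quotient is simple, so it
competes in the definition of the next step. -/
theorem loewyFiltration_succ_lt [IsNoetherian A M] {i : ℕ} (h : loewyFiltration A M i ≠ ⊥) :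
    loewyFiltration A M (i + 1) < loewyFiltration A M i := by
  set F := loewyFiltration A M i with hF
  have : Nontrivial F := Submodule.nontrivial_iff_ne_bot.mpr h
  obtain ⟨N, hN⟩ := IsCoatomic.exists_coatom (α := Submodule A F)
  have hNF : (N.map F.subtype).submoduleOf F = N :=
    Submodule.comap_map_eq_of_injective F.injective_subtype N
  have hle : loewyFiltration A M (i + 1) ≤ N.map F.subtype := by
    refine loewyFiltration_succ_le_of_le (Submodule.map_subtype_le F N) ?_
    have : IsSimpleModule A (F ⧸ N) := isSimpleModule_iff_isCoatom.mpr hN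
    rw [← hF, hNF]
    infer_instance
  refine lt_of_le_of_ne (loewyFiltration_succ_le i) fun heq ↦ hN.1 ?_
  rw [heq] at hle
  exact Submodule.eq_top_iff'.mpr fun x ↦ by
    obtain ⟨y, hy, hyx⟩ := hle x.2
    rwa [← Subtype.ext hyx]

/-- Each nonzero step costs at least one dimension. This is where the constant `C = h⁰(L)` comes
from. -/
theorem loewyFiltration_finrank [Algebra ℂ A] [Module ℂ M] [IsScalarTower ℂ A M]
    [FiniteDimensional ℂ M] : loewyFiltration A M (Module.finrank ℂ M) = ⊥ := by
  have : IsNoetherian A M := isNoetherian_of_tower ℂ inferInstance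
  have key : ∀ i, loewyFiltration A M i = ⊥ ∨
      Module.finrank ℂ ((loewyFiltration A M i).restrictScalars ℂ) + i ≤ Module.finrank ℂ M := by
    intro i
    induction i with
    | zero => exact Or.inr (Submodule.finrank_le _)
    | succ i ih =>
      by_cases h : loewyFiltration A M i = ⊥
      · exact Or.inl (le_bot_iff.mp (h ▸ loewyFiltration_succ_le i))
      · refine Or.inr ?_
        have h1 := Submodule.finrank_lt_finrank_of_lt
          (s := (loewyFiltration A M (i + 1)).restrictScalars ℂ)
          (t := (loewyFiltration A M i).restrictScalars ℂ) (loewyFiltration_succ_lt h)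
        have h2 := ih.resolve_left h
        omega
  refine (key _).elim id fun h ↦ ?_
  have h1 : Module.finrank ℂ ((loewyFiltration A M (Module.finrank ℂ M)).restrictScalars ℂ) = 0 := by
    omega
  exact (Submodule.restrictScalars_eq_bot_iff ..).mp (Submodule.finrank_eq_zero.mp h1)

end Loewy

/-! ### Loewy filtrations and bilinear maps -/

namespace Chevalley

variable {G : Type*} [Group G]
variable {M N Q : Type*}
  [AddCommGroup M] [Module ℂ M] [Module (MonoidAlgebra ℂ G) M] [IsScalarTower ℂ (MonoidAlgebra ℂ G) M]
  [AddCommGroup N] [Module ℂ N] [Module (MonoidAlgebra ℂ G) N] [IsScalarTower ℂ (MonoidAlgebra ℂ G) N]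
  [AddCommGroup Q] [Module ℂ Q] [Module (MonoidAlgebra ℂ G) Q] [IsScalarTower ℂ (MonoidAlgebra ℂ G) Q]

/-- Chevalley's theorem for a bilinear map that factors through semisimple quotients. -/
theorem exists_isSemisimpleModule_of_quotient [FiniteDimensional ℂ M] [FiniteDimensional ℂ N]
    (M' : Submodule (MonoidAlgebra ℂ G) M) (N' : Submodule (MonoidAlgebra ℂ G) N)
    [IsSemisimpleModule (MonoidAlgebra ℂ G) (M ⧸ M')] [IsSemisimpleModule (MonoidAlgebra ℂ G) (N ⧸ N')]
    (β : M →ₗ[ℂ] N →ₗ[ℂ] Q) (hβ : ∀ (g : G) x y,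
      β (MonoidAlgebra.of ℂ G g • x) (MonoidAlgebra.of ℂ G g • y) = MonoidAlgebra.of ℂ G g • β x y)
    (hM : ∀ x ∈ M', ∀ y, β x y = 0) (hN : ∀ x, ∀ y ∈ N', β x y = 0) :
    ∃ P : Submodule (MonoidAlgebra ℂ G) Q, IsSemisimpleModule (MonoidAlgebra ℂ G) P ∧
      ∀ x y, β x y ∈ P := by
  have : FiniteDimensional ℂ (M ⧸ M') :=
    Module.Finite.of_surjective (M'.mkQ.restrictScalars ℂ) M'.mkQ_surjective
  have : FiniteDimensional ℂ (N ⧸ N') :=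
    Module.Finite.of_surjective (N'.mkQ.restrictScalars ℂ) N'.mkQ_surjective
  let f : M ⧸ M' → N ⧸ N' → Q := fun x y ↦ β (Quotient.out x) (Quotient.out y)
  have hf : ∀ x y, f (M'.mkQ x) (N'.mkQ y) = β x y := by
    intro x y
    have h1 : Quotient.out (M'.mkQ x) - x ∈ M' := by
      rw [← Submodule.Quotient.mk_eq_zero, Submodule.Quotient.mk_sub, sub_eq_zero]
      exact Quotient.out_eq _
    have h2 : Quotient.out (N'.mkQ y) - y ∈ N' := by
      rw [← Submodule.Quotient.mk_eq_zero, Submodule.Quotient.mk_sub, sub_eq_zero]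
      exact Quotient.out_eq _
    have h3 := hM _ h1 (Quotient.out (N'.mkQ y))
    have h4 := hN x _ h2
    rw [map_sub, LinearMap.sub_apply, sub_eq_zero] at h3
    rw [map_sub, sub_eq_zero] at h4
    exact h3.trans h4
  let β' : M ⧸ M' →ₗ[ℂ] N ⧸ N' →ₗ[ℂ] Q := LinearMap.mk₂ ℂ f
    (fun x x' y ↦ by
      obtain ⟨x, rfl⟩ := M'.mkQ_surjective x
      obtain ⟨x', rfl⟩ := M'.mkQ_surjective x'
      obtain ⟨y, rfl⟩ := N'.mkQ_surjective y
      rw [← map_add, hf, hf, hf, map_add, LinearMap.add_apply])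
    (fun c x y ↦ by
      obtain ⟨x, rfl⟩ := M'.mkQ_surjective x
      obtain ⟨y, rfl⟩ := N'.mkQ_surjective y
      rw [← LinearMap.map_smul_of_tower, hf, hf, map_smul, LinearMap.smul_apply])
    (fun x y y' ↦ by
      obtain ⟨x, rfl⟩ := M'.mkQ_surjective x
      obtain ⟨y, rfl⟩ := N'.mkQ_surjective y
      obtain ⟨y', rfl⟩ := N'.mkQ_surjective y'
      rw [← map_add, hf, hf, hf, map_add])
    (fun c x y ↦ by
      obtain ⟨x, rfl⟩ := M'.mkQ_surjective x
      obtain ⟨y, rfl⟩ := N'.mkQ_surjective y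
      rw [← LinearMap.map_smul_of_tower, hf, hf, map_smul])
  obtain ⟨P, hP, h⟩ := exists_isSemisimpleModule β' fun g x y ↦ by
    obtain ⟨x, rfl⟩ := M'.mkQ_surjective x
    obtain ⟨y, rfl⟩ := N'.mkQ_surjective y
    change f _ _ = MonoidAlgebra.of ℂ G g • f _ _
    rw [← map_smul, ← map_smul, hf, hf, hβ]
  exact ⟨P, hP, fun x y ↦ hf x y ▸ h (M'.mkQ x) (N'.mkQ y)⟩

/-- The span of the products of the `p`-th and the `q`-th Loewy steps with `p + q = j`. -/
def productFiltration (β : M →ₗ[ℂ] N →ₗ[ℂ] Q) (hβ : ∀ (g : G) x y,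
      β (MonoidAlgebra.of ℂ G g • x) (MonoidAlgebra.of ℂ G g • y) = MonoidAlgebra.of ℂ G g • β x y)
    (j : ℕ) : Submodule (MonoidAlgebra ℂ G) Q :=
  stableSubmodule (Submodule.span ℂ {z | ∃ p q, p + q = j ∧
      ∃ x ∈ loewyFiltration (MonoidAlgebra ℂ G) M p, ∃ y ∈ loewyFiltration (MonoidAlgebra ℂ G) N q,
        β x y = z}) fun g z hz ↦ by
    induction hz using Submodule.span_induction with
    | mem z hz =>
      obtain ⟨p, q, hpq, x, hx, y, hy, rfl⟩ := hz
      exact Submodule.subset_span ⟨p, q, hpq, _, Submodule.smul_mem _ _ hx, _,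
        Submodule.smul_mem _ _ hy, hβ g x y⟩
    | zero => rw [smul_zero]; exact zero_mem _
    | add x y _ _ hx hy => rw [smul_add]; exact add_mem hx hy
    | smul c x _ hx => rw [smul_comm]; exact Submodule.smul_mem _ c hx

variable {β : M →ₗ[ℂ] N →ₗ[ℂ] Q} {hβ : ∀ (g : G) x y,
      β (MonoidAlgebra.of ℂ G g • x) (MonoidAlgebra.of ℂ G g • y) = MonoidAlgebra.of ℂ G g • β x y}

theorem mem_productFiltration {p q j : ℕ} (hpq : p + q = j) {x : M} {y : N}
    (hx : x ∈ loewyFiltration (MonoidAlgebra ℂ G) M p)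
    (hy : y ∈ loewyFiltration (MonoidAlgebra ℂ G) N q) : β x y ∈ productFiltration β hβ j :=
  Submodule.subset_span ⟨p, q, hpq, x, hx, y, hy, rfl⟩

theorem productFiltration_le {j : ℕ} {P : Submodule (MonoidAlgebra ℂ G) Q}
    (h : ∀ p q, p + q = j → ∀ x ∈ loewyFiltration (MonoidAlgebra ℂ G) M p,
      ∀ y ∈ loewyFiltration (MonoidAlgebra ℂ G) N q, β x y ∈ P) : productFiltration β hβ j ≤ P := by
  have : Submodule.span ℂ {z | ∃ p q, p + q = j ∧
      ∃ x ∈ loewyFiltration (MonoidAlgebra ℂ G) M p, ∃ y ∈ loewyFiltration (MonoidAlgebra ℂ G) N q,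
        β x y = z} ≤ P.restrictScalars ℂ := by
    rw [Submodule.span_le]
    rintro _ ⟨p, q, hpq, x, hx, y, hy, rfl⟩
    exact h p q hpq x hx y hy
  exact this

/-- If `Q` is spanned by products of elements of `M` and `N`, the Loewy filtration of `Q` is
contained in the product of the Loewy filtrations. -/
theorem loewyFiltration_le_productFiltration [FiniteDimensional ℂ M] [FiniteDimensional ℂ N]
    (hspan : ∀ z, z ∈ Submodule.span ℂ {z | ∃ x y, β x y = z}) (j : ℕ) :
    loewyFiltration (MonoidAlgebra ℂ G) Q j ≤ productFiltration β hβ j := by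
  -- The Artinian property ensures that the infimum defining each step is attained, so that the
  -- graded pieces are semisimple.
  have : IsArtinian (MonoidAlgebra ℂ G) M := isArtinian_of_tower ℂ inferInstance
  have : IsArtinian (MonoidAlgebra ℂ G) N := isArtinian_of_tower ℂ inferInstance
  refine loewyFiltration_le_of_chain (Submodule.eq_top_iff'.mpr fun z ↦ ?_) (fun j ↦ ?_) j
  · refine Submodule.span_mono ?_ (hspan z)
    rintro _ ⟨x, y, rfl⟩
    exact ⟨0, 0, rfl, x, trivial, y, trivial, rfl⟩
  · set W := productFiltration β hβ (j + 1) with hW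
    -- Raising either index puts the product in `W`, so modulo `W` multiplication factors through
    -- the graded pieces of degrees `p` and `q`.
    have key : ∀ p q : ℕ, p + q = j → ∃ P : Submodule (MonoidAlgebra ℂ G) (Q ⧸ W),
        IsSemisimpleModule (MonoidAlgebra ℂ G) P ∧
        ∀ x ∈ loewyFiltration (MonoidAlgebra ℂ G) M p,
        ∀ y ∈ loewyFiltration (MonoidAlgebra ℂ G) N q, W.mkQ (β x y) ∈ P := by
      intro p q hp
      have h1 := (loewyFiltration_isLeast (MonoidAlgebra ℂ G) M p).1.2
      have h2 := (loewyFiltration_isLeast (MonoidAlgebra ℂ G) N q).1.2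
      set S := loewyFiltration (MonoidAlgebra ℂ G) M p
      set T := loewyFiltration (MonoidAlgebra ℂ G) N q
      have : FiniteDimensional ℂ S :=
        inferInstanceAs (FiniteDimensional ℂ (S.restrictScalars ℂ))
      have : FiniteDimensional ℂ T :=
        inferInstanceAs (FiniteDimensional ℂ (T.restrictScalars ℂ))
      let β' : S →ₗ[ℂ] T →ₗ[ℂ] (Q ⧸ W) := (β.compl₁₂ (S.subtype.restrictScalars ℂ)
        (T.subtype.restrictScalars ℂ)).compr₂ (W.mkQ.restrictScalars ℂ)
      have hβ' : ∀ x y, β' x y = W.mkQ (β x y) := fun _ _ ↦ rfl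
      obtain ⟨P, hP, h⟩ := exists_isSemisimpleModule_of_quotient
        ((loewyFiltration (MonoidAlgebra ℂ G) M (p + 1)).submoduleOf S)
        ((loewyFiltration (MonoidAlgebra ℂ G) N (q + 1)).submoduleOf T) β'
        (fun g x y ↦ by
          rw [hβ', hβ', ← map_smul, ← hβ]
          rfl)
        (fun x hx y ↦ by
          rw [hβ', Submodule.mkQ_apply, Submodule.Quotient.mk_eq_zero]
          exact mem_productFiltration (p := p + 1) (q := q) (by omega) hx y.2)
        (fun x y hy ↦ by
          rw [hβ', Submodule.mkQ_apply, Submodule.Quotient.mk_eq_zero]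
          exact mem_productFiltration (p := p) (q := q + 1) (by omega) x.2 hy)
      exact ⟨P, hP, fun x hx y hy ↦ h ⟨x, hx⟩ ⟨y, hy⟩⟩
    choose P hP h using fun p : Fin (j + 1) ↦ key p (j - p) (by omega)
    refine ⟨⨆ p, P p, ?_, productFiltration_le fun p q hpq x hx y hy ↦ ?_⟩
    · have := isSemisimpleModule_biSup_of_isSemisimpleModule_submodule (s := Set.univ) (p := P)
        fun i _ ↦ hP i
      have e : ⨆ i ∈ Set.univ, P i = ⨆ i, P i := iSup_univ
      rwa [← e]
    · obtain rfl : q = j - p := by omega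
      exact Submodule.mem_iSup_of_mem ⟨p, by omega⟩ (h ⟨p, by omega⟩ x hx y hy)

/-- Subadditivity of the length of the Loewy filtration under products. -/
theorem loewyFiltration_add_eq_bot [FiniteDimensional ℂ M] [FiniteDimensional ℂ N]
    (β : M →ₗ[ℂ] N →ₗ[ℂ] Q) (hβ : ∀ (g : G) x y,
      β (MonoidAlgebra.of ℂ G g • x) (MonoidAlgebra.of ℂ G g • y) = MonoidAlgebra.of ℂ G g • β x y)
    (hspan : ∀ z, z ∈ Submodule.span ℂ {z | ∃ x y, β x y = z}) {a b : ℕ}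
    (ha : loewyFiltration (MonoidAlgebra ℂ G) M a = ⊥)
    (hb : loewyFiltration (MonoidAlgebra ℂ G) N b = ⊥) :
    loewyFiltration (MonoidAlgebra ℂ G) Q (a + b) = ⊥ := by
  refine le_bot_iff.mp ((loewyFiltration_le_productFiltration (hβ := hβ) hspan _).trans
    (productFiltration_le fun p q hpq x hx y hy ↦ ?_))
  rw [Submodule.mem_bot]
  rcases le_total a p with h | h
  · have := loewyFiltration_antitone h hx
    rw [ha, Submodule.mem_bot] at this
    rw [this, map_zero, LinearMap.zero_apply]
  · have := loewyFiltration_antitone (show b ≤ q by omega) hy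
    rw [hb, Submodule.mem_bot] at this
    rw [this, map_zero]

end Chevalley

/-! ### Finiteness of spaces of elements of a field -/

/-- Every nonzero element of `S` divides a nonzero element of `A`, as it is algebraic over `A`, so
denominators from `A` suffice. This makes `L` finite over the fraction field of `A` once `S` is
finite over `A`. -/
theorem isLocalization_algebraMapSubmonoid (A S L : Type*) [CommRing A] [IsDomain A] [CommRing S]
    [IsDomain S] [Algebra A S] [FaithfulSMul A S] [Algebra.IsIntegral A S] [Field L] [Algebra S L]
    [IsFractionRing S L] :
    IsLocalization (Algebra.algebraMapSubmonoid S (nonZeroDivisors A)) L where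
  map_units := by
    rintro ⟨_, a, ha, rfl⟩
    rw [isUnit_iff_ne_zero, Ne, FaithfulSMul.algebraMap_eq_zero_iff,
      FaithfulSMul.algebraMap_eq_zero_iff]
    exact nonZeroDivisors.ne_zero ha
  surj z := by
    obtain ⟨x, y, hy, rfl⟩ := IsFractionRing.div_surjective S z
    obtain ⟨a, ha, c, hc⟩ := (Algebra.IsAlgebraic.isAlgebraic (R := A) y).exists_nonzero_dvd hy
    refine ⟨⟨x * c, algebraMap A S a, a, mem_nonZeroDivisors_of_ne_zero ha, rfl⟩, ?_⟩
    have hy' : algebraMap S L y ≠ 0 := by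
      rw [Ne, FaithfulSMul.algebraMap_eq_zero_iff]
      exact nonZeroDivisors.ne_zero hy
    change _ / _ * algebraMap S L (algebraMap A S a) = algebraMap S L (x * c)
    rw [hc, map_mul, map_mul]
    field_simp
  exists_of_eq h := ⟨1, congrArg _ (FaithfulSMul.algebraMap_injective S L h)⟩

set_option maxHeartbeats 1000000 in
/-- Finiteness of the normalization of a finitely generated domain `S`: the elements of the fraction
field of `S` that are integral over `S` lie in a finitely generated `S`-module. -/
theorem Subalgebra.FG.exists_fg_of_isIntegral {F E : Type*} [Field F] [CharZero F] [Field E]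
    [Algebra F E] (S : Subalgebra F E) (hS : S.FG) :
    ∃ T : Submodule S E, T.FG ∧
      ∀ x : E, IsIntegral S x → (∃ a ∈ S, ∃ b ∈ S, b ≠ 0 ∧ b * x = a) → x ∈ T := by
  have : Algebra.FiniteType F S := S.fg_iff_finiteType.mp hS
  -- Noether normalization: `S` is finite over a polynomial ring `A`. As `A` is integrally closed
  -- and the characteristic is zero, the integral closure of `A` in `L` is a Noetherian `A`-module.
  obtain ⟨s, g, hg, hfin⟩ := exists_finite_inj_algHom_of_fg F S
  algebraize [g.toRingHom]
  let A := MvPolynomial (Fin s) F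
  let L := FractionRing S
  have : FaithfulSMul A S := (faithfulSMul_iff_algebraMap_injective _ _).mpr hg
  have : Module.Finite A S := hfin
  let := FractionRing.liftAlgebra A L
  have : Algebra.IsAlgebraic (FractionRing A) L := isAlgebraic_of_isFractionRing A S ..
  have : IsLocalization (Algebra.algebraMapSubmonoid S (nonZeroDivisors A)) L :=
    isLocalization_algebraMapSubmonoid A S L
  have : FiniteDimensional (FractionRing A) L := .of_isLocalization A S (nonZeroDivisors A)
  have : IsNoetherian A (integralClosure A L) :=
    IsIntegralClosure.isNoetherian A (FractionRing A) L (integralClosure A L)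
  let φ : L →ₐ[S] E := IsFractionRing.liftAlgHom (g := Algebra.ofId S E) Subtype.val_injective
  let C : Submodule S L := Subalgebra.toSubmodule (integralClosure S L)
  -- Integral over `S` is the same as integral over `A`, so generators over `A` also serve over `S`.
  have hC : C.FG := by
    have h1 : Submodule.FG ((Subalgebra.toSubmodule (integralClosure A L))) :=
      Module.Finite.iff_fg.mp (Module.IsNoetherian.finite A (integralClosure A L))
    obtain ⟨t, ht⟩ := h1
    refine ⟨t, le_antisymm (Submodule.span_le.mpr fun x hx ↦ ?_) fun x hx ↦ ?_⟩
    · have h2 : x ∈ integralClosure A L := by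
        have : x ∈ Submodule.span A (t : Set L) := Submodule.subset_span hx
        rwa [ht] at this
      exact IsIntegral.tower_top h2
    · have h2 : x ∈ Submodule.span A (t : Set L) := by
        rw [ht]
        exact isIntegral_trans (R := A) (A := S) x hx
      exact Submodule.span_le_restrictScalars A S _ h2
  refine ⟨C.map φ.toLinearMap, hC.map _, ?_⟩
  rintro x hx ⟨a, ha, b, hb, hb0, hab⟩
  have hφb : algebraMap S L ⟨b, hb⟩ ≠ 0 := by
    rw [Ne, FaithfulSMul.algebraMap_eq_zero_iff]
    exact fun h ↦ hb0 congr(Subtype.val $h)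
  have hy : φ (algebraMap S L ⟨a, ha⟩ / algebraMap S L ⟨b, hb⟩) = x := by
    rw [map_div₀, AlgHom.commutes, AlgHom.commutes]
    rw [div_eq_iff]
    · rw [mul_comm]; exact hab.symm
    · exact hb0
  refine ⟨_, ?_, hy⟩
  exact (isIntegral_algHom_iff φ φ.toRingHom.injective).mp (hy.symm ▸ hx)

theorem Submodule.prod_pow_mem_pow_sum {R A ι : Type*} [CommSemiring R] [CommSemiring A]
    [Algebra R A] {M : Submodule R A} {f : ι → A} (s : Finset ι) (d : ι → ℕ)
    (hf : ∀ i ∈ s, f i ∈ M) : ∏ i ∈ s, f i ^ d i ∈ M ^ ∑ i ∈ s, d i := by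
  classical
  induction s using Finset.induction_on with
  | empty => rw [Finset.prod_empty, Finset.sum_empty, pow_zero]; exact Submodule.one_le.mp le_rfl
  | insert i s hi ih =>
    rw [Finset.prod_insert hi, Finset.sum_insert hi, pow_add]
    exact Submodule.mul_mem_mul (Submodule.pow_mem_pow _ (hf i (Finset.mem_insert_self i s)) _)
      (ih fun j hj ↦ hf j (Finset.mem_insert_of_mem hj))

/-- By pigeonhole, a monomial of degree `∑ N l + 1` contains some `r l` more than `N l` times, and
the factor `r l ^ N l` absorbs `x`. Thus a single exponent `D` works for all of `M ^ D`. -/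
theorem exists_forall_mem_pow_mul_mem {F K ι : Type*} [Field F] [Field K] [Algebra F K] [Fintype ι]
    (r : ι → K) (x : K)
    (h : ∀ l, ∃ N, r l ^ N * x ∈ Submodule.span F (Set.range r) ^ (N + 1)) :
    ∃ D, ∀ m ∈ Submodule.span F (Set.range r) ^ D,
      m * x ∈ Submodule.span F (Set.range r) ^ (D + 1) := by
  classical
  set M := Submodule.span F (Set.range r) with hM
  have hr : ∀ l, r l ∈ M := fun l ↦ Submodule.subset_span ⟨l, rfl⟩
  choose N hN using h
  refine ⟨∑ l, N l + 1, fun m hm ↦ ?_⟩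
  rw [hM, Submodule.span_pow] at hm
  induction hm using Submodule.span_induction with
  | zero => rw [zero_mul]; exact zero_mem _
  | add a b _ _ ha hb => rw [add_mul]; exact add_mem ha hb
  | smul c a _ ha => rw [smul_mul_assoc]; exact Submodule.smul_mem _ c ha
  | mem a ha =>
    obtain ⟨f, rfl⟩ := Set.mem_pow.mp ha
    choose p hp using fun i ↦ (f i).2
    have : ∃ l, N l < (Finset.univ.filter fun i ↦ p i = l).card := by
      by_contra! hcon
      have h1 := Finset.sum_le_sum fun l (_ : l ∈ Finset.univ) ↦ hcon l
      rw [← Finset.card_eq_sum_card_fiberwise (f := p)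
        (fun _ _ ↦ Finset.mem_coe.mpr (Finset.mem_univ _)),
        Finset.card_univ, Fintype.card_fin] at h1
      omega
    obtain ⟨l, hl⟩ := this
    have hprod : (List.ofFn fun i ↦ (f i : K)).prod = ∏ i, r (p i) := by
      rw [List.prod_ofFn]
      exact Finset.prod_congr rfl fun i _ ↦ (hp i).symm
    have hs := Finset.prod_filter_mul_prod_filter_not Finset.univ (fun i ↦ p i = l) fun i ↦ r (p i)
    have hc := Finset.card_filter_add_card_filter_not (s := Finset.univ) (fun i ↦ p i = l)
    rw [Finset.card_univ, Fintype.card_fin] at hc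
    have h1 : ∏ i with p i = l, r (p i) =
        r l ^ N l * r l ^ ((Finset.univ.filter fun i ↦ p i = l).card - N l) := by
      rw [← pow_add, Nat.add_sub_cancel' hl.le, ← Finset.prod_const]
      exact Finset.prod_congr rfl fun i hi ↦ by rw [(Finset.mem_filter.mp hi).2]
    have h2 : ∏ i with ¬ p i = l, r (p i) ∈ M ^ (Finset.univ.filter fun i ↦ ¬ p i = l).card := by
      simpa using Submodule.prod_pow_mem_pow_sum (Finset.univ.filter fun i ↦ ¬ p i = l) (fun _ ↦ 1)
        fun i _ ↦ hr (p i)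
    rw [hprod, ← hs, h1, show ∀ a b c d : K, a * b * c * d = a * d * (b * c) from fun a b c d ↦ by ring]
    rw [show ∑ l, N l + 1 + 1 = N l + 1 + (((Finset.univ.filter fun i ↦ p i = l).card - N l) +
      (Finset.univ.filter fun i ↦ ¬ p i = l).card) by omega, pow_add, pow_add _ (_ - _)]
    exact Submodule.mul_mem_mul (hN l) (Submodule.mul_mem_mul (Submodule.pow_mem_pow _ (hr l) _) h2)

open Polynomial in
/-- A vector space of elements `x` of a field `K` is finite-dimensional if there are `r l ∈ K`, one
of them equal to `1`, such that for all `x` and `l` some `r l ^ N * x` is a homogeneous polynomial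
of degree `N + 1` in the `r l`. -/
theorem finiteDimensional_of_pow_mul_mem {F K ι : Type*} [Field F] [CharZero F] [Field K]
    [Algebra F K] [Fintype ι] (r : ι → K) (j : ι) (hj : r j = 1) (V : Submodule F K)
    (h : ∀ x ∈ V, ∀ l, ∃ N, r l ^ N * x ∈ Submodule.span F (Set.range r) ^ (N + 1)) :
    FiniteDimensional F V := by
  classical
  set M := Submodule.span F (Set.range r) with hM
  have h1M : (1 : K) ∈ M := Submodule.subset_span ⟨j, hj⟩
  have hMfg : M.FG := Submodule.fg_span (Set.finite_range r)
  -- The variable records the degree: `S` is the graded algebra generated in degree one by the `r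
  -- l`, and elements of `V` enter as `x X`, also in degree one.
  let S : Subalgebra F K[X] := Algebra.adjoin F (Set.range fun l ↦ C (r l) * X)
  have hS1 : ∀ m ∈ M, C m * X ∈ S := by
    intro m hm
    induction hm using Submodule.span_induction with
    | mem m hm =>
      obtain ⟨l, rfl⟩ := hm
      exact Algebra.subset_adjoin ⟨l, rfl⟩
    | zero => rw [C_0, zero_mul]; exact zero_mem _
    | add a b _ _ ha hb => rw [C_add, add_mul]; exact add_mem ha hb
    | smul c a _ ha => rw [← smul_C, smul_mul_assoc]; exact Subalgebra.smul_mem _ ha c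
  have hSd : ∀ d, ∀ m ∈ M ^ d, C m * X ^ d ∈ S := by
    intro d
    induction d with
    | zero =>
      intro m hm
      rw [pow_zero, Submodule.mem_one] at hm
      obtain ⟨c, rfl⟩ := hm
      rw [pow_zero, mul_one]
      exact S.algebraMap_mem c
    | succ d ih =>
      intro m hm
      rw [pow_succ] at hm
      induction hm using Submodule.mul_induction_on' with
      | mem_mul_mem a ha b hb =>
        rw [C_mul, pow_succ, mul_mul_mul_comm]
        exact mul_mem (ih a ha) (hS1 b hb)
      | add a _ b _ ha hb => rw [C_add, add_mul]; exact add_mem ha hb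
  have hS0 : ∀ s ∈ S, ∃ c : F, algebraMap F K c = s.coeff 0 := by
    intro s hs
    induction hs using Algebra.adjoin_induction with
    | mem x hx =>
      obtain ⟨l, rfl⟩ := hx
      exact ⟨0, by rw [map_zero, coeff_mul_X_zero]⟩
    | algebraMap c => exact ⟨c, by rw [Polynomial.algebraMap_apply, coeff_C_zero]⟩
    | add x y _ _ hx hy =>
      obtain ⟨a, ha⟩ := hx
      obtain ⟨b, hb⟩ := hy
      exact ⟨a + b, by rw [map_add, coeff_add, ha, hb]⟩
    | mul x y _ _ hx hy =>
      obtain ⟨a, ha⟩ := hx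
      obtain ⟨b, hb⟩ := hy
      exact ⟨a * b, by rw [map_mul, mul_coeff_zero, ha, hb]⟩
  have hint : ∀ x ∈ V, IsIntegral S (C x * X) := by
    intro x hx
    obtain ⟨D, hD⟩ := exists_forall_mem_pow_mul_mem r x (h x hx)
    -- The determinant trick: `N`, generated over `S` by `M ^ D X ^ D`, is finitely generated,
    -- nonzero and stable under multiplication by `x X`.
    let N : Submodule S K[X] := Submodule.span S ((fun m ↦ C m * X ^ D) '' (M ^ D : Submodule F K))
    have hN1 : X ^ D ∈ N := Submodule.subset_span ⟨1, by
      have := Submodule.pow_mem_pow M h1M D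
      rwa [one_pow] at this, by simp⟩
    refine isIntegral_of_smul_mem_submodule N ?_ ?_ _ ?_
    · intro hN
      rw [hN, Submodule.mem_bot] at hN1
      exact pow_ne_zero D X_ne_zero hN1
    · obtain ⟨t, ht⟩ := hMfg.pow D
      refine ⟨t.image fun m ↦ C m * X ^ D, le_antisymm (Submodule.span_mono ?_)
        (Submodule.span_le.mpr ?_)⟩
      · rw [Finset.coe_image]
        exact Set.image_mono (ht ▸ Submodule.subset_span)
      · rintro _ ⟨m, hm, rfl⟩
        rw [← ht] at hm
        change C m * X ^ D ∈ Submodule.span S _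
        induction hm using Submodule.span_induction with
        | mem m hm => exact Submodule.subset_span (Finset.mem_image_of_mem _ hm)
        | zero => simp
        | add a b _ _ ha hb => rw [C_add, add_mul]; exact add_mem ha hb
        | smul c a _ ha =>
          have := Submodule.smul_mem _ (algebraMap F S c) ha
          rw [algebraMap_smul] at this
          rwa [← smul_C, smul_mul_assoc]
    · intro n hn
      induction hn using Submodule.span_induction with
      | zero => rw [smul_zero]; exact zero_mem _
      | add a b _ _ ha hb => rw [smul_add]; exact add_mem ha hb
      | smul c a _ ha => rw [smul_comm]; exact Submodule.smul_mem _ c ha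
      | mem n hn =>
        obtain ⟨m, hm, rfl⟩ := hn
        have key : ∀ y ∈ M ^ (D + 1), C y * X ^ (D + 1) ∈ N := by
          intro y hy
          rw [pow_succ'] at hy
          induction hy using Submodule.mul_induction_on' with
          | mem_mul_mem a ha b hb =>
            rw [C_mul, pow_succ', mul_mul_mul_comm]
            exact Submodule.smul_mem _ (⟨_, hS1 a ha⟩ : S) (Submodule.subset_span ⟨b, hb, rfl⟩)
          | add a _ b _ ha hb => rw [C_add, add_mul]; exact add_mem ha hb
        have := key _ (hD m hm)
        rwa [C_mul, pow_succ, mul_mul_mul_comm, mul_comm] at this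
  let E := FractionRing K[X]
  let ι' : K[X] →ₐ[F] E := Algebra.algHom F K[X] E
  have hι : Function.Injective ι' := IsFractionRing.injective K[X] E
  have hSfg : S.FG := Subalgebra.fg_def.mpr ⟨_, Set.finite_range _, rfl⟩
  have hSfg' : (S.map ι').FG := hSfg.map ι'
  obtain ⟨T, hT, hTint⟩ := hSfg'.exists_fg_of_isIntegral
  have hmem : ∀ x ∈ V, ι' (C x * X) ∈ T := by
    intro x hx
    -- Since `r j = 1`, this gives `x ∈ M ^ (N + 1)`. Both `X ^ N` and `X ^ N (x X)` then lie in
    -- `S`, so `x X` is a fraction of elements of `S`.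
    obtain ⟨N, hN⟩ := h x hx j
    rw [hj, one_pow, one_mul] at hN
    refine hTint _ ?_ ⟨_, ⟨_, hSd _ _ hN, rfl⟩, ι' (X ^ N), ⟨X ^ N, ?_, rfl⟩, ?_, ?_⟩
    · obtain ⟨p, hp, hp'⟩ := hint x hx
      let e : S →+* S.map ι' := (ι'.toRingHom.restrict S (S.map ι') fun s hs ↦ ⟨s, hs, rfl⟩)
      refine ⟨p.map e, hp.map e, ?_⟩
      rw [eval₂_map]
      have := congrArg ι' hp'
      rw [map_zero, ← AlgHom.coe_toRingHom, hom_eval₂] at this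
      exact this
    · have := hSd N 1 (by
        have := Submodule.pow_mem_pow M h1M N
        rwa [one_pow] at this)
      rwa [C_1, one_mul] at this
    · exact (map_ne_zero_iff _ hι).mpr (pow_ne_zero N X_ne_zero)
    · rw [← map_mul]
      exact congrArg ι' (by ring)
  have : Algebra.FiniteType F (S.map ι') := (S.map ι').fg_iff_finiteType.mp hSfg'
  have : IsNoetherianRing (S.map ι') := Algebra.FiniteType.isNoetherianRing F _
  have hspan : (Submodule.span (S.map ι') ((fun x ↦ ι' (C x * X)) '' (V : Set K))).FG :=
    Submodule.FG.of_le (T := T) hT (Submodule.span_le.mpr (by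
      rintro _ ⟨x, hx, rfl⟩
      exact hmem x hx))
  obtain ⟨t, ht, ht'⟩ := (Submodule.fg_span_iff_fg_span_finset_subset _).mp hspan
  obtain ⟨V₀, hV₀, rfl⟩ := Finset.subset_set_image_iff.mp ht
  -- Comparison of degree-one coefficients: only the constant terms of the coefficients in `S`
  -- contribute, and these are scalars by `hS0`. Finite generation over `S` thus becomes finite
  -- generation over `F`.
  have hcoeff : ∀ z ∈ Submodule.span (S.map ι')
      ((V₀.image fun x ↦ ι' (C x * X) : Finset E) : Set E),
      ∃ p : K[X], ι' p = z ∧ p.coeff 0 = 0 ∧ p.coeff 1 ∈ Submodule.span F (V₀ : Set K) := by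
    intro z hz
    induction hz using Submodule.span_induction with
    | mem z hz =>
      obtain ⟨x, hx, rfl⟩ := Finset.mem_image.mp hz
      refine ⟨_, rfl, coeff_mul_X_zero _, ?_⟩
      rw [coeff_C_mul, coeff_X_one, mul_one]
      exact Submodule.subset_span hx
    | zero => exact ⟨0, map_zero _, coeff_zero _, by rw [coeff_zero]; exact zero_mem _⟩
    | add a b _ _ ha hb =>
      obtain ⟨p, rfl, hp, hp'⟩ := ha
      obtain ⟨q, rfl, hq, hq'⟩ := hb
      exact ⟨p + q, map_add _ _ _, by rw [coeff_add, hp, hq, add_zero], by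
        rw [coeff_add]; exact add_mem hp' hq'⟩
    | smul c a _ ha =>
      obtain ⟨p, rfl, hp, hp'⟩ := ha
      obtain ⟨_, s, hs, rfl⟩ := c
      obtain ⟨c, hc⟩ := hS0 s hs
      refine ⟨s * p, map_mul _ _ _, by rw [mul_coeff_zero, hp, mul_zero], ?_⟩
      rw [mul_coeff_one, hp, mul_zero, add_zero, ← hc, ← Algebra.smul_def]
      exact Submodule.smul_mem _ c hp'
  have hle : V ≤ Submodule.span F (V₀ : Set K) := by
    intro x hx
    obtain ⟨p, hp, -, hp'⟩ := hcoeff (ι' (C x * X)) (by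
      rw [← ht']
      exact Submodule.subset_span ⟨x, hx, rfl⟩)
    rw [hι hp, coeff_C_mul, coeff_X_one, mul_one] at hp'
    exact hp'
  have : FiniteDimensional F (Submodule.span F (V₀ : Set K)) :=
    FiniteDimensional.span_of_finite F V₀.finite_toSet
  exact Submodule.finiteDimensional_of_le hle

/-! ### Sections of line bundles on projective varieties -/

section Proj

open HomogeneousLocalization (Away fromZeroRingHom)

variable {A σ : Type} [CommRing A] [SetLike σ A] [AddSubgroupClass σ A] (𝒜 : ℕ → σ)
  [GradedRing 𝒜] {f : A} {d : ℕ}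

/-- The function `a / f ^ n` on `D(f)` vanishes at the points at which `a` vanishes. -/
theorem Proj.basicOpen_awayToSection_mk_le (hf : f ∈ 𝒜 d) (n : ℕ) (a : A) (ha : a ∈ 𝒜 (n • d)) :
    (Proj 𝒜).basicOpen (U := Proj.basicOpen 𝒜 f) (Proj.awayToSection 𝒜 f (Away.mk 𝒜 hf n a ha)) ≤
      Proj.basicOpen 𝒜 a := by
  intro x hx
  have hxf : x ∈ Proj.basicOpen 𝒜 f := (Proj 𝒜).basicOpen_le _ hx
  have hprime : x.asHomogeneousIdeal.toIdeal.IsPrime := x.isPrime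
  have hxf' : f ∈ x.asHomogeneousIdeal.toIdeal.primeCompl := hxf
  rw [Scheme.mem_basicOpen (hx := hxf)] at hx
  set z := Away.mk 𝒜 hf n a ha
  have h : (Proj 𝒜).presheaf.germ _ x hxf (Proj.awayToSection 𝒜 f z) =
      (Proj.stalkIso' 𝒜 x).symm (HomogeneousLocalization.mapId 𝒜 (Submonoid.powers_le.mpr hxf') z) :=
    congr($(ProjectiveSpectrum.Proj.awayToSection_germ 𝒜 f x hxf) z)
  rw [h] at hx
  have h2 := (MulEquiv.isUnit_map (Proj.stalkIso' 𝒜 x).symm).mp hx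
  rw [← HomogeneousLocalization.isUnit_iff_isUnit_val] at h2
  intro (hl : a ∈ x.asHomogeneousIdeal)
  have h3 : (HomogeneousLocalization.mapId 𝒜 (Submonoid.powers_le.mpr hxf') z).val =
    Localization.mk a ⟨f ^ n, pow_mem hxf' n⟩ := rfl
  rw [h3, Localization.mk_eq_mk'] at h2
  exact (IsLocalization.AtPrime.isUnit_mk'_iff (Localization.AtPrime x.asHomogeneousIdeal.toIdeal)
    x.asHomogeneousIdeal.toIdeal a _).mp h2 hl

/-- Over `D(f)` the morphism to the spectrum of the degree-zero ring is induced by the inclusion of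
constants. This matches scalars on the chart with scalars in the localization. -/
theorem Proj.toSpecZero_appTop_restrict (hf : f ∈ 𝒜 d) (hd : 0 < d) (c : 𝒜 0) :
    (Proj 𝒜).presheaf.map (homOfLE le_top : Proj.basicOpen 𝒜 f ⟶ ⊤).op
      ((Proj.toSpecZero 𝒜).appTop ((Scheme.ΓSpecIso _).inv c)) =
    Proj.awayToSection 𝒜 f (fromZeroRingHom 𝒜 _ c) := by
  have h1 : (Proj.basicOpen 𝒜 f).ι ≫ Proj.toSpecZero 𝒜 =
      Proj.basicOpenToSpec 𝒜 f ≫ Spec.map (CommRingCat.ofHom (fromZeroRingHom 𝒜 _)) := by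
    rw [← Proj.awayι_toSpecZero 𝒜 f hf hd, ← Proj.basicOpenIsoSpec_inv_ι,
      ← Proj.basicOpenIsoSpec_hom 𝒜 f hf hd, Category.assoc, Iso.hom_inv_id_assoc]
  have h3 := congr((Scheme.ΓSpecIso _).inv ≫ Scheme.Hom.appTop $h1 ≫
    (Proj.basicOpen 𝒜 f).topIso.hom)
  rw [Scheme.Hom.comp_appTop, Scheme.Hom.comp_appTop,
    Scheme.Hom.appTop.eq_def (Proj.basicOpenToSpec _ _), Proj.basicOpenToSpec_app_top] at h3
  have h4 : (Proj.basicOpen 𝒜 f).ι.appTop ≫ (Proj.basicOpen 𝒜 f).topIso.hom =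
      (Proj 𝒜).presheaf.map (homOfLE le_top).op := by
    rw [Scheme.Opens.ι_appTop, Scheme.Opens.topIso_hom]
    exact ((Proj 𝒜).presheaf.map_comp _ _).symm
  rw [Category.assoc, h4] at h3
  refine congr($h3 c).trans ?_
  rw [Category.assoc, Category.assoc, Category.assoc, Iso.inv_hom_id, Category.comp_id,
    ← Scheme.ΓSpecIso_inv_naturality_assoc, Iso.inv_hom_id_assoc]
  rfl

end Proj

/-! ### Coordinates on projective space and finiteness of `H⁰(X, L)` -/

namespace SchemePair

open MvPolynomial (homogeneousSubmodule isHomogeneous_X)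
open HomogeneousLocalization (Away fromZeroRingHom)

theorem projSpace_basicOpen_projRatio_le (n : ℕ) (l j : Fin (n + 1)) :
    (projSpace n).basicOpen (projRatio n l j) ≤ projChart n l :=
  Proj.basicOpen_awayToSection_mk_le _ _ _ _ _

/-- `x_m / x_j` as an element of the degree zero part of the localization. -/
def awayRatio (n : ℕ) (m j : Fin (n + 1)) :
    Away (homogeneousSubmodule (Fin (n + 1)) ℂ) (MvPolynomial.X j) :=
  Away.mk _ ((MvPolynomial.mem_homogeneousSubmodule 1 _).mpr (isHomogeneous_X ℂ j)) 1
    (MvPolynomial.X m) ((MvPolynomial.mem_homogeneousSubmodule _ _).mpr (isHomogeneous_X ℂ m))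

theorem val_awayRatio_mul {n : ℕ} (m j : Fin (n + 1)) :
    (awayRatio n m j).val * algebraMap _ _ (MvPolynomial.X j : MvPolynomial (Fin (n + 1)) ℂ) =
      algebraMap _ _ (MvPolynomial.X m : MvPolynomial (Fin (n + 1)) ℂ) := by
  rw [awayRatio, Away.val_mk, Localization.mk_eq_mk',
    ← IsLocalization.eq_mk'_iff_mul_eq (y := ⟨_, Submonoid.mem_powers _⟩)]
  congr 2
  exact pow_one _

/-- Dehomogenisation: `f / x_j ^ N` is the value of `f` at the ratios `x_m / x_j`, as every monomial
of `f` has degree `N`. -/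
theorem eval₂_eq_awayMk {n : ℕ} (j : Fin (n + 1))
    (hj : MvPolynomial.X j ∈ homogeneousSubmodule (Fin (n + 1)) ℂ 1) (N : ℕ)
    (f : MvPolynomial (Fin (n + 1)) ℂ)
    (hf : f ∈ homogeneousSubmodule (Fin (n + 1)) ℂ (N • 1)) :
    MvPolynomial.eval₂ ((fromZeroRingHom (homogeneousSubmodule (Fin (n + 1)) ℂ)
        (.powers (MvPolynomial.X j))).comp (algebraMap ℂ (homogeneousSubmodule (Fin (n + 1)) ℂ 0)))
      (fun m ↦ awayRatio n m j) f =
    Away.mk (homogeneousSubmodule (Fin (n + 1)) ℂ) hj N f hf := by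
  apply HomogeneousLocalization.val_injective
  rw [MvPolynomial.eval₂_eq', Away.val_mk]
  have hv : ∀ z, HomogeneousLocalization.val z =
      algebraMap (Away (homogeneousSubmodule (Fin (n + 1)) ℂ) (MvPolynomial.X j))
        (Localization.Away (MvPolynomial.X j : MvPolynomial (Fin (n + 1)) ℂ)) z := fun z ↦ rfl
  rw [hv, map_sum, Localization.mk_eq_mk', IsLocalization.eq_mk'_iff_mul_eq, Finset.sum_mul]
  conv_rhs => rw [f.as_sum, map_sum]
  refine Finset.sum_congr rfl fun d hd ↦ ?_
  have hdN : ∑ i, d i = N := by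
    have := hf (MvPolynomial.mem_support_iff.mp hd)
    rw [Finsupp.weight_apply, Finsupp.sum_fintype _ _ (by simp)] at this
    simpa using this
  rw [map_mul, map_prod, MvPolynomial.monomial_eq, map_mul,
    Finsupp.prod_fintype _ _ (fun _ ↦ pow_zero _), map_prod]
  change _ * _ * algebraMap _ _ (MvPolynomial.X j ^ N) = _
  rw [← hdN, ← Finset.prod_pow_eq_pow_sum, map_prod, mul_assoc, ← Finset.prod_mul_distrib]
  refine congr_arg₂ _ ?_ ?_
  · change Localization.mk (MvPolynomial.C _) 1 = _
    exact Localization.mk_one_eq_algebraMap _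
  · refine Finset.prod_congr rfl fun i _ ↦ ?_
    rw [map_pow, map_pow, map_pow, ← mul_pow, ← hv, val_awayRatio_mul]

theorem projSpaceStr_appTop_restrict (n : ℕ) (j : Fin (n + 1)) (c : ℂ) :
    (projSpace n).presheaf.map (homOfLE le_top : projChart n j ⟶ ⊤).op
      ((projSpaceStr n).appTop ((Scheme.ΓSpecIso (CommRingCat.of ℂ)).inv c)) =
    Proj.awayToSection (homogeneousSubmodule (Fin (n + 1)) ℂ) (MvPolynomial.X j)
      (fromZeroRingHom _ _ (algebraMap ℂ (homogeneousSubmodule (Fin (n + 1)) ℂ 0) c)) := by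
  rw [projSpaceStr, Scheme.Hom.comp_appTop, CommRingCat.comp_apply]
  refine Eq.trans ?_ (Proj.toSpecZero_appTop_restrict _
    ((MvPolynomial.mem_homogeneousSubmodule 1 _).mpr (isHomogeneous_X ℂ j)) one_pos _)
  congr 2
  exact congr($(Scheme.ΓSpecIso_inv_naturality (CommRingCat.ofHom
    (algebraMap ℂ (homogeneousSubmodule (Fin (n + 1)) ℂ 0)))).hom c).symm

/-- A regular function on `{x_j ≠ 0}` is a homogeneous polynomial in the functions `x_m / x_j`. -/
theorem exists_map_mem_span_pow {n : ℕ} (j : Fin (n + 1)) {K : Type*} [CommRing K] [Algebra ℂ K]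
    (Φ : Γ(projSpace n, projChart n j) →+* K)
    (hΦ : ∀ c : ℂ, Φ ((projSpace n).presheaf.map (homOfLE le_top : projChart n j ⟶ ⊤).op
      ((projSpaceStr n).appTop ((Scheme.ΓSpecIso (CommRingCat.of ℂ)).inv c))) = algebraMap ℂ K c)
    (z : Γ(projSpace n, projChart n j)) :
    ∃ N, Φ z ∈ Submodule.span ℂ (Set.range fun m ↦ Φ (projRatio n m j)) ^ N := by
  have hj := (MvPolynomial.mem_homogeneousSubmodule 1 _).mpr (isHomogeneous_X ℂ j)
  obtain ⟨y, rfl⟩ : ∃ y, Proj.awayToSection _ _ y = z :=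
    ⟨(Proj.basicOpenIsoAway _ _ hj one_pos).inv z,
      congr($((Proj.basicOpenIsoAway _ _ hj one_pos).inv_hom_id) z)⟩
  obtain ⟨N, f, hf, rfl⟩ := Away.mk_surjective _ hj y
  let Ψ : Away (homogeneousSubmodule (Fin (n + 1)) ℂ) (MvPolynomial.X j) →+* K :=
    Φ.comp (Proj.awayToSection _ _).hom
  have hΨ : ∀ c : ℂ, Ψ (fromZeroRingHom _ _
      (algebraMap ℂ (homogeneousSubmodule (Fin (n + 1)) ℂ 0) c)) = algebraMap ℂ K c := fun c ↦
    (congrArg Φ (projSpaceStr_appTop_restrict n j c)).symm.trans (hΦ c)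
  refine ⟨N, ?_⟩
  change Ψ _ ∈ Submodule.span ℂ (Set.range fun m ↦ Ψ (awayRatio n m j)) ^ N
  rw [← eval₂_eq_awayMk, MvPolynomial.eval₂_eq', map_sum]
  refine Submodule.sum_mem _ fun d hd ↦ ?_
  have hdN : ∑ i, d i = N := by
    have := hf (MvPolynomial.mem_support_iff.mp hd)
    rw [Finsupp.weight_apply, Finsupp.sum_fintype _ _ (by simp)] at this
    simpa using this
  rw [map_mul, RingHom.comp_apply, hΨ, ← Algebra.smul_def, map_prod, ← hdN]
  simp only [map_pow]
  exact Submodule.smul_mem _ _ (Submodule.prod_pow_mem_pow_sum _ _ fun m _ ↦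
    Submodule.subset_span ⟨m, rfl⟩)

theorem app_projSpaceStr (P : SchemePair) {n : ℕ} (i : P.X ⟶ projSpace n)
    (hi : i ≫ projSpaceStr n = P.str) (j : Fin (n + 1)) (c : ℂ) :
    i.app (projChart n j) ((projSpace n).presheaf.map (homOfLE le_top : projChart n j ⟶ ⊤).op
      ((projSpaceStr n).appTop ((Scheme.ΓSpecIso (CommRingCat.of ℂ)).inv c))) =
      algebraMap ℂ Γ(P.X, i ⁻¹ᵁ projChart n j) c := by
  have h : ∀ (f : P.X ⟶ Spec (CommRingCat.of ℂ)), f = P.str →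
      ∀ z, f.appTop z = P.str.appTop z := by
    rintro f rfl z
    rfl
  rw [algebraMap_def, ← h _ hi, Scheme.Hom.comp_appTop, ← CommRingCat.comp_apply,
    Scheme.Hom.naturality]
  rfl

/-- Change of frame for the coefficients of a section of `L^k`. -/
theorem coeff_eq_pow_mul (P : SchemePair) {k : ℕ} (t : P.H0 k) {W : P.X.Opens} (f g : Frames P.L W)
    (a : Γ(P.X, W)) (ha : a • f.1 = g.1) : t.1 W f = a ^ k * t.1 W g := by
  have bij : ∀ f : Frames P.L W, Function.Bijective fun a : Γ(P.X, W) ↦ a • f.1 := fun f ↦ by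
    have h := f.2 W le_rfl
    rwa [show (homOfLE (le_refl W)).op = 𝟙 _ from rfl, P.L.presheaf.map_id] at h
  obtain ⟨b, hb⟩ := (bij g).2 f.1
  have hab : b * a = 1 := (bij f).1 (by
    change (b * a) • f.1 = (1 : Γ(P.X, W)) • f.1
    rw [mul_smul, one_smul]
    exact (congrArg (b • ·) ha).trans hb)
  let u : Γ(P.X, W)ˣ := ⟨a, b, by rw [mul_comm, hab], hab⟩
  have hg : g = f.smul u := Subtype.ext ha.symm
  rw [hg]
  exact t.2.2 W f u

theorem exists_mem_projChart {n : ℕ} (x : projSpace n) : ∃ j, x ∈ projChart n j := by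
  have h := Proj.iSup_basicOpen_eq_top' (homogeneousSubmodule (Fin (n + 1)) ℂ)
    (MvPolynomial.X (R := ℂ))
    (fun j ↦ ⟨1, (MvPolynomial.mem_homogeneousSubmodule 1 _).mpr (isHomogeneous_X ℂ j)⟩) (by
      refine eq_top_iff.mpr fun f _ ↦ ?_
      induction f using MvPolynomial.induction_on with
      | C c =>
        exact Subalgebra.algebraMap_mem _ (algebraMap ℂ (homogeneousSubmodule (Fin (n + 1)) ℂ 0) c)
      | add p q hp hq => exact add_mem (hp trivial) (hq trivial)
      | mul_X p i hp => exact mul_mem (hp trivial) (Algebra.subset_adjoin ⟨i, rfl⟩))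
  exact Opens.mem_iSup.mp (h.symm ▸ trivial : x ∈ ⨆ j, Proj.basicOpen _ (MvPolynomial.X j))

/-- The space of global sections of a very ample line bundle on a projective variety is
finite-dimensional. -/
theorem finiteDimensional_H0_one {P : SchemePair} (hP : P.IsPolarisedVariety) :
    FiniteDimensional ℂ (P.H0 1) := by
  have hint := hP.isIntegral
  obtain ⟨n, i, s, hi, hstr, hs⟩ := hP.isVeryAmple
  let η := genericPoint P.X
  let K := P.X.functionField
  let U : Fin (n + 1) → P.X.Opens := fun j ↦ i ⁻¹ᵁ projChart n j
  let e : ∀ j, Frames P.L (U j) := fun j ↦ ⟨_, (hs j).1⟩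
  obtain ⟨j, hj⟩ : ∃ j, η ∈ U j := exists_mem_projChart (i η)
  let γ : ∀ W : P.X.Opens, η ∈ W → Γ(P.X, W) →+* K := fun W hW ↦ (P.X.presheaf.germ W η hW).hom
  have hγinj : ∀ W hW, Function.Injective (γ W hW) := fun W hW ↦
    germ_injective_of_isIntegral P.X η hW
  have hγres : ∀ {W W' : P.X.Opens} (h : W' ≤ W) (hW' : η ∈ W') (a : Γ(P.X, W)),
      γ W' hW' (P.X.presheaf.map (homOfLE h).op a) = γ W (h hW') a := fun h hW' a ↦
    P.X.presheaf.germ_res_apply (homOfLE h) η hW' a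
  let : Algebra ℂ K := ((γ ⊤ trivial).comp (algebraMap ℂ Γ(P.X, ⊤))).toAlgebra
  have hγalg : ∀ W hW c, γ W hW (algebraMap ℂ Γ(P.X, W) c) = algebraMap ℂ K c := fun W hW c ↦ by
    rw [← map_algebraMap P (le_top : W ≤ ⊤), hγres]
    rfl
  have hratio : ∀ (l m : Fin (n + 1)), P.L.presheaf.map (homOfLE le_top).op (s l) =
    i.app (projChart n m) (projRatio n l m) • (e m).1 := fun l m ↦ (hs m).2 l
  have hframe : ∀ (l m : Fin (n + 1)) (W : P.X.Opens) (hl : W ≤ U l) (hm : W ≤ U m),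
      P.X.presheaf.map (homOfLE hm).op (i.app (projChart n m) (projRatio n l m)) •
        ((e m).restrict hm).1 = ((e l).restrict hl).1 := by
    intro l m W hl hm
    have := congr(P.L.presheaf.map (homOfLE hm).op $(hratio l m))
    rw [Scheme.Modules.map_smul] at this
    refine this.symm.trans ?_
    change _ = P.L.presheaf.map (homOfLE hl).op (P.L.presheaf.map (homOfLE le_top).op (s l))
    rw [← ConcreteCategory.comp_apply, ← ConcreteCategory.comp_apply, ← Functor.map_comp,
      ← Functor.map_comp]
    rfl
  have hτ : ∀ (t : P.H0 1) (l m : Fin (n + 1)) (hl : η ∈ U l) (hm : η ∈ U m),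
      γ _ hm (t.1 _ (e m)) = γ _ hm (i.app (projChart n m) (projRatio n l m)) *
        γ _ hl (t.1 _ (e l)) := by
    intro t l m hl hm
    have h := coeff_eq_pow_mul P t _ _ _ (hframe l m (U l ⊓ U m) inf_le_left inf_le_right)
    rw [t.2.1, t.2.1, pow_one] at h
    have hlm : η ∈ U l ⊓ U m := ⟨hl, hm⟩
    have h' := congr(γ (U l ⊓ U m) hlm $h)
    rwa [map_mul, hγres, hγres, hγres] at h'
  -- The rational functions `x_l / x_j` on `X`, for a chart `j` that contains the generic point.
  let r : Fin (n + 1) → K := fun l ↦ γ _ hj (i.app (projChart n j) (projRatio n l j))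
  have hcoeff : ∀ l m : Fin (n + 1), (P.ofGlobal (s l)).1 _ (e m) =
      i.app (projChart n m) (projRatio n l m) := by
    intro l m
    have h := (e m).2 (U m) le_rfl
    rw [show (homOfLE (le_refl (U m))).op = 𝟙 _ from rfl, P.L.presheaf.map_id] at h
    exact h.1 ((ofGlobal_smul P (s l) _ (e m)).trans (hratio l m))
  have hr : ∀ (m l : Fin (n + 1)) (hl : η ∈ U l), r m =
      γ _ hl (i.app (projChart n l) (projRatio n m l)) * r l := by
    intro m l hl
    have h := hτ (P.ofGlobal (s m)) l j hl hj
    rw [hcoeff, hcoeff] at h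
    rw [mul_comm]
    exact h
  have hrj : r j = 1 := by
    have h := (e j).2 (U j) le_rfl
    rw [show (homOfLE (le_refl (U j))).op = 𝟙 _ from rfl, P.L.presheaf.map_id] at h
    have h1 : i.app (projChart n j) (projRatio n j j) = 1 :=
      h.1 ((hratio j j).symm.trans (one_smul _ (e j).1).symm)
    exact (congrArg (γ _ hj) h1).trans (map_one (γ _ hj))
  -- If `x_l / x_j` were nonzero in the function field, `x_l` would not vanish at the generic point.
  have hr0 : ∀ l, η ∉ U l → r l = 0 := by
    intro l hl
    by_contra hne
    refine hl (projSpace_basicOpen_projRatio_le n l j ?_)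
    have h : η ∈ P.X.basicOpen (i.app (projChart n j) (projRatio n l j)) := by
      rw [Scheme.mem_basicOpen (hx := hj)]
      exact IsUnit.mk0 _ hne
    rwa [← Scheme.preimage_basicOpen] at h
  -- The rational function `t / s_j`; it determines `t` because `X` is integral and `s_j` is a frame
  -- near the generic point.
  let T : P.H0 1 →ₗ[ℂ] K :=
    { toFun t := γ _ hj (t.1 _ (e j))
      map_add' x y := map_add (γ _ hj) _ _
      map_smul' c x := by
        change γ _ hj (c • x.1 _ (e j)) = c • γ _ hj (x.1 _ (e j))
        rw [Algebra.smul_def, Algebra.smul_def, map_mul, hγalg] }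
  have hT : Function.Injective T := by
    rw [injective_iff_map_eq_zero]
    intro t ht
    have ht' : t.1 _ (e j) = 0 := hγinj _ hj (ht.trans (map_zero _).symm)
    refine Subtype.ext (funext fun W ↦ funext fun f ↦ ?_)
    by_cases hW : η ∈ W
    · obtain ⟨a, ha⟩ := (f.2 (W ⊓ U j) inf_le_left).2 ((e j).restrict inf_le_right).1
      have h := coeff_eq_pow_mul P t (f.restrict inf_le_left) _ a ha
      rw [t.2.1, t.2.1, ht', map_zero, mul_zero] at h
      refine hγinj _ hW ?_
      rw [← hγres (inf_le_left : W ⊓ U j ≤ W) ⟨hW, hj⟩, h, map_zero]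
      exact (map_zero _).symm
    · obtain rfl : W = ⊥ := by
        by_contra hne
        exact hW (((genericPoint_spec P.X).mem_open_set_iff W.isOpen).mpr (by
          rw [Set.univ_inter]
          exact Set.nonempty_iff_ne_empty.mpr fun h ↦ hne (Opens.ext h)))
      exact Subsingleton.elim _ _
  have key : ∀ x ∈ LinearMap.range T, ∀ l, ∃ N,
      r l ^ N * x ∈ Submodule.span ℂ (Set.range r) ^ (N + 1) := by
    rintro _ ⟨t, rfl⟩ l
    by_cases hl : η ∈ U l
    · have haff : IsAffineOpen (projChart n l) := Proj.isAffineOpen_basicOpen _ _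
        ((MvPolynomial.mem_homogeneousSubmodule 1 _).mpr (MvPolynomial.isHomogeneous_X ℂ l)) one_pos
      -- On the affine chart `l` the closed immersion lets `t / s_l` lift to projective space, where
      -- it is a polynomial of degree `N` in the `x_m / x_l`. Multiplication by `r l ^ N` clears the
      -- denominators, and `t / s_j = r l (t / s_l)` adds one degree.
      obtain ⟨z, hz⟩ := Scheme.Hom.app_surjective i (projChart n l) haff (t.1 _ (e l))
      obtain ⟨N, hN⟩ := exists_map_mem_span_pow l ((γ _ hl).comp (i.app (projChart n l)).hom)
        (fun c ↦ (congrArg _ (app_projSpaceStr P i hstr l c)).trans (hγalg _ hl c)) z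
      refine ⟨N, ?_⟩
      have h1 : T t = r l * γ _ hl (t.1 _ (e l)) := hτ t l j hl hj
      rw [h1, ← hz, mul_left_comm, pow_succ']
      refine Submodule.mul_mem_mul (Submodule.subset_span ⟨l, rfl⟩) ?_
      have h2 := Submodule.mul_mem_mul
        (Submodule.pow_mem_pow _ (Submodule.mem_span_singleton_self (R := ℂ) (r l)) N) hN
      rw [← mul_pow, Submodule.span_mul_span] at h2
      refine pow_le_pow_left' (Submodule.span_mono ?_) N h2
      rintro _ ⟨_, rfl, _, ⟨m, rfl⟩, rfl⟩
      exact ⟨m, (hr m l hl).trans (mul_comm _ _)⟩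
    · exact ⟨1, by rw [hr0 l hl, pow_one, zero_mul]; exact zero_mem _⟩
  have := finiteDimensional_of_pow_mul_mem r j hrj (LinearMap.range T) key
  exact Module.Finite.of_injective T.rangeRestrict fun x y h ↦ hT congr(Subtype.val $h)

/-! ### Products of sections -/

/-- The multiplication map `H⁰(X, L^k) × H⁰(X, L^m) → H⁰(X, L^(k + m))`. -/
def mulSections (P : SchemePair) (k m : ℕ) : P.H0 k →ₗ[ℂ] P.H0 m →ₗ[ℂ] P.H0 (k + m) :=
  LinearMap.mk₂ ℂ (fun s t ↦ ⟨fun U e ↦ s.1 U e * t.1 U e, fun U V h e ↦ by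
      beta_reduce
      rw [s.2.1 U V h e, t.2.1 U V h e, map_mul], fun U e u ↦ by
      beta_reduce
      rw [s.2.2 U e u, t.2.2 U e u, pow_add, mul_mul_mul_comm]⟩)
    (fun _ _ _ ↦ Subtype.ext (funext fun _ ↦ funext fun _ ↦ add_mul _ _ _))
    (fun c s t ↦ Subtype.ext (funext fun U ↦ funext fun e ↦
      smul_mul_assoc c (s.1 U e) (t.1 U e)))
    (fun _ _ _ ↦ Subtype.ext (funext fun _ ↦ funext fun _ ↦ mul_add _ _ _))
    (fun c s t ↦ Subtype.ext (funext fun U ↦ funext fun e ↦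
      mul_smul_comm c (s.1 U e) (t.1 U e)))

theorem mulSections_autAction (P : SchemePair) {k m : ℕ} (g : Aut P) (s : P.H0 k) (t : P.H0 m) :
    P.mulSections k m (P.autAction k g s) (P.autAction m g t) =
      P.autAction (k + m) g (P.mulSections k m s t) :=
  Subtype.ext (funext fun U ↦ funext fun _ ↦ (map_mul (pullbackFun g U).symm _ _).symm)

theorem prodSections_succ (P : SchemePair) (k : ℕ) (s : Fin (k + 1) → P.H0 1) :
    P.prodSections (k + 1) s =
      P.mulSections k 1 (P.prodSections k fun i ↦ s i.castSucc) (s (Fin.last k)) :=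
  Subtype.ext (funext fun _ ↦ funext fun _ ↦ Fin.prod_univ_castSucc _)

theorem IsProjectivelyNormal.span_mulSections {P : SchemePair} (hN : P.IsProjectivelyNormal)
    (k : ℕ) : Submodule.span ℂ {z | ∃ s t, P.mulSections k 1 s t = z} = ⊤ := by
  rw [eq_top_iff, ← hN (k + 1)]
  refine Submodule.span_mono ?_
  rintro _ ⟨s, rfl⟩
  exact ⟨_, _, (P.prodSections_succ k s).symm⟩

/-- By projective normality `H⁰(L^(k+1))` is a quotient of `H⁰(L^k) ⊗ H⁰(L)`. -/
theorem IsProjectivelyNormal.finiteDimensional_H0 {P : SchemePair} (hN : P.IsProjectivelyNormal)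
    [FiniteDimensional ℂ (P.H0 1)] (k : ℕ) : FiniteDimensional ℂ (P.H0 k) := by
  induction k with
  | zero =>
    refine ⟨(Submodule.fg_def).mpr ⟨_, Set.finite_range (P.prodSections 0), hN 0⟩⟩
  | succ k ih =>
    refine Module.Finite.of_surjective (TensorProduct.lift (P.mulSections k 1)) ?_
    rw [← LinearMap.range_eq_top, eq_top_iff, ← hN.span_mulSections k, Submodule.span_le]
    rintro _ ⟨s, t, rfl⟩
    exact ⟨TensorProduct.tmul ℂ s t, TensorProduct.lift.tmul s t⟩

/-! ### The bounds for the Loewy filtration of `H⁰(X, L^k)` -/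

theorem loewy_finrank (P : SchemePair) (k : ℕ) [FiniteDimensional ℂ (P.H0 k)] :
    P.loewy k (Module.finrank ℂ (P.H0 k)) = ⊥ := by
  have : FiniteDimensional ℂ (P.autAction k).asModule := ‹FiniteDimensional ℂ (P.H0 k)›
  exact loewyFiltration_finrank (A := MonoidAlgebra ℂ (Aut P)) (M := (P.autAction k).asModule)

/-- Multiplication of sections is equivariant and its values span, so subadditivity applies. -/
theorem loewy_add {P : SchemePair} (hN : P.IsProjectivelyNormal) [FiniteDimensional ℂ (P.H0 1)]
    {k a b : ℕ} (ha : P.loewy k a = ⊥) (hb : P.loewy 1 b = ⊥) : P.loewy (k + 1) (a + b) = ⊥ := by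
  have h1 : FiniteDimensional ℂ (P.autAction 1).asModule := ‹FiniteDimensional ℂ (P.H0 1)›
  have hk : FiniteDimensional ℂ (P.autAction k).asModule := hN.finiteDimensional_H0 k
  have hof : ∀ (m : ℕ) (g : Aut P) (x : (P.autAction m).asModule),
      MonoidAlgebra.of ℂ (Aut P) g • x = P.autAction m g x := fun m g x ↦ by
    rw [MonoidAlgebra.of_apply, Representation.single_smul, one_smul]
    rfl
  refine Chevalley.loewyFiltration_add_eq_bot (M := (P.autAction k).asModule)
    (N := (P.autAction 1).asModule) (Q := (P.autAction (k + 1)).asModule)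
    (P.mulSections k 1) (fun g x y ↦ ?_) (fun z ↦ ?_) ha hb
  · rw [hof, hof, hof]
    exact P.mulSections_autAction g x y
  · exact (hN.span_mulSections k).ge trivial

theorem loewy_mul {P : SchemePair} (hN : P.IsProjectivelyNormal) [FiniteDimensional ℂ (P.H0 1)]
    {k : ℕ} (hk : 1 ≤ k) : P.loewy k (P.h0 * k) = ⊥ := by
  induction k, hk using Nat.le_induction with
  | base => rw [mul_one]; exact P.loewy_finrank 1
  | succ k _ ih => exact loewy_add hN ih (P.loewy_finrank 1)

/-- Degree zero is separate because `C * 0 = 0` and `F 0` is the whole space. That space is spanned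
by the empty product, so its dimension is at most one. -/
theorem loewy_zero_one {P : SchemePair} (hN : P.IsProjectivelyNormal)
    [FiniteDimensional ℂ (P.H0 1)] : P.loewy 0 1 = ⊥ := by
  have := hN.finiteDimensional_H0 0
  have h : Module.finrank ℂ (P.H0 0) ≤ 1 := by
    refine finrank_le_one (P.prodSections 0 0) fun x ↦ ?_
    have hx : x ∈ Submodule.span ℂ (Set.range (P.prodSections 0)) := hN 0 ▸ trivial
    rw [Set.range_unique, Submodule.mem_span_singleton] at hx
    obtain ⟨c, hc⟩ := hx
    exact ⟨c, Subsingleton.elim (default : Fin 0 → P.H0 1) 0 ▸ hc⟩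
  exact le_bot_iff.mp ((loewyFiltration_antitone h).trans (P.loewy_finrank 0).le)

theorem ll_le {P : SchemePair} {k d : ℕ} (h : P.loewy k (d + 1) = ⊥) : P.ll k ≤ d := by
  refine iSup₂_le fun i hi ↦ Nat.cast_le.mpr ?_
  by_contra! hlt
  exact hi (le_bot_iff.mp ((loewyFiltration_antitone hlt).trans h.le))

end SchemePair

end

/-- The Loewy length of `H⁰(X, L^k)` is at most `h⁰(L) k`, and the Loewy filtration is linearly
right bounded. -/
theorem mainTheorem6 (P : SchemePair) (hP : P.IsPolarisedVariety)
    (hN : P.IsProjectivelyNormal) :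
    (∀ k : ℕ, P.ll k ≤ ((P.h0 * k : ℕ) : ℕ∞)) ∧
      ∀ k : ℕ, 1 ≤ k → P.loewy k (P.h0 * k) = ⊥ := by
  have := SchemePair.finiteDimensional_H0_one hP
  refine ⟨fun k ↦ SchemePair.ll_le ?_, fun k hk ↦ SchemePair.loewy_mul hN hk⟩
  -- The length bound only needs the step of index `C k + 1` to vanish: for `k ≥ 1` this is one more
  -- than necessary, while for `k = 0` it is the step of index one.
  rcases Nat.eq_zero_or_pos k with rfl | hk
  · exact SchemePair.loewy_zero_one hN
  · exact le_bot_iff.mp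
      ((loewyFiltration_antitone (Nat.le_succ _)).trans (SchemePair.loewy_mul hN hk).le)
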